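/- Let $M$ be a smooth (Hausdorff) manifold of dimension $n\ge 2$ with a projective structure $p$, i.e. a class of smooth torsion-free affine connections such that a smooth torsion-free connection $\widehat\nabla$ belongs to $p$ if and only if, for a given $\nabla\in p$, there is a smooth one-form $\Upsilon$ with $\widehat\nabla_aY^b=\nabla_aY^b+\Upsilon_aY^b+\Upsilon_cY^c\delta_a^b$. Let $\mathcal E(1)$ be the positive $(2n+2)$-th root of the line bundle $(\Lambda^nTM)^2$. Write $\mathcal E_a(1)=T^*M\otimes\mathcal E(1)$, and let $\mathcal T^*=J^1\mathcal E(1)$ be the cotractor bundle, with its jet exact sequence $0\to\mathcal E_a(1)\to\mathcal T^*\to\mathcal E(1)\to0$. Each $\nabla\in p$ induces a connection on $\mathcal E(1)$ and so a splitting $\mathcal T^*\cong\mathcal E_a(1)\oplus\mathcal E(1)$, $j^1s\mapsto(\nabla s\mid s)$. The normal tractor connection on $\mathcal T^*$ is $$\nabla_a(\mu_b\mid\sigma)=(\nabla_a\mu_b+P_{ab}\sigma\mid\nabla_a\sigma-\mu_a),\qquad (n-1)P_{ab}=\mathrm{Ric}_{ab}-(P_{ab}-P_{ba}),\qquad \mathrm{Ric}_{ab}=R_{ca}{}^c{}_b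 ;$$ it does not depend on the choice of $\nabla\in p$. The tractor bundle $\mathcal T=(\mathcal T^*)^*$ carries the dual connection. A sub-metric is a smooth field $h$ of symmetric bilinear forms on the fibres of $\mathcal T^*$ whose restriction to $\mathcal E_a(1)$ is nondegenerate at every point. A metric on $M$ means a smooth pseudo-Riemannian metric of any signature. A metric $g$ is Einstein if $\mathrm{Ric}=c\,g$ with $c$ locally constant (hence constant if $M$ is connected). Theorem. The sub-metrics on $\mathcal T^*$ that are parallel for the tractor connection are in one-to-one correspondence with the Einstein metrics on $M$ whose Levi-Civita connection lies in $p$. The correspondence can be chosen such that, if $h$ corresponds to $g$ and $s_g$ is the positive section of $\mathcal E(1)$ of unit length for $g$, then the restriction of $h$ to $\mathcal E_a(1)$, identified with $T^*M$ by means of $s_g$, is the inverse metric: $h(\alpha\otimes s_g,\beta\otimes s_g)=g^{ab}\alpha_a\beta_b$ for all one-forms $\alpha,\beta$. Moreover: 1. If $h$ corresponds to $g$, then $h$ is nondegenerate on the fibre $\mathcal T^*_x$ if and only if the Ricci tensor of $g$ does not vanish at $x$. In particular, if $M$ is connected and $g$ is not Ricci-flat, then $h$ is a metric on the bundle $\mathcal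 T^*$, i.e. nondegenerate at every point. 2. Those of the above Einstein metrics whose Ricci tensor vanishes at no point are in one-to-one correspondence with the smooth nondegenerate symmetric forms $H$ on $\mathcal T$ that are parallel for the tractor connection and whose inverse is a sub-metric on $\mathcal T^*$. Here $H$ corresponds to $g$ when $H$ is the inverse of the parallel sub-metric that corresponds to $g$. -/

import Mathlib

open Bundle Filter Topology
open scoped Manifold ContDiff

noncomputable section

namespace ProjTractor

/-! ## Projective densities of weight one -/

section Densities

variable {n : ℕ} {M : Type*} [TopologicalSpace M] [ChartedSpace (EuclideanSpace ℝ (Fin n)) M]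

/-- Top-degree forms on the tangent space at `x`, i.e. elements of `(Λⁿ TₓM)*`. -/
abbrev TopForm (n : ℕ) {M : Type*} [TopologicalSpace M]
    [ChartedSpace (EuclideanSpace ℝ (Fin n)) M] (x : M) : Type :=
  TangentSpace (𝓡 n) x [⋀^Fin n]→ₗ[ℝ] ℝ

/-- The functions on `(Λⁿ TₓM)*` that are homogeneous,
`φ (c η) = |c| ^ (2 / (2n+2)) φ η`. -/
def densitySubmodule (n : ℕ) {M : Type*} [TopologicalSpace M]
    [ChartedSpace (EuclideanSpace ℝ (Fin n)) M] (x : M) : Submodule ℝ (TopForm n x → ℝ) where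
  carrier := {φ | ∀ (c : ℝ) (η : TopForm n x), φ (c • η) = |c| ^ (1 / ((n : ℝ) + 1)) * φ η}
  add_mem' := by
    intro a b ha hb c η
    simp only [Set.mem_ofPred_eq, Pi.add_apply] at *
    rw [ha, hb]; ring
  zero_mem' := by intro c η; simp
  smul_mem' := by
    intro r a ha c η
    simp only [Set.mem_ofPred_eq, Pi.smul_apply, smul_eq_mul] at *
    rw [ha]; ring

/-- The fibre at `x` of the projective density bundle `ℰ(1)`, the positive `(2n+2)`-th root of
`(Λⁿ TM)²`: an element is a function on the dual line `(Λⁿ TₓM)*` that is homogeneous of degree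
`2 / (2n+2)` with respect to absolute values. -/
def Density (n : ℕ) {M : Type*} [TopologicalSpace M]
    [ChartedSpace (EuclideanSpace ℝ (Fin n)) M] (x : M) : Type :=
  ↥(densitySubmodule n x)

instance densityAddCommGroup (x : M) : AddCommGroup (Density n x) :=
  inferInstanceAs (AddCommGroup (densitySubmodule n x))

instance densityModule (x : M) : Module ℝ (Density n x) :=
  inferInstanceAs (Module ℝ (densitySubmodule n x))

/-- The positive density `|e₁ ∧ ⋯ ∧ eₙ| ^ (1/(n+1))` in `ℰ(1)ₓ`. -/
def tupleDensity {x : M} (e : Fin n → TangentSpace (𝓡 n) x) : Density n x :=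
  ⟨fun η => |η e| ^ (1 / ((n : ℝ) + 1)), by
    intro c η
    simp only [AlternatingMap.smul_apply, smul_eq_mul, abs_mul]
    rw [Real.mul_rpow (abs_nonneg _) (abs_nonneg _)]⟩

variable [IsManifold (𝓡 n) ∞ M]

/-- The coordinate vector field `∂ᵢ` of the preferred chart at `x`, evaluated at `y`
(zero when `y` lies outside the domain of that chart). -/
def coordField (x : M) (i : Fin n) : Π y : M, TangentSpace (𝓡 n) y :=
  (trivializationAt (EuclideanSpace ℝ (Fin n)) (TangentSpace (𝓡 n) : M → Type _) x).localFrame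
    (EuclideanSpace.basisFun (Fin n) ℝ).toBasis i

/-- The coordinate one-form `dxⁱ` of the preferred chart at `x`, evaluated at `y`
(zero when `y` lies outside the domain of that chart). -/
def coordForm (x : M) (i : Fin n) : Π y : M, TangentSpace (𝓡 n) y →ₗ[ℝ] ℝ :=
  (trivializationAt (EuclideanSpace ℝ (Fin n)) (TangentSpace (𝓡 n) : M → Type _)
    x).localFrameCoeff (𝓡 n) (EuclideanSpace.basisFun (Fin n) ℝ).toBasis i

/-- The coordinate volume form `dx¹ ∧ ⋯ ∧ dxⁿ` of the preferred chart at `x`, evaluated at `y`. -/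
def coordVol (x y : M) : TopForm n y :=
  (Pi.basisFun ℝ (Fin n)).det.compLinearMap (LinearMap.pi fun i => coordForm x i y)

/-- The basis of `TₓM` given by the coordinate vector fields of the preferred chart at `x`. -/
def coordBasis (x : M) : Module.Basis (Fin n) ℝ (TangentSpace (𝓡 n) x) :=
  (trivializationAt (EuclideanSpace ℝ (Fin n)) (TangentSpace (𝓡 n) : M → Type _) x).basisAt
    (EuclideanSpace.basisFun (Fin n) ℝ).toBasis (mem_baseSet_trivializationAt _ _ x)

/-- The density `|∂₁ ∧ ⋯ ∧ ∂ₙ| ^ (1/(n+1))` of the preferred chart at `x`, evaluated at `y`. -/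
def coordDensity (x y : M) : Density n y := tupleDensity fun i : Fin n => coordField x i y

/-- The component function `y ↦ σ_y (dx¹ ∧ ⋯ ∧ dxⁿ)` of a section `σ` of `ℰ(1)` in the preferred
chart at `x`; on the domain of that chart `σ = coeff x σ • coordDensity x`. -/
def coeff (x : M) (σ : Π y : M, Density n y) (y : M) : ℝ := (σ y).1 (coordVol x y)

lemma coordBasis_apply (x : M) (i : Fin n) : coordBasis x i = coordField x i x := by
  exact ((trivializationAt (EuclideanSpace ℝ (Fin n)) (TangentSpace (𝓡 n) : M → Type _)
    x).localFrame_apply_of_mem_baseSet (EuclideanSpace.basisFun (Fin n) ℝ).toBasis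
    (mem_baseSet_trivializationAt _ _ x)).symm

lemma coordForm_coordField {x y : M} (hy : y ∈ (trivializationAt (EuclideanSpace ℝ (Fin n))
    (TangentSpace (𝓡 n) : M → Type _) x).baseSet) (i j : Fin n) :
    coordForm x i y (coordField x j y) = if i = j then 1 else 0 := by
  have := Trivialization.localFrameCoeff_apply_of_mem_baseSet (I := 𝓡 n)
    (trivializationAt (EuclideanSpace ℝ (Fin n)) (TangentSpace (𝓡 n) : M → Type _) x)
    (EuclideanSpace.basisFun (Fin n) ℝ).toBasis hy (coordField x j) i
  have h2 : coordField x j y = _ := (trivializationAt (EuclideanSpace ℝ (Fin n))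
    (TangentSpace (𝓡 n) : M → Type _) x).localFrame_apply_of_mem_baseSet
    (EuclideanSpace.basisFun (Fin n) ℝ).toBasis hy
  refine this.trans ?_
  rw [h2, Module.Basis.repr_self, Finsupp.single_apply]
  simp [eq_comm]

lemma coordVol_coordField {x y : M} (hy : y ∈ (trivializationAt (EuclideanSpace ℝ (Fin n))
    (TangentSpace (𝓡 n) : M → Type _) x).baseSet) :
    coordVol x y (fun i : Fin n => coordField x i y) = 1 := by
  have h : (fun j : Fin n => (LinearMap.pi fun i : Fin n => coordForm x i y) (coordField x j y))
      = (Pi.basisFun ℝ (Fin n)) := by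
    funext j i
    simp [coordForm_coordField hy, Pi.single_apply]
  have : coordVol x y (fun i : Fin n => coordField x i y)
      = (Pi.basisFun ℝ (Fin n)).det (fun j : Fin n => (LinearMap.pi fun i : Fin n => coordForm x i y)
        (coordField x j y)) := rfl
  rw [this, h, Module.Basis.det_self]

lemma coeff_smul_coordDensity {x y : M} (hy : y ∈ (trivializationAt (EuclideanSpace ℝ (Fin n))
    (TangentSpace (𝓡 n) : M → Type _) x).baseSet) (f : M → ℝ) :
    coeff x (fun y => f y • (coordDensity x y : Density n y)) y = f y := by
  have : coeff x (fun y => f y • coordDensity x y) y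
      = f y * |coordVol x y (fun i : Fin n => coordField x i y)| ^ (1 / ((n : ℝ) + 1)) := rfl
  rw [this, coordVol_coordField hy]; simp

/-- `ℰ(1)ₓ` is a line, spanned by the coordinate density. -/
lemma density_eq (x : M) (s : Density n x) : s = s.1 (coordVol (n := n) x x) • coordDensity (n := n) x x := by
  have hx := mem_baseSet_trivializationAt (EuclideanSpace ℝ (Fin n))
    (TangentSpace (𝓡 n) : M → Type _) x
  apply Subtype.ext
  funext η
  have hη : η = η (fun i : Fin n => coordField x i x) • coordVol x x := by
    have h1 := AlternatingMap.eq_smul_basis_det (coordBasis x) η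
    have h2 := AlternatingMap.eq_smul_basis_det (coordBasis (n := n) x) (coordVol x x)
    have hb : (coordBasis (n := n) x : Fin n → TangentSpace (𝓡 n) x) =
        fun i : Fin n => coordField x i x :=
      funext (coordBasis_apply x)
    rw [hb] at h1 h2
    rw [coordVol_coordField hx, one_smul] at h2
    rw [h2]; exact h1
  have hs := s.2 (η (fun i : Fin n => coordField x i x)) (coordVol x x)
  rw [← hη] at hs
  rw [hs, mul_comm]; rfl

end Densities

/-! ## The cotractor bundle as the first jet prolongation of `ℰ(1)` -/

section Jets

variable {n : ℕ} {M : Type*} [TopologicalSpace M] [ChartedSpace (EuclideanSpace ℝ (Fin n)) M]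
  [IsManifold (𝓡 n) ∞ M]

/-- The section `σ` of `ℰ(1)` is smooth on a neighbourhood of `x`. -/
def SmoothNear (σ : Π y : M, Density n y) (x : M) : Prop :=
  ∀ᶠ y in 𝓝 x, ContMDiffAt (𝓡 n) 𝓘(ℝ, ℝ) ∞ (coeff x σ) y

/-- The sections of `ℰ(1)` that are smooth on a neighbourhood of `x`. -/
def smoothSections (n : ℕ) {M : Type*} [TopologicalSpace M]
    [ChartedSpace (EuclideanSpace ℝ (Fin n)) M] [IsManifold (𝓡 n) ∞ M] (x : M) :
    Submodule ℝ (Π y : M, Density n y) where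
  carrier := {σ | SmoothNear σ x}
  add_mem' := by
    intro a b ha hb
    filter_upwards [ha, hb] with y h1 h2
    exact h1.add h2
  zero_mem' := by
    refine Eventually.of_forall fun y => ?_
    exact contMDiffAt_const (c := (0 : ℝ))
  smul_mem' := by
    intro r a ha
    filter_upwards [ha] with y h1
    exact contMDiffAt_const.mul h1

/-- The linear map `σ ↦ (dσ(x), σ(x))`, the derivative being taken in the preferred chart at `x`
(with the density bundle trivialised by the coordinate density). -/
def chartJet (x : M) : smoothSections n x →ₗ[ℝ]
    (TangentSpace (𝓡 n) x →ₗ[ℝ] Density n x) × Density n x where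
  toFun σ := ((mvfderiv (𝓡 n) (coeff x σ.1) x).toLinearMap.smulRight (coordDensity x x), σ.1 x)
  map_add' := by
    intro a b
    have ha : MDifferentiableAt (𝓡 n) 𝓘(ℝ, ℝ) (coeff x a.1) x :=
      (Eventually.self_of_nhds a.2).mdifferentiableAt (by simp)
    have hb : MDifferentiableAt (𝓡 n) 𝓘(ℝ, ℝ) (coeff x b.1) x :=
      (Eventually.self_of_nhds b.2).mdifferentiableAt (by simp)
    have h : mvfderiv (𝓡 n) (coeff x (a + b).1) x
        = mvfderiv (𝓡 n) (coeff x a.1) x + mvfderiv (𝓡 n) (coeff x b.1) x :=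
      mvfderiv_add ha hb
    ext1
    · ext v : 1
      exact (congrArg (fun L => L v • coordDensity (n := n) x x) h).trans (add_smul _ _ _)
    · rfl
  map_smul' := by
    intro r a
    have ha : MDifferentiableAt (𝓡 n) 𝓘(ℝ, ℝ) (coeff x a.1) x :=
      (Eventually.self_of_nhds a.2).mdifferentiableAt (by simp)
    have h : mvfderiv (𝓡 n) (coeff x (r • a).1) x = r • mvfderiv (𝓡 n) (coeff x a.1) x := by
      have := mvfderiv_smul (I := 𝓡 n) (x := x) (a := fun _ : M => r) (g := coeff x a.1)
        mdifferentiableAt_const ha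
      have h0 : mvfderiv (𝓡 n) (fun _ : M => r) x = 0 := mvfderiv_const r
      simp only [h0] at this
      have h2 : coeff x (r • a).1 = (fun _ : M => r) • coeff x a.1 := rfl
      rw [h2, this]
      ext v
      simp
    ext1
    · ext v : 1
      exact (congrArg (fun L => L v • coordDensity (n := n) x x) h).trans (mul_smul _ _ _)
    · rfl

lemma chartJet_surjective (x : M) : Function.Surjective (chartJet (n := n) x) := by
  rintro ⟨μ, s⟩
  set e := trivializationAt (EuclideanSpace ℝ (Fin n)) (TangentSpace (𝓡 n) : M → Type _) x
  have hx : x ∈ e.baseSet := mem_baseSet_trivializationAt _ _ x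
  let L : EuclideanSpace ℝ (Fin n) →ₗ[ℝ] ℝ :=
    { toFun := fun v => (μ v).1 (coordVol x x)
      map_add' := fun v w => congrArg (fun s : Density n x => s.1 (coordVol x x)) (μ.map_add v w)
      map_smul' := fun r v =>
        congrArg (fun s : Density n x => s.1 (coordVol x x)) (μ.map_smul r v) }
  let L' : EuclideanSpace ℝ (Fin n) →L[ℝ] ℝ := L.toContinuousLinearMap
  let f : M → ℝ := fun y =>
    s.1 (coordVol x x) + L' (extChartAt (𝓡 n) x y - extChartAt (𝓡 n) x x)
  let σ : Π y : M, Density n y := fun y => f y • coordDensity x y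
  have hcf : ∀ᶠ y in 𝓝 x, coeff x σ y = f y := by
    filter_upwards [e.open_baseSet.mem_nhds hx] with y hy
    exact coeff_smul_coordDensity hy f
  have hf : ∀ᶠ y in 𝓝 x, ContMDiffAt (𝓡 n) 𝓘(ℝ, ℝ) ∞ f y := by
    filter_upwards [(chartAt (EuclideanSpace ℝ (Fin n)) x).open_source.mem_nhds
      (mem_chart_source _ x)] with y hy
    have h1 : ContMDiffAt (𝓡 n) 𝓘(ℝ, EuclideanSpace ℝ (Fin n)) ∞ (extChartAt (𝓡 n) x) y :=
      contMDiffAt_extChartAt' hy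
    have h2 : ContMDiffAt (𝓡 n) 𝓘(ℝ, EuclideanSpace ℝ (Fin n)) ∞
        (fun y => extChartAt (𝓡 n) x y - extChartAt (𝓡 n) x x) y := h1.sub contMDiffAt_const
    exact contMDiffAt_const.add (L'.contMDiff.contMDiffAt.comp y h2)
  have hσ : SmoothNear σ x := by
    filter_upwards [hcf.eventually_nhds, hf] with y h1 h2
    exact h2.congr_of_eventuallyEq h1
  refine ⟨⟨σ, hσ⟩, ?_⟩
  have hd : mvfderiv (𝓡 n) (coeff x σ) x = L' := by
    have h0 : coeff x σ =ᶠ[𝓝 x] f := hcf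
    have h1 : HasMFDerivAt (𝓡 n) 𝓘(ℝ, EuclideanSpace ℝ (Fin n)) (extChartAt (𝓡 n) x) x
        (ContinuousLinearMap.id ℝ (EuclideanSpace ℝ (Fin n))) := by
      have h := (mdifferentiableAt_extChartAt (I := 𝓡 n) (mem_chart_source _ x)).hasMFDerivAt
      rwa [mfderiv_extChartAt_self] at h
    have h2 : HasFDerivAt (fun z : EuclideanSpace ℝ (Fin n) =>
        s.1 (coordVol x x) + L' (z - extChartAt (𝓡 n) x x)) L' (extChartAt (𝓡 n) x x) :=
      (L'.hasFDerivAt.comp _ ((hasFDerivAt_id _).sub_const _)).const_add _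
    have h3 : HasMFDerivAt (𝓡 n) 𝓘(ℝ, ℝ) f x L' := h2.hasMFDerivAt.comp x h1
    have h4 : mfderiv (𝓡 n) 𝓘(ℝ, ℝ) (coeff x σ) x = L' :=
      (h3.congr_of_eventuallyEq h0).mfderiv
    ext v
    exact congrArg (fun T : EuclideanSpace ℝ (Fin n) →L[ℝ] ℝ => T v) h4
  refine Prod.ext ?_ ?_
  · refine LinearMap.ext fun v => ?_
    have h1 : ((chartJet x ⟨σ, hσ⟩).1 v : Density n x)
        = (mvfderiv (𝓡 n) (coeff x σ) x v) • coordDensity x x := rfl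
    rw [h1, hd]
    exact (density_eq x (μ v)).symm
  · have h1 : ((chartJet x ⟨σ, hσ⟩).2 : Density n x) = f x • coordDensity x x := rfl
    have h2 : f x = s.1 (coordVol x x) := by simp [f]
    rw [h1, h2]
    exact (density_eq x s).symm

/-- The fibre at `x` of the cotractor bundle `𝒯* = J¹ ℰ(1)`: germs at `x` of smooth sections of
`ℰ(1)`, modulo those that vanish at `x` together with their first derivative. -/
def Cotractor (n : ℕ) {M : Type*} [TopologicalSpace M]
    [ChartedSpace (EuclideanSpace ℝ (Fin n)) M] [IsManifold (𝓡 n) ∞ M] (x : M) : Type _ :=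
  smoothSections n x ⧸ LinearMap.ker (chartJet (n := n) x)

instance cotractorAddCommGroup (x : M) : AddCommGroup (Cotractor n x) :=
  inferInstanceAs (AddCommGroup (smoothSections n x ⧸ LinearMap.ker (chartJet (n := n) x)))

instance cotractorModule (x : M) : Module ℝ (Cotractor n x) :=
  inferInstanceAs (Module ℝ (smoothSections n x ⧸ LinearMap.ker (chartJet (n := n) x)))

/-- The one-jet at `x` of a section of `ℰ(1)` that is smooth near `x`. -/
def jet (x : M) : smoothSections n x →ₗ[ℝ] Cotractor n x :=
  Submodule.mkQ (LinearMap.ker (chartJet (n := n) x))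

/-- The splitting `𝒯*ₓ ≅ ℰₐ(1)ₓ ⊕ ℰ(1)ₓ`, `j¹σ ↦ (dσ(x), σ(x))`, of the jet bundle given by the
flat connection of the preferred chart at `x`. -/
def chartSplit (x : M) : Cotractor n x ≃ₗ[ℝ]
    (TangentSpace (𝓡 n) x →ₗ[ℝ] Density n x) × Density n x :=
  (chartJet x).quotKerEquivOfSurjective (chartJet_surjective x)

lemma chartSplit_jet (x : M) (σ : smoothSections n x) : chartSplit x (jet x σ) = chartJet x σ :=
  LinearMap.quotKerEquivOfSurjective_apply_mk _ _ _

/-- The jet projection `X : 𝒯* → ℰ(1)`, `j¹σ ↦ σ(x)`. -/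
def jetProj (x : M) : Cotractor n x →ₗ[ℝ] Density n x :=
  LinearMap.snd ℝ _ _ ∘ₗ (chartSplit x).toLinearMap

/-- The canonical inclusion `Z : ℰₐ(1) → 𝒯*` of the jet exact sequence: it sends `μ` to the jet of
any section that vanishes at `x` and has derivative `μ` there. -/
def jetIncl (x : M) : (TangentSpace (𝓡 n) x →ₗ[ℝ] Density n x) →ₗ[ℝ] Cotractor n x :=
  (chartSplit x).symm.toLinearMap ∘ₗ LinearMap.inl ℝ _ _

end Jets

/-! ## Affine connections and projective structures -/

section Connections

variable {n : ℕ} {M : Type*} [TopologicalSpace M] [ChartedSpace (EuclideanSpace ℝ (Fin n)) M]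
  [IsManifold (𝓡 n) ∞ M]

/-- Affine connections, i.e. covariant derivatives on the tangent bundle. In `D Y x v` the field
`Y` is differentiated at the point `x` in the direction `v`. -/
abbrev AffineConnection (n : ℕ) (M : Type*) [TopologicalSpace M]
    [ChartedSpace (EuclideanSpace ℝ (Fin n)) M] [IsManifold (𝓡 n) ∞ M] :=
  CovariantDerivative (𝓡 n) (EuclideanSpace ℝ (Fin n)) (TangentSpace (𝓡 n) : M → Type _)

/-- Smooth torsion-free affine connections. -/
def IsSmoothTorsionFree (D : AffineConnection n M) : Prop :=
  CovariantDerivative.ContMDiffCovariantDerivative D ∞ ∧ D.torsion = 0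

/-- The vector field `Y` is differentiable at `x`. -/
def FieldDiffAt (Y : Π y : M, TangentSpace (𝓡 n) y) (x : M) : Prop :=
  MDifferentiableAt (𝓡 n) ((𝓡 n).prod 𝓘(ℝ, EuclideanSpace ℝ (Fin n)))
    (fun y => TotalSpace.mk' (EuclideanSpace ℝ (Fin n))
      (E := (TangentSpace (𝓡 n) : M → Type _)) y (Y y)) x

/-- Two connections are projectively equivalent if
`∇̂_v Y = ∇_v Y + Υ(v) Y + Υ(Y) v` for a smooth one-form `Υ`. -/
def ProjectivelyEquivalent (D D' : AffineConnection n M) : Prop :=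
  ∃ Υ : Π x : M, TangentSpace (𝓡 n) x →L[ℝ] ℝ,
    ContMDiff (𝓡 n) ((𝓡 n).prod 𝓘(ℝ, EuclideanSpace ℝ (Fin n) →L[ℝ] ℝ)) ∞
      (fun x => TotalSpace.mk' (EuclideanSpace ℝ (Fin n) →L[ℝ] ℝ)
        (E := fun x : M => TangentSpace (𝓡 n) x →L[ℝ] ℝ) x (Υ x)) ∧
    ∀ (Y : Π x : M, TangentSpace (𝓡 n) x) (x : M), FieldDiffAt Y x →
      ∀ v : TangentSpace (𝓡 n) x, D' Y x v = D Y x v + Υ x v • Y x + Υ x (Y x) • v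

/-- A projective structure: a projective equivalence class of smooth torsion-free affine
connections. -/
structure ProjectiveStructure (n : ℕ) (M : Type*) [TopologicalSpace M]
    [ChartedSpace (EuclideanSpace ℝ (Fin n)) M] [IsManifold (𝓡 n) ∞ M] where
  /-- The connections in the class (the Weyl connections). -/
  carrier : Set (AffineConnection n M)
  nonempty : carrier.Nonempty
  smooth : ∀ D ∈ carrier, IsSmoothTorsionFree D
  mem_iff : ∀ D ∈ carrier, ∀ D' : AffineConnection n M, IsSmoothTorsionFree D' →
    (D' ∈ carrier ↔ ProjectivelyEquivalent D D')

instance projectiveStructureMembership : Membership (AffineConnection n M) (ProjectiveStructure n M) :=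
  ⟨fun p D => D ∈ p.carrier⟩

/-- The curvature `R(X,Y)Z = ∇_X ∇_Y Z - ∇_Y ∇_X Z - ∇_[X,Y] Z` of an affine connection. -/
def curvature (D : AffineConnection n M) (X Y Z : Π x : M, TangentSpace (𝓡 n) x) (x : M) :
    TangentSpace (𝓡 n) x :=
  D (fun y => D Z y (Y y)) x (X x) - D (fun y => D Z y (X y)) x (Y x)
    - D Z x (VectorField.mlieBracket (𝓡 n) X Y x)

/-- The Ricci tensor `Ric_{ab} = R_{ca}{}^c{}_b`, i.e. `Ric(Y,Z)` is the trace of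
`X ↦ R(X,Y)Z`, computed in the coordinate frame of the preferred chart at `x`. -/
def ricci (D : AffineConnection n M) (x : M) : LinearMap.BilinForm ℝ (TangentSpace (𝓡 n) x) :=
  Matrix.toBilin (coordBasis x) (Matrix.of fun j k => ∑ i : Fin n,
    coordForm x i x (curvature D (coordField x i) (coordField x j) (coordField x k) x))

/-- The projective Schouten tensor: the solution `P` of `(n-1) P_{ab} = Ric_{ab} + β_{ab}`,
`β_{ab} = - (P_{ab} - P_{ba})`. -/
def schouten (D : AffineConnection n M) (x : M) :
    LinearMap.BilinForm ℝ (TangentSpace (𝓡 n) x) :=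
  ((n : ℝ) ^ 2 - 1)⁻¹ • ((n : ℝ) • ricci D x + LinearMap.flip (ricci D x))

lemma schouten_spec (hn : 2 ≤ n) (D : AffineConnection n M) (x : M)
    (v w : TangentSpace (𝓡 n) x) :
    ((n : ℝ) - 1) * schouten D x v w
      = ricci D x v w - (schouten D x v w - schouten D x w v) := by
  have hn' : (2 : ℝ) ≤ n := by exact_mod_cast hn
  have h : ((n : ℝ) ^ 2 - 1) ≠ 0 := by nlinarith
  simp only [schouten, LinearMap.smul_apply, LinearMap.add_apply, LinearMap.flip_apply,
    smul_eq_mul]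
  field_simp
  ring

/-- The one-form `v ↦ ∑ᵢ dxⁱ(∇_v ∂ᵢ)` at `x`: the trace of the connection form of `∇` in the
coordinate frame of the preferred chart at `x`. -/
def connTrace (D : AffineConnection n M) (x : M) : TangentSpace (𝓡 n) x →ₗ[ℝ] ℝ :=
  ∑ i : Fin n, coordForm x i x ∘ₗ (D (coordField x i) x).toLinearMap

/-- The connection on `ℰ(1)` induced by an affine connection. On `Λⁿ TM` the induced connection has
connection form `connTrace`, hence on the `(2n+2)`-th root of its square the connection form is
`(n+1)⁻¹ connTrace`, with respect to the coordinate density. -/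
def covDensity (D : AffineConnection n M) (σ : Π y : M, Density n y) (x : M) :
    TangentSpace (𝓡 n) x →ₗ[ℝ] Density n x :=
  ((mvfderiv (𝓡 n) (coeff x σ) x).toLinearMap
    + (((n : ℝ) + 1)⁻¹ * coeff x σ x) • connTrace D x).smulRight (coordDensity x x)

/-- The induced connection on `ℰₐ(1) = T*M ⊗ ℰ(1)` (a section being a field of linear maps
`TₓM → ℰ(1)ₓ`): `(∇_v μ)(∂ᵢ) = ∇_v (μ(∂ᵢ)) - μ(∇_v ∂ᵢ)`. -/
def covWeightedForm (D : AffineConnection n M)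
    (μ : Π y : M, TangentSpace (𝓡 n) y →ₗ[ℝ] Density n y) (x : M) (v : TangentSpace (𝓡 n) x) :
    TangentSpace (𝓡 n) x →ₗ[ℝ] Density n x :=
  (coordBasis x).constr ℝ fun i : Fin n =>
    covDensity D (fun y => μ y (coordField x i y)) x v - μ x (D (coordField x i) x v)

end Connections

/-! ## The tractor connection -/

section Tractors

variable {n : ℕ} {M : Type*} [TopologicalSpace M] [ChartedSpace (EuclideanSpace ℝ (Fin n)) M]
  [IsManifold (𝓡 n) ∞ M]

/-- The automorphism `(μ, s) ↦ (μ + θ s, s)` of `ℰₐ(1)ₓ ⊕ ℰ(1)ₓ`, for a one-form `θ` at `x`. -/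
def shear {x : M} (θ : TangentSpace (𝓡 n) x →ₗ[ℝ] ℝ) :
    ((TangentSpace (𝓡 n) x →ₗ[ℝ] Density n x) × Density n x) ≃ₗ[ℝ]
      (TangentSpace (𝓡 n) x →ₗ[ℝ] Density n x) × Density n x where
  toFun u := (u.1 + θ.smulRight u.2, u.2)
  invFun u := (u.1 - θ.smulRight u.2, u.2)
  map_add' := by
    intro u w
    refine Prod.ext (LinearMap.ext fun v => ?_) rfl
    simp only [Prod.fst_add, Prod.snd_add, LinearMap.add_apply, LinearMap.smulRight_apply,
      smul_add]
    abel
  map_smul' := by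
    intro r u
    refine Prod.ext (LinearMap.ext fun v => ?_) rfl
    simp only [Prod.smul_fst, Prod.smul_snd, LinearMap.add_apply, LinearMap.smulRight_apply,
      LinearMap.smul_apply, smul_add, RingHom.id_apply, smul_comm r]
  left_inv := by intro u; simp
  right_inv := by intro u; simp

/-- The splitting `𝒯*ₓ ≅ ℰₐ(1)ₓ ⊕ ℰ(1)ₓ`, `j¹σ ↦ (∇σ(x), σ(x))`, determined by an affine
connection through the connection it induces on `ℰ(1)`. -/
def split (D : AffineConnection n M) (x : M) : Cotractor n x ≃ₗ[ℝ]
    (TangentSpace (𝓡 n) x →ₗ[ℝ] Density n x) × Density n x :=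
  (chartSplit x).trans (shear (((n : ℝ) + 1)⁻¹ • connTrace D x))

lemma split_jet (D : AffineConnection n M) (x : M) (σ : smoothSections n x) :
    split D x (jet x σ) = (covDensity D σ.1 x, σ.1 x) := by
  have h : split D x (jet x σ)
      = shear (((n : ℝ) + 1)⁻¹ • connTrace D x) (chartSplit x (jet x σ)) := rfl
  rw [h, chartSplit_jet]
  refine Prod.ext (LinearMap.ext fun v => ?_) rfl
  have h1 : σ.1 x = coeff x σ.1 x • coordDensity x x := density_eq x (σ.1 x)
  simp only [shear, chartJet, covDensity, LinearEquiv.coe_mk, LinearMap.coe_mk, AddHom.coe_mk,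
    LinearMap.add_apply, LinearMap.smulRight_apply, LinearMap.smul_apply, smul_eq_mul]
  rw [add_smul]
  congr 1
  rw [h1, smul_smul]
  congr 1
  ring

/-- The `ℰₐ(1)`-component of a cotractor field in the splitting given by `D`. -/
def formPart (D : AffineConnection n M) (U : Π y : M, Cotractor n y) (y : M) :
    TangentSpace (𝓡 n) y →ₗ[ℝ] Density n y := (split D y (U y)).1

/-- The `ℰ(1)`-component of a cotractor field. -/
def densityPart (D : AffineConnection n M) (U : Π y : M, Cotractor n y) (y : M) : Density n y :=
  (split D y (U y)).2

/-- A cotractor field is smooth near `x` if its two components in the splitting given by (the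
smooth connection) `D` are. -/
def CotractorSmoothNear (D : AffineConnection n M) (U : Π y : M, Cotractor n y) (x : M) : Prop :=
  SmoothNear (densityPart D U) x ∧
    ∀ i : Fin n, SmoothNear (fun y => formPart D U y (coordField x i y)) x

/-- The normal cotractor connection, in the splitting given by `D`:
`∇_v (μ | σ) = (∇_v μ + P(v, ·) σ | ∇_v σ - μ(v))`. -/
def cotractorDeriv (D : AffineConnection n M) (U : Π y : M, Cotractor n y) (x : M)
    (v : TangentSpace (𝓡 n) x) : Cotractor n x :=
  (split D x).symm
    (covWeightedForm D (formPart D U) x v + (schouten D x v).smulRight (densityPart D U x),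
      covDensity D (densityPart D U) x v - formPart D U x v)

/-- Fields of bilinear forms `h^{AB}` on the cotractor bundle. -/
abbrev CotractorForm (n : ℕ) (M : Type*) [TopologicalSpace M]
    [ChartedSpace (EuclideanSpace ℝ (Fin n)) M] [IsManifold (𝓡 n) ∞ M] :=
  Π x : M, LinearMap.BilinForm ℝ (Cotractor n x)

/-- Smoothness of a field of bilinear forms on the cotractor bundle. -/
def CotractorFormSmooth (D : AffineConnection n M) (h : CotractorForm n M) : Prop :=
  ∀ (x : M) (U V : Π y : M, Cotractor n y),
    CotractorSmoothNear D U x → CotractorSmoothNear D V x →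
    ContMDiffAt (𝓡 n) 𝓘(ℝ, ℝ) ∞ (fun y => h y (U y) (V y)) x

/-- `∇h = 0`: for all smooth cotractor fields, `v (h(U,V)) = h(∇_v U, V) + h(U, ∇_v V)`. -/
def CotractorFormParallel (D : AffineConnection n M) (h : CotractorForm n M) : Prop :=
  ∀ (x : M) (U V : Π y : M, Cotractor n y),
    CotractorSmoothNear D U x → CotractorSmoothNear D V x → ∀ v : TangentSpace (𝓡 n) x,
    mvfderiv (𝓡 n) (fun y => h y (U y) (V y)) x v
      = h x (cotractorDeriv D U x v) (V x) + h x (U x) (cotractorDeriv D V x v)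

/-- A field of bilinear forms on `𝒯*` is a sub-metric if it is symmetric and its restriction to the
invariant subbundle `ℰₐ(1)` is nondegenerate. -/
def IsSubmetric (h : CotractorForm n M) : Prop :=
  ∀ x : M, (h x).IsSymm ∧ ((h x).restrict (LinearMap.range (jetIncl (n := n) x))).Nondegenerate

/-- The smooth sub-metrics on `𝒯*` that are parallel for the tractor connection of `p`. The tractor
connection does not depend on the connection in `p` used to write it down. -/
def parallelSubmetrics (p : ProjectiveStructure n M) : Set (CotractorForm n M) :=
  {h | IsSubmetric h ∧ ∀ D ∈ p, CotractorFormSmooth D h ∧ CotractorFormParallel D h}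

/-! ### The dual picture on the tractor bundle -/

/-- The fibre at `x` of the tractor bundle `𝒯`, the dual of the cotractor bundle. -/
abbrev Tractor (n : ℕ) {M : Type*} [TopologicalSpace M]
    [ChartedSpace (EuclideanSpace ℝ (Fin n)) M] [IsManifold (𝓡 n) ∞ M] (x : M) : Type _ :=
  Module.Dual ℝ (Cotractor n x)

/-- Smoothness near `x` of a tractor field: its pairing with smooth cotractor fields is smooth. -/
def TractorSmoothNear (D : AffineConnection n M) (Φ : Π y : M, Tractor n y) (x : M) : Prop :=
  ∀ U : Π y : M, Cotractor n y, CotractorSmoothNear D U x →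
    ∀ᶠ y in 𝓝 x, ContMDiffAt (𝓡 n) 𝓘(ℝ, ℝ) ∞ (fun z => Φ z (U z)) y

/-- The smooth local frame of the cotractor bundle formed by `(dxⁱ ⊗ ε | 0)`, `1 ≤ i ≤ n`, and
`(0 | ε)` (with index `none`), where `ε` is the coordinate density, in the splitting given by `D`
and in the preferred chart at `x`. -/
def cotractorFrame (D : AffineConnection n M) (x : M) : Option (Fin n) → Π y : M, Cotractor n y
  | none => fun y => (split D y).symm (0, coordDensity x y)
  | some i => fun y => (split D y).symm ((coordForm x i y).smulRight (coordDensity x y), 0)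

/-- The coordinates on `𝒯*ₓ` with respect to the cotractor frame. -/
def cotractorCoord (D : AffineConnection n M) (x : M) : Option (Fin n) → Tractor n x
  | none =>
    { toFun := fun u => (split D x u).2.1 (coordVol x x)
      map_add' := fun u w => by rw [map_add]; rfl
      map_smul' := fun r u => by rw [map_smul]; rfl }
  | some i =>
    { toFun := fun u => ((split D x u).1 (coordField x i x)).1 (coordVol x x)
      map_add' := fun u w => by rw [map_add]; rfl
      map_smul' := fun r u => by rw [map_smul]; rfl }

/-- The tractor connection on `𝒯`, dual to the cotractor connection:
`(∇_v Φ)(F) = v (Φ(F)) - Φ(∇_v F)` for the members `F` of the cotractor frame. -/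
def tractorDeriv (D : AffineConnection n M) (Φ : Π y : M, Tractor n y) (x : M)
    (v : TangentSpace (𝓡 n) x) : Tractor n x :=
  ∑ a : Option (Fin n),
    (mvfderiv (𝓡 n) (fun y => Φ y (cotractorFrame D x a y)) x v
      - Φ x (cotractorDeriv D (cotractorFrame D x a) x v)) • cotractorCoord D x a

/-- Fields of bilinear forms on the tractor bundle. -/
abbrev TractorForm (n : ℕ) (M : Type*) [TopologicalSpace M]
    [ChartedSpace (EuclideanSpace ℝ (Fin n)) M] [IsManifold (𝓡 n) ∞ M] :=
  Π x : M, LinearMap.BilinForm ℝ (Tractor n x)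

/-- Smoothness of a field of bilinear forms on the tractor bundle. -/
def TractorFormSmooth (D : AffineConnection n M) (H : TractorForm n M) : Prop :=
  ∀ (x : M) (Φ Ψ : Π y : M, Tractor n y),
    TractorSmoothNear D Φ x → TractorSmoothNear D Ψ x →
    ContMDiffAt (𝓡 n) 𝓘(ℝ, ℝ) ∞ (fun y => H y (Φ y) (Ψ y)) x

/-- `∇H = 0` for a field of bilinear forms on the tractor bundle. -/
def TractorFormParallel (D : AffineConnection n M) (H : TractorForm n M) : Prop :=
  ∀ (x : M) (Φ Ψ : Π y : M, Tractor n y),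
    TractorSmoothNear D Φ x → TractorSmoothNear D Ψ x → ∀ v : TangentSpace (𝓡 n) x,
    mvfderiv (𝓡 n) (fun y => H y (Φ y) (Ψ y)) x v
      = H x (tractorDeriv D Φ x v) (Ψ x) + H x (Φ x) (tractorDeriv D Ψ x v)

/-- The nondegenerate forms `h` on `𝒯*` and `H` on `𝒯` are inverse to each other:
`H(h(u,·), h(w,·)) = h(u,w)`. -/
def AreInverse (h : CotractorForm n M) (H : TractorForm n M) : Prop :=
  ∀ x : M, (h x).Nondegenerate ∧ (H x).Nondegenerate ∧
    ∀ u w : Cotractor n x, H x (h x u) (h x w) = h x u w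

/-- The smooth metrics on the tractor bundle `𝒯` that are parallel for the tractor connection of `p`
and whose inverse is a sub-metric on `𝒯*`. -/
def parallelTractorMetrics (p : ProjectiveStructure n M) : Set (TractorForm n M) :=
  {H | (∀ x : M, (H x).IsSymm ∧ (H x).Nondegenerate) ∧
    (∀ D ∈ p, TractorFormSmooth D H ∧ TractorFormParallel D H) ∧
    ∃ h : CotractorForm n M, AreInverse h H ∧ IsSubmetric h}

end Tractors

/-! ## Einstein metrics -/

section Metrics

variable {n : ℕ} {M : Type*} [TopologicalSpace M] [ChartedSpace (EuclideanSpace ℝ (Fin n)) M]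
  [IsManifold (𝓡 n) ∞ M]

/-- Smooth pseudo-Riemannian metrics (of any signature). -/
structure PseudoMetric (n : ℕ) (M : Type*) [TopologicalSpace M]
    [ChartedSpace (EuclideanSpace ℝ (Fin n)) M] [IsManifold (𝓡 n) ∞ M] where
  /-- The inner product on each tangent space. -/
  inner (x : M) : TangentSpace (𝓡 n) x →L[ℝ] TangentSpace (𝓡 n) x →L[ℝ] ℝ
  symm (x : M) (v w : TangentSpace (𝓡 n) x) : inner x v w = inner x w v
  nondegenerate (x : M) (v : TangentSpace (𝓡 n) x) (hv : ∀ w, inner x v w = 0) : v = 0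
  contMDiff : ContMDiff (𝓡 n)
    ((𝓡 n).prod 𝓘(ℝ, EuclideanSpace ℝ (Fin n) →L[ℝ] EuclideanSpace ℝ (Fin n) →L[ℝ] ℝ)) ∞
    (fun x => TotalSpace.mk' (EuclideanSpace ℝ (Fin n) →L[ℝ] EuclideanSpace ℝ (Fin n) →L[ℝ] ℝ)
      (E := fun x : M => TangentSpace (𝓡 n) x →L[ℝ] TangentSpace (𝓡 n) x →L[ℝ] ℝ) x (inner x))

/-- `D` is the Levi-Civita connection of `g`: it is smooth, torsion-free and
`v (g(Y,Z)) = g(∇_v Y, Z) + g(Y, ∇_v Z)`. -/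
def IsLeviCivita (g : PseudoMetric n M) (D : AffineConnection n M) : Prop :=
  IsSmoothTorsionFree D ∧
    ∀ (Y Z : Π x : M, TangentSpace (𝓡 n) x) (x : M), FieldDiffAt Y x → FieldDiffAt Z x →
      ∀ v : TangentSpace (𝓡 n) x, mvfderiv (𝓡 n) (fun y => g.inner y (Y y) (Z y)) x v
        = g.inner x (D Y x v) (Z x) + g.inner x (Y x) (D Z x v)

/-- `g` is Einstein: `Ric = c g` with `c` locally constant (so constant if `M` is connected). -/
def IsEinstein (g : PseudoMetric n M) : Prop :=
  ∃ D : AffineConnection n M, IsLeviCivita g D ∧ ∃ c : M → ℝ, IsLocallyConstant c ∧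
    ∀ (x : M) (v w : TangentSpace (𝓡 n) x), ricci D x v w = c x * g.inner x v w

/-- The Ricci tensor of `g` vanishes at the point `x`. -/
def IsRicciFlatAt (g : PseudoMetric n M) (x : M) : Prop :=
  ∃ D : AffineConnection n M, IsLeviCivita g D ∧ ricci D x = 0

/-- The Einstein metrics on `M` whose Levi-Civita connection is in `p`. -/
def einsteinMetrics (p : ProjectiveStructure n M) : Set (PseudoMetric n M) :=
  {g | IsEinstein g ∧ ∃ D ∈ p, IsLeviCivita g D}

/-- The positive section of `ℰ(1)` of unit length for `g`: it equals
`|e₁ ∧ ⋯ ∧ eₙ| ^ (1/(n+1)) |det g(eᵢ,eⱼ)| ^ (-1/(2n+2))` for any basis `e` of `TₓM`. -/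
def metricDensity (g : PseudoMetric n M) (x : M) : Density n x :=
  (|(Matrix.of fun i j : Fin n => g.inner x (coordField x i x) (coordField x j x)).det|
    ^ (-(1 / (2 * (n : ℝ) + 2)))) • coordDensity x x

/-- The form `h` on `𝒯*` restricts to the metric `g`: on `ℰₐ(1)`, identified with `T*M` by means of
the unit density `s` of `g`, the form `h` is the inverse metric `g^{ab}`, that is
`h(Z(g(v,·) s), Z(g(w,·) s)) = g(v,w)`. -/
def RestrictsTo (h : CotractorForm n M) (g : PseudoMetric n M) : Prop :=
  ∀ (x : M) (v w : TangentSpace (𝓡 n) x),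
    h x (jetIncl x ((g.inner x v).toLinearMap.smulRight (metricDensity g x)))
        (jetIncl x ((g.inner x w).toLinearMap.smulRight (metricDensity g x)))
      = g.inner x v w

end Metrics

end ProjTractor
end

open ProjTractor

noncomputable section

namespace ProjTractor

/-! ## Directional derivatives of real functions -/

section DirectionalDerivatives

variable {n : ℕ} {M : Type*} [TopologicalSpace M] [ChartedSpace (EuclideanSpace ℝ (Fin n)) M]

/-! A sub-metric `h` is nondegenerate on ℰₐ(1), so the orthogonal complement of ℰₐ(1) is a
complementary line, that is, a splitting of the jet sequence. A projective change of connection by Υ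
shears the splitting, (μ | σ) ↦ (μ + Υσ | σ), so some connection `D` of `p` has this complement as
its ℰ(1) summand (`exists_orthogonal_oneForm`, `exists_isDiagonal`). In its splitting `h` is block
diagonal. In coordinates the first block has the form Z = |det G|^(1/(n+1)) G⁻¹ for the Gram matrix
G of exactly one metric g, recovered as G = (|det Z| Z)⁻¹; the second block is λ |det G|^(1/(n+1))
for a function λ.

In the cotractor frame the tractor connection is d + Γ, and the off-diagonal blocks of Γ are -v and
P(v, ·). For a block diagonal `h` the equation ∇h = 0 therefore falls apart into three: Z is
parallel as a weighted tensor, which means ∇g = 0; the mixed block gives P = λg; the last block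
gives dλ = 0 (`parallel_optionBlock_iff`, `matDeriv_normalised_iff`, `IsDiagonal.parallel_iff`). So
`D` is the Levi-Civita connection of g, and Ric = (n-1)λg with λ locally constant. Conversely, an
Einstein metric whose Levi-Civita connection lies in `p` gives a block diagonal form that solves the
three equations, and invariance of the tractor connection (`IsProjectiveChange.cotractorDeriv`)
carries parallelism to every other member of `p`. The form determines g through its restriction; g
determines its Levi-Civita connection, hence the splitting and λ, hence the form
(`IsEinsteinPair.form_unique`).

The block diagonal form degenerates exactly where λ, equivalently the Ricci tensor, vanishes. On the
tractor bundle one passes to inverse matrices: the inverse of a parallel matrix for d + Γ is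
parallel for the dual connection d - Γᵀ (`AreInverse.parallel_iff`). -/

lemma mvfderiv_congr_nhds {f g : M → ℝ} {x : M} (h : f =ᶠ[𝓝 x] g) :
    mvfderiv (𝓡 n) f x = mvfderiv (𝓡 n) g x := by
  have h1 : mfderiv (𝓡 n) 𝓘(ℝ, ℝ) f x = mfderiv (𝓡 n) 𝓘(ℝ, ℝ) g x := h.mfderiv_eq
  ext v
  exact congrArg (fun T : EuclideanSpace ℝ (Fin n) →L[ℝ] ℝ => T v) h1

lemma mvfderiv_const_apply (c : ℝ) (x : M) (v : TangentSpace (𝓡 n) x) :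
    mvfderiv (𝓡 n) (fun _ : M => c) x v = 0 := by
  rw [mvfderiv_const]; rfl

lemma mvfderiv_add_apply {f g : M → ℝ} {x : M} (hf : MDifferentiableAt (𝓡 n) 𝓘(ℝ, ℝ) f x)
    (hg : MDifferentiableAt (𝓡 n) 𝓘(ℝ, ℝ) g x) (v : TangentSpace (𝓡 n) x) :
    mvfderiv (𝓡 n) (fun y => f y + g y) x v
      = mvfderiv (𝓡 n) f x v + mvfderiv (𝓡 n) g x v := by
  have := mvfderiv_add hf hg
  exact congrArg (fun T => T v) this

lemma mdifferentiableAt_fun_mul {f g : M → ℝ} {x : M}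
    (hf : MDifferentiableAt (𝓡 n) 𝓘(ℝ, ℝ) f x) (hg : MDifferentiableAt (𝓡 n) 𝓘(ℝ, ℝ) g x) :
    MDifferentiableAt (𝓡 n) 𝓘(ℝ, ℝ) (fun y => f y * g y) x :=
  hf.mul hg

lemma mvfderiv_mul_apply {f g : M → ℝ} {x : M} (hf : MDifferentiableAt (𝓡 n) 𝓘(ℝ, ℝ) f x)
    (hg : MDifferentiableAt (𝓡 n) 𝓘(ℝ, ℝ) g x) (v : TangentSpace (𝓡 n) x) :
    mvfderiv (𝓡 n) (fun y => f y * g y) x v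
      = mvfderiv (𝓡 n) f x v * g x + f x * mvfderiv (𝓡 n) g x v := by
  have := congrArg (fun T => T v) (mvfderiv_mul hf hg)
  refine (show mvfderiv (𝓡 n) (fun y => f y * g y) x v = _ from this).trans ?_
  simp
  ring

lemma mdifferentiableAt_sum {ι : Type*} {s : Finset ι} {f : ι → M → ℝ} {x : M}
    (hf : ∀ i ∈ s, MDifferentiableAt (𝓡 n) 𝓘(ℝ, ℝ) (f i) x) :
    MDifferentiableAt (𝓡 n) 𝓘(ℝ, ℝ) (fun y => ∑ i ∈ s, f i y) x := by
  classical
  induction s using Finset.induction_on with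
  | empty => simpa using mdifferentiableAt_const
  | insert a s ha ih =>
    simp only [Finset.sum_insert ha]
    exact (hf a (by simp)).add (ih fun i hi => hf i (by simp [hi]))

lemma mvfderiv_sum_apply {ι : Type*} {s : Finset ι} {f : ι → M → ℝ} {x : M}
    (hf : ∀ i ∈ s, MDifferentiableAt (𝓡 n) 𝓘(ℝ, ℝ) (f i) x) (v : TangentSpace (𝓡 n) x) :
    mvfderiv (𝓡 n) (fun y => ∑ i ∈ s, f i y) x v = ∑ i ∈ s, mvfderiv (𝓡 n) (f i) x v := by
  classical
  induction s using Finset.induction_on with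
  | empty => simpa using mvfderiv_const_apply 0 x v
  | insert a s ha ih =>
    simp only [Finset.sum_insert ha]
    rw [mvfderiv_add_apply (hf a (by simp))
      (mdifferentiableAt_sum fun i hi => hf i (by simp [hi])), ih fun i hi => hf i (by simp [hi])]

lemma mdifferentiableAt_prod {ι : Type*} {s : Finset ι} {f : ι → M → ℝ} {x : M}
    (hf : ∀ i ∈ s, MDifferentiableAt (𝓡 n) 𝓘(ℝ, ℝ) (f i) x) :
    MDifferentiableAt (𝓡 n) 𝓘(ℝ, ℝ) (fun y => ∏ i ∈ s, f i y) x := by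
  classical
  induction s using Finset.induction_on with
  | empty => simpa using mdifferentiableAt_const
  | insert a s ha ih =>
    simp only [Finset.prod_insert ha]
    exact (hf a (by simp)).mul (ih fun i hi => hf i (by simp [hi]))

lemma mvfderiv_prod_apply {ι : Type*} [DecidableEq ι] {s : Finset ι} {f : ι → M → ℝ} {x : M}
    (hf : ∀ i ∈ s, MDifferentiableAt (𝓡 n) 𝓘(ℝ, ℝ) (f i) x) (v : TangentSpace (𝓡 n) x) :
    mvfderiv (𝓡 n) (fun y => ∏ i ∈ s, f i y) x v
      = ∑ i ∈ s, mvfderiv (𝓡 n) (f i) x v * ∏ j ∈ s.erase i, f j x := by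
  induction s using Finset.induction_on with
  | empty => simpa using mvfderiv_const_apply 1 x v
  | insert a s ha ih =>
    simp only [Finset.prod_insert ha, Finset.sum_insert ha]
    rw [mvfderiv_mul_apply (hf a (by simp))
      (mdifferentiableAt_prod fun i hi => hf i (by simp [hi])), ih fun i hi => hf i (by simp [hi]),
      Finset.erase_insert ha, Finset.mul_sum]
    congr 1
    refine Finset.sum_congr rfl fun i hi => ?_
    have hai : a ≠ i := fun h => ha (h ▸ hi)
    rw [Finset.erase_insert_of_ne hai, Finset.prod_insert (by simp [ha])]
    ring

lemma mvfderiv_comp_real {f : M → ℝ} {x : M} {φ : ℝ → ℝ} {φ' : ℝ}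
    (hf : MDifferentiableAt (𝓡 n) 𝓘(ℝ, ℝ) f x) (hφ : HasDerivAt φ φ' (f x))
    (v : TangentSpace (𝓡 n) x) :
    mvfderiv (𝓡 n) (fun y => φ (f y)) x v = φ' * mvfderiv (𝓡 n) f x v := by
  have h1 : HasMFDerivAt (𝓡 n) 𝓘(ℝ, ℝ) (fun y => φ (f y)) x _ :=
    (hφ.hasFDerivAt.hasMFDerivAt).comp x hf.hasMFDerivAt
  have h2 := congrArg (fun T : EuclideanSpace ℝ (Fin n) →L[ℝ] ℝ => T v) h1.mfderiv
  refine (show mvfderiv (𝓡 n) (fun y => φ (f y)) x v = _ from h2).trans ?_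
  refine (show _ = (mvfderiv (𝓡 n) f x v) * φ' from rfl).trans (mul_comm _ _)

end DirectionalDerivatives

/-! ## Matrices of functions -/

section MatrixFunctions

variable {n : ℕ} {M : Type*} [TopologicalSpace M] [ChartedSpace (EuclideanSpace ℝ (Fin n)) M]
variable {ι : Type*} [Fintype ι] [DecidableEq ι]

/-- The entrywise directional derivative of a matrix of functions. -/
def matDeriv (A : M → Matrix ι ι ℝ) (x : M) (v : TangentSpace (𝓡 n) x) : Matrix ι ι ℝ :=
  Matrix.of fun i j => mvfderiv (𝓡 n) (fun y => A y i j) x v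

/-- All entries of a matrix of functions are differentiable at `x`. -/
def MatDiffAt (n : ℕ) {M : Type*} [TopologicalSpace M] [ChartedSpace (EuclideanSpace ℝ (Fin n)) M]
    (A : M → Matrix ι ι ℝ) (x : M) : Prop :=
  ∀ i j, MDifferentiableAt (𝓡 n) 𝓘(ℝ, ℝ) (fun y => A y i j) x

/-- All entries of a matrix of functions are smooth at `x`. -/
def MatSmoothAt (n : ℕ) {M : Type*} [TopologicalSpace M]
    [ChartedSpace (EuclideanSpace ℝ (Fin n)) M] (A : M → Matrix ι ι ℝ) (x : M) : Prop :=
  ∀ i j, ContMDiffAt (𝓡 n) 𝓘(ℝ, ℝ) ∞ (fun y => A y i j) x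

omit [Fintype ι] [DecidableEq ι] in
lemma MatSmoothAt.matDiffAt {A : M → Matrix ι ι ℝ} {x : M} (h : MatSmoothAt n A x) :
    MatDiffAt n A x := fun i j => (h i j).mdifferentiableAt (by simp)

omit [Fintype ι] [DecidableEq ι] in
lemma MatSmoothAt.congr {A B : M → Matrix ι ι ℝ} {x : M} (h : MatSmoothAt n A x)
    (hAB : B =ᶠ[𝓝 x] A) : MatSmoothAt n B x := fun i j =>
  (h i j).congr_of_eventuallyEq (hAB.mono fun y hy => by simp only [hy])

omit [Fintype ι] [DecidableEq ι] in
lemma matDeriv_congr {A B : M → Matrix ι ι ℝ} {x : M} (hAB : A =ᶠ[𝓝 x] B)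
    (v : TangentSpace (𝓡 n) x) : matDeriv A x v = matDeriv B x v := by
  ext i j
  have : (fun y => A y i j) =ᶠ[𝓝 x] fun y => B y i j := hAB.mono fun y hy => by simp only [hy]
  simp only [matDeriv, Matrix.of_apply, mvfderiv_congr_nhds this]

omit [DecidableEq ι] in
lemma matDeriv_mul {A B : M → Matrix ι ι ℝ} {x : M} (hA : MatDiffAt n A x)
    (hB : MatDiffAt n B x) (v : TangentSpace (𝓡 n) x) :
    matDeriv (fun y => A y * B y) x v = matDeriv A x v * B x + A x * matDeriv B x v := by
  ext i j
  simp only [matDeriv, Matrix.of_apply, Matrix.mul_apply, Matrix.add_apply]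
  rw [mvfderiv_sum_apply (f := fun k y => A y i k * B y k j)
    fun k _ => mdifferentiableAt_fun_mul (hA i k) (hB k j), ← Finset.sum_add_distrib]
  exact Finset.sum_congr rfl fun k _ => mvfderiv_mul_apply (hA i k) (hB k j) v

omit [Fintype ι] [DecidableEq ι] in
lemma matDeriv_smul {f : M → ℝ} {A : M → Matrix ι ι ℝ} {x : M}
    (hf : MDifferentiableAt (𝓡 n) 𝓘(ℝ, ℝ) f x) (hA : MatDiffAt n A x)
    (v : TangentSpace (𝓡 n) x) :
    matDeriv (fun y => f y • A y) x v
      = mvfderiv (𝓡 n) f x v • A x + f x • matDeriv A x v := by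
  ext i j
  simp only [matDeriv, Matrix.of_apply, Matrix.add_apply, Matrix.smul_apply, smul_eq_mul]
  exact mvfderiv_mul_apply hf (hA i j) v

lemma MatDiffAt.det {A : M → Matrix ι ι ℝ} {x : M} (hA : MatDiffAt n A x) :
    MDifferentiableAt (𝓡 n) 𝓘(ℝ, ℝ) (fun y => (A y).det) x := by
  simp only [Matrix.det_apply']
  exact mdifferentiableAt_sum fun σ _ =>
    mdifferentiableAt_const.mul (mdifferentiableAt_prod fun i _ => hA _ _)

/-- Jacobi's formula. -/
lemma mvfderiv_det {A : M → Matrix ι ι ℝ} {x : M} (hA : MatDiffAt n A x)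
    (v : TangentSpace (𝓡 n) x) :
    mvfderiv (𝓡 n) (fun y => (A y).det) x v = ((A x).adjugate * matDeriv A x v).trace := by
  -- By Cramer's rule each diagonal entry is the determinant of A with one column differentiated.
  -- The Leibniz expansion of these determinants is then compared with the product rule, permutation
  -- by permutation.
  have h1 : ∀ i : ι, ((A x).adjugate * matDeriv A x v) i i
      = ((A x).updateCol i fun k => matDeriv A x v k i).det := by
    intro i
    rw [← Matrix.cramer_apply, Matrix.cramer_eq_adjugate_mulVec]
    rfl
  simp only [Matrix.trace, Matrix.diag_apply, h1]
  simp only [Matrix.det_apply']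
  rw [mvfderiv_sum_apply (f := fun (σ : Equiv.Perm ι) y =>
      ((Equiv.Perm.sign σ : ℤ) : ℝ) * ∏ i, A y (σ i) i) fun σ _ =>
    mdifferentiableAt_const.mul (mdifferentiableAt_prod fun i _ => hA _ _), Finset.sum_comm]
  refine Finset.sum_congr rfl fun σ _ => ?_
  rw [mvfderiv_mul_apply (f := fun _ => ((Equiv.Perm.sign σ : ℤ) : ℝ))
    (g := fun y => ∏ i, A y (σ i) i) mdifferentiableAt_const
    (mdifferentiableAt_prod fun i _ => hA _ _),
    mvfderiv_const_apply, zero_mul, zero_add,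
    mvfderiv_prod_apply (f := fun i y => A y (σ i) i) fun i _ => hA _ _,
    Finset.mul_sum]
  refine Finset.sum_congr rfl fun i _ => ?_
  congr 1
  rw [← Finset.mul_prod_erase Finset.univ _ (Finset.mem_univ i)]
  congr 1
  · simp [matDeriv]
  · refine Finset.prod_congr rfl fun j hj => ?_
    rw [Matrix.updateCol_ne (Finset.ne_of_mem_erase hj)]

lemma MatSmoothAt.det {A : M → Matrix ι ι ℝ} {x : M} (hA : MatSmoothAt n A x) :
    ContMDiffAt (𝓡 n) 𝓘(ℝ, ℝ) ∞ (fun y => (A y).det) x := by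
  simp only [Matrix.det_apply']
  exact contMDiffAt_finsetSum fun σ _ =>
    contMDiffAt_const.mul (contMDiffAt_finsetProd fun i _ => hA _ _)

lemma contMDiffAt_comp_real {f : M → ℝ} {x : M} {φ : ℝ → ℝ}
    (hφ : ContDiffAt ℝ ∞ φ (f x)) (hf : ContMDiffAt (𝓡 n) 𝓘(ℝ, ℝ) ∞ f x) :
    ContMDiffAt (𝓡 n) 𝓘(ℝ, ℝ) ∞ (fun y => φ (f y)) x :=
  hφ.contMDiffAt.comp x hf

/-- The inverse is the adjugate over the determinant, and an entry of the adjugate is the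
determinant of A with one row replaced by a constant vector. -/
lemma MatSmoothAt.inv {A : M → Matrix ι ι ℝ} {x : M} (hA : MatSmoothAt n A x)
    (h0 : (A x).det ≠ 0) : MatSmoothAt n (fun y => (A y)⁻¹) x := by
  intro i j
  have h1 : ContMDiffAt (𝓡 n) 𝓘(ℝ, ℝ) ∞ (fun y => (A y).adjugate i j) x := by
    simp only [Matrix.adjugate_apply]
    refine MatSmoothAt.det fun k l => ?_
    by_cases hk : k = j
    · subst hk
      simp only [Matrix.updateRow_self]
      exact contMDiffAt_const
    · simp only [Matrix.updateRow_ne hk]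
      exact hA k l
  have h2 : ContMDiffAt (𝓡 n) 𝓘(ℝ, ℝ) ∞ (fun y => ((A y).det)⁻¹) x :=
    contMDiffAt_comp_real (φ := fun t => t⁻¹) (contDiffAt_inv ℝ h0) hA.det
  have h3 : (fun y => (A y)⁻¹ i j) = fun y => ((A y).det)⁻¹ * (A y).adjugate i j := by
    funext y
    rw [Matrix.inv_def, Matrix.smul_apply, Ring.inverse_eq_inv', smul_eq_mul]
  rw [h3]
  exact h2.mul h1

lemma MatSmoothAt.abs_det {A : M → Matrix ι ι ℝ} {x : M} (hA : MatSmoothAt n A x)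
    (h0 : (A x).det ≠ 0) : ContMDiffAt (𝓡 n) 𝓘(ℝ, ℝ) ∞ (fun y => |(A y).det|) x :=
  contMDiffAt_comp_real (φ := fun t => |t|) (contDiffAt_abs h0) hA.det

lemma eventually_det_ne_zero {A : M → Matrix ι ι ℝ} {x : M} (hA : MatDiffAt n A x)
    (h0 : (A x).det ≠ 0) : ∀ᶠ y in 𝓝 x, (A y).det ≠ 0 :=
  hA.det.continuousAt.eventually_ne h0

/-- Differentiate AB = 1 and multiply on the left by B, which for square matrices is a left inverse
as well. -/
lemma matDeriv_of_mul_eq_one {A B : M → Matrix ι ι ℝ} {x : M} (hA : MatDiffAt n A x)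
    (hB : MatDiffAt n B x) (hAB : ∀ᶠ y in 𝓝 x, A y * B y = 1) (v : TangentSpace (𝓡 n) x) :
    matDeriv B x v = -(B x * matDeriv A x v * B x) := by
  have h1 : matDeriv (fun y => A y * B y) x v = 0 := by
    rw [matDeriv_congr (B := fun _ => 1) hAB]
    ext i j
    exact mvfderiv_const_apply _ x v
  rw [matDeriv_mul hA hB] at h1
  have h2 : B x * A x = 1 := mul_eq_one_comm.mp hAB.self_of_nhds
  have h3 : B x * (matDeriv A x v * B x + A x * matDeriv B x v) = 0 := by rw [h1, mul_zero]
  rw [mul_add, ← mul_assoc (B x) (A x), h2, one_mul, ← mul_assoc] at h3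
  exact eq_neg_of_add_eq_zero_right h3

/-- Jacobi's formula says that det has logarithmic derivative tr(A⁻¹A'); taking absolute values
multiplies both det and its derivative by the same locally constant sign. -/
lemma mvfderiv_abs_det {A : M → Matrix ι ι ℝ} {x : M} (hA : MatDiffAt n A x)
    (h0 : (A x).det ≠ 0) (v : TangentSpace (𝓡 n) x) :
    mvfderiv (𝓡 n) (fun y => |(A y).det|) x v
      = |(A x).det| * ((A x)⁻¹ * matDeriv A x v).trace := by
  rw [mvfderiv_comp_real (φ := fun t => |t|) hA.det (hasDerivAt_abs h0), mvfderiv_det hA,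
    Matrix.inv_def, Ring.inverse_eq_inv', Matrix.smul_mul, Matrix.trace_smul, smul_eq_mul,
    ← mul_assoc]
  congr 1
  rcases lt_or_gt_of_ne h0 with h | h
  · rw [abs_of_neg h, sign_neg h]; field_simp; simp
  · rw [abs_of_pos h, sign_pos h]; field_simp; simp

end MatrixFunctions

/-! ## The coordinate frame of the tangent bundle -/

section CoordinateFrame

variable {n : ℕ} {M : Type*} [TopologicalSpace M] [ChartedSpace (EuclideanSpace ℝ (Fin n)) M]

/-- The domain of the coordinate frame of the preferred chart at `x`. -/
def frameDomain (n : ℕ) {M : Type*} [TopologicalSpace M]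
    [ChartedSpace (EuclideanSpace ℝ (Fin n)) M] [IsManifold (𝓡 n) ∞ M] (x : M) : Set M :=
  (trivializationAt (EuclideanSpace ℝ (Fin n)) (TangentSpace (𝓡 n) : M → Type _) x).baseSet

variable [IsManifold (𝓡 n) ∞ M]

lemma isOpen_frameDomain (x : M) : IsOpen (frameDomain n x) :=
  (trivializationAt (EuclideanSpace ℝ (Fin n)) (TangentSpace (𝓡 n) : M → Type _) x).open_baseSet

lemma mem_frameDomain (x : M) : x ∈ frameDomain n x := mem_baseSet_trivializationAt _ _ x

lemma frameDomain_mem_nhds {x y : M} (hy : y ∈ frameDomain n x) : frameDomain n x ∈ 𝓝 y :=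
  (isOpen_frameDomain x).mem_nhds hy

/-- The coordinate basis of the preferred chart at `x`, at a point `y` of its domain. -/
def frameBasis {x y : M} (hy : y ∈ frameDomain n x) :
    Module.Basis (Fin n) ℝ (TangentSpace (𝓡 n) y) :=
  (trivializationAt (EuclideanSpace ℝ (Fin n)) (TangentSpace (𝓡 n) : M → Type _) x).basisAt
    (EuclideanSpace.basisFun (Fin n) ℝ).toBasis hy

lemma frameBasis_apply {x y : M} (hy : y ∈ frameDomain n x) (i : Fin n) :
    frameBasis hy i = coordField x i y :=
  ((trivializationAt (EuclideanSpace ℝ (Fin n)) (TangentSpace (𝓡 n) : M → Type _)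
    x).localFrame_apply_of_mem_baseSet (EuclideanSpace.basisFun (Fin n) ℝ).toBasis hy).symm

lemma frameBasis_coord {x y : M} (hy : y ∈ frameDomain n x) (i : Fin n) :
    (frameBasis hy).coord i = coordForm x i y := by
  refine (frameBasis hy).ext fun j => ?_
  rw [Module.Basis.coord_apply, Module.Basis.repr_self, frameBasis_apply,
    coordForm_coordField hy, Finsupp.single_apply]
  simp [eq_comm]

lemma sum_coordForm_smul {x y : M} (hy : y ∈ frameDomain n x) (v : TangentSpace (𝓡 n) y) :
    ∑ i, coordForm x i y v • coordField x i y = v := by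
  conv_rhs => rw [← (frameBasis hy).sum_repr v]
  refine Finset.sum_congr rfl fun i _ => ?_
  rw [frameBasis_apply, ← frameBasis_coord hy]
  rfl

lemma linearMap_eq_sum {W : Type*} [AddCommGroup W] [Module ℝ W] {x y : M}
    (hy : y ∈ frameDomain n x) (μ : TangentSpace (𝓡 n) y →ₗ[ℝ] W) (v : TangentSpace (𝓡 n) y) :
    μ v = ∑ i, coordForm x i y v • μ (coordField x i y) := by
  conv_lhs => rw [← sum_coordForm_smul hy v]
  rw [map_sum]
  exact Finset.sum_congr rfl fun i _ => map_smul _ _ _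

/-- The vector field `Y` is smooth at `x`. -/
def FieldSmoothAt (Y : Π y : M, TangentSpace (𝓡 n) y) (x : M) : Prop :=
  ContMDiffAt (𝓡 n) ((𝓡 n).prod 𝓘(ℝ, EuclideanSpace ℝ (Fin n))) ∞
    (fun y => TotalSpace.mk' (EuclideanSpace ℝ (Fin n))
      (E := (TangentSpace (𝓡 n) : M → Type _)) y (Y y)) x

lemma FieldSmoothAt.fieldDiffAt {Y : Π y : M, TangentSpace (𝓡 n) y} {x : M}
    (h : FieldSmoothAt Y x) : FieldDiffAt Y x :=
  ContMDiffAt.mdifferentiableAt h (by simp)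

lemma FieldSmoothAt.congr {Y Z : Π y : M, TangentSpace (𝓡 n) y} {x : M}
    (h : FieldSmoothAt Y x) (hYZ : ∀ᶠ y in 𝓝 x, Z y = Y y) : FieldSmoothAt Z x :=
  ContMDiffAt.congr_of_eventuallyEq h (hYZ.mono fun y hy => by simp only [hy])

lemma FieldDiffAt.congr {Y Z : Π y : M, TangentSpace (𝓡 n) y} {x : M}
    (h : FieldDiffAt Y x) (hYZ : ∀ᶠ y in 𝓝 x, Z y = Y y) : FieldDiffAt Z x :=
  MDifferentiableAt.congr_of_eventuallyEq h (hYZ.mono fun y hy => by simp only [hy])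

lemma coordField_smoothAt {x y : M} (hy : y ∈ frameDomain n x) (i : Fin n) :
    FieldSmoothAt (coordField x i) y :=
  contMDiffAt_localFrame_of_mem (I := 𝓡 n) ∞ (trivializationAt (EuclideanSpace ℝ (Fin n))
    (TangentSpace (𝓡 n) : M → Type _) x) (EuclideanSpace.basisFun (Fin n) ℝ).toBasis i hy

lemma coordField_diffAt {x y : M} (hy : y ∈ frameDomain n x) (i : Fin n) :
    FieldDiffAt (coordField x i) y := (coordField_smoothAt hy i).fieldDiffAt

lemma FieldDiffAt.coordForm {Y : Π y : M, TangentSpace (𝓡 n) y} {x y : M}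
    (hy : y ∈ frameDomain n x) (h : FieldDiffAt Y y) (i : Fin n) :
    MDifferentiableAt (𝓡 n) 𝓘(ℝ, ℝ) (fun z => ProjTractor.coordForm x i z (Y z)) y := by
  have h1 : MDifferentiableAt (𝓡 n) 𝓘(ℝ, EuclideanSpace ℝ (Fin n)) (fun z =>
      ((trivializationAt (EuclideanSpace ℝ (Fin n)) (TangentSpace (𝓡 n) : M → Type _) x)
        (TotalSpace.mk' (EuclideanSpace ℝ (Fin n)) z (Y z))).2) y :=
    ((trivializationAt (EuclideanSpace ℝ (Fin n)) (TangentSpace (𝓡 n) : M → Type _)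
      x).mdifferentiableAt_section_iff (𝓡 n) Y hy).mp h
  have h2 : MDifferentiableAt (𝓡 n) 𝓘(ℝ, ℝ) (fun z =>
      (EuclideanSpace.proj (𝕜 := ℝ) i) (((trivializationAt (EuclideanSpace ℝ (Fin n))
        (TangentSpace (𝓡 n) : M → Type _) x)
        (TotalSpace.mk' (EuclideanSpace ℝ (Fin n)) z (Y z))).2)) y :=
    ((EuclideanSpace.proj (𝕜 := ℝ) i).differentiableAt.mdifferentiableAt).comp y h1
  refine h2.congr_of_eventuallyEq ?_
  filter_upwards [frameDomain_mem_nhds hy] with z hz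
  exact Trivialization.localFrameCoeff_eq_coeff (I := 𝓡 n) (s := Y) (i := i)
    (b := (EuclideanSpace.basisFun (Fin n) ℝ).toBasis) _ hz

lemma FieldSmoothAt.smul {f : M → ℝ} {Y : Π y : M, TangentSpace (𝓡 n) y} {x : M}
    (hf : ContMDiffAt (𝓡 n) 𝓘(ℝ, ℝ) ∞ f x) (h : FieldSmoothAt Y x) :
    FieldSmoothAt (fun y => f y • Y y) x := ContMDiffAt.smul_section hf h

lemma FieldSmoothAt.add {Y Z : Π y : M, TangentSpace (𝓡 n) y} {x : M}
    (h : FieldSmoothAt Y x) (h' : FieldSmoothAt Z x) :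
    FieldSmoothAt (fun y => Y y + Z y) x := ContMDiffAt.add_section h h'

lemma FieldDiffAt.smul {f : M → ℝ} {Y : Π y : M, TangentSpace (𝓡 n) y} {x : M}
    (hf : MDifferentiableAt (𝓡 n) 𝓘(ℝ, ℝ) f x) (h : FieldDiffAt Y x) :
    FieldDiffAt (fun y => f y • Y y) x := MDifferentiableAt.smul_section hf h

lemma FieldDiffAt.add {Y Z : Π y : M, TangentSpace (𝓡 n) y} {x : M}
    (h : FieldDiffAt Y x) (h' : FieldDiffAt Z x) :
    FieldDiffAt (fun y => Y y + Z y) x := mdifferentiableAt_add_section h h'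

lemma FieldDiffAt.sum {ι : Type*} {s : Finset ι} {Y : ι → Π y : M, TangentSpace (𝓡 n) y} {x : M}
    (h : ∀ i ∈ s, FieldDiffAt (Y i) x) :
    FieldDiffAt (fun y => ∑ i ∈ s, Y i y) x := MDifferentiableAt.sum_section h

end CoordinateFrame

/-! ## Smoothness of sections of bundles of linear maps -/

section HomSections

variable {n : ℕ} {M : Type*} [TopologicalSpace M] [ChartedSpace (EuclideanSpace ℝ (Fin n)) M]
  [IsManifold (𝓡 n) ∞ M]
  {F : Type*} [NormedAddCommGroup F] [NormedSpace ℝ F]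
  {V : M → Type*} [TopologicalSpace (TotalSpace F V)]
  [∀ x, AddCommGroup (V x)] [∀ x, Module ℝ (V x)] [∀ x, TopologicalSpace (V x)]
  [∀ x, IsTopologicalAddGroup (V x)] [∀ x, ContinuousSMul ℝ (V x)]
  [FiberBundle F V] [VectorBundle ℝ F V]

/-- In trivialisations L is the sum over i of the i-th coordinate functional tensored with L(∂ᵢ), so
it depends on the columns L(∂ᵢ) through fixed continuous linear maps. Taking the trivial, the
cotangent and the tangent bundle for `V` covers one-forms, bilinear forms and covariant derivatives
of fields. -/
lemma contMDiffAt_hom_of_coordField [ContMDiffVectorBundle ∞ F V (𝓡 n)] {x : M}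
    (L : Π y : M, TangentSpace (𝓡 n) y →L[ℝ] V y)
    (h : ∀ i : Fin n, ContMDiffAt (𝓡 n) ((𝓡 n).prod 𝓘(ℝ, F)) ∞
      (fun y => TotalSpace.mk' F (E := V) y (L y (coordField x i y))) x) :
    ContMDiffAt (𝓡 n) ((𝓡 n).prod 𝓘(ℝ, EuclideanSpace ℝ (Fin n) →L[ℝ] F)) ∞
      (fun y => TotalSpace.mk' (EuclideanSpace ℝ (Fin n) →L[ℝ] F)
        (E := fun y : M => TangentSpace (𝓡 n) y →L[ℝ] V y) y (L y)) x := by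
  rw [contMDiffAt_hom_bundle]
  refine ⟨contMDiffAt_id, ?_⟩
  have h1 : ∀ i : Fin n, ContMDiffAt (𝓡 n) 𝓘(ℝ, F) ∞
      (fun y => ((trivializationAt F V x) (TotalSpace.mk' F y (L y (coordField x i y)))).2) x :=
    fun i => (contMDiffAt_section _).mp (h i)
  have h2 : ContMDiffAt (𝓡 n) 𝓘(ℝ, EuclideanSpace ℝ (Fin n) →L[ℝ] F) ∞ (fun y =>
      ∑ i : Fin n, ContinuousLinearMap.smulRightL ℝ (EuclideanSpace ℝ (Fin n)) F
        (EuclideanSpace.proj i)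
        ((trivializationAt F V x) (TotalSpace.mk' F y (L y (coordField x i y)))).2) x :=
    contMDiffAt_finsetSum fun i _ =>
      (ContinuousLinearMap.contMDiff _).contMDiffAt.comp x (h1 i)
  refine h2.congr_of_eventuallyEq ?_
  have hV : (trivializationAt F V x).baseSet ∈ 𝓝 x :=
    (trivializationAt F V x).open_baseSet.mem_nhds (mem_baseSet_trivializationAt F V x)
  filter_upwards [frameDomain_mem_nhds (mem_frameDomain (n := n) x), hV] with y hy hy'
  refine ContinuousLinearMap.coe_injective
    ((EuclideanSpace.basisFun (Fin n) ℝ).toBasis.ext fun j => ?_)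
  have h3 : (trivializationAt (EuclideanSpace ℝ (Fin n)) (TangentSpace (𝓡 n) : M → Type _)
      x).symmL ℝ y ((EuclideanSpace.basisFun (Fin n) ℝ).toBasis j) = coordField x j y := by
    rw [← frameBasis_apply hy]
    simp only [frameBasis, Trivialization.basisAt, Module.Basis.map_apply]
    exact Trivialization.symmL_apply (trivializationAt (EuclideanSpace ℝ (Fin n))
      (TangentSpace (𝓡 n) : M → Type _) x) hy _
  have h4 : ∀ w : V y, (trivializationAt F V x).continuousLinearMapAt ℝ y w
      = ((trivializationAt F V x) (TotalSpace.mk' F y w)).2 := fun w => by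
    rw [Trivialization.continuousLinearMapAt_apply, Trivialization.coe_linearMapAt_of_mem _ hy']
  refine (show _ = (trivializationAt F V x).continuousLinearMapAt ℝ y (L y
    ((trivializationAt (EuclideanSpace ℝ (Fin n)) (TangentSpace (𝓡 n) : M → Type _)
      x).symmL ℝ y ((EuclideanSpace.basisFun (Fin n) ℝ).toBasis j))) from rfl).trans ?_
  rw [h3, h4]
  simp [PiLp.single_apply]
end HomSections

/-! ### Smoothness of one-forms and of bilinear forms on the tangent bundle -/

section TensorFields

variable {n : ℕ} {M : Type*} [TopologicalSpace M] [ChartedSpace (EuclideanSpace ℝ (Fin n)) M]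
  [IsManifold (𝓡 n) ∞ M]

/-- Smoothness at `x` of a one-form. -/
def OneFormSmoothAt (Υ : Π y : M, TangentSpace (𝓡 n) y →L[ℝ] ℝ) (x : M) : Prop :=
  ContMDiffAt (𝓡 n) ((𝓡 n).prod 𝓘(ℝ, EuclideanSpace ℝ (Fin n) →L[ℝ] ℝ)) ∞
    (fun y => TotalSpace.mk' (EuclideanSpace ℝ (Fin n) →L[ℝ] ℝ)
      (E := fun y : M => TangentSpace (𝓡 n) y →L[ℝ] ℝ) y (Υ y)) x

omit [IsManifold (𝓡 n) ∞ M] in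
lemma contMDiffAt_trivial_iff {f : M → ℝ} {x : M} :
    ContMDiffAt (𝓡 n) ((𝓡 n).prod 𝓘(ℝ, ℝ)) ∞
      (fun y => TotalSpace.mk' ℝ (E := Bundle.Trivial M ℝ) y (f y)) x ↔
    ContMDiffAt (𝓡 n) 𝓘(ℝ, ℝ) ∞ f x :=
  contMDiffAt_section _

lemma OneFormSmoothAt.apply {Υ : Π y : M, TangentSpace (𝓡 n) y →L[ℝ] ℝ} {x : M}
    (h : OneFormSmoothAt Υ x) {Y : Π y : M, TangentSpace (𝓡 n) y} (hY : FieldSmoothAt Y x) :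
    ContMDiffAt (𝓡 n) 𝓘(ℝ, ℝ) ∞ (fun y => Υ y (Y y)) x :=
  contMDiffAt_trivial_iff.mp
    (ContMDiffAt.clm_bundle_apply (F₁ := EuclideanSpace ℝ (Fin n)) (F₂ := ℝ)
      (E₁ := (TangentSpace (𝓡 n) : M → Type _)) (E₂ := Bundle.Trivial M ℝ) (b := id) h hY)

lemma oneFormSmoothAt_of_coordField {Υ : Π y : M, TangentSpace (𝓡 n) y →L[ℝ] ℝ} {x : M}
    (h : ∀ i : Fin n, ContMDiffAt (𝓡 n) 𝓘(ℝ, ℝ) ∞ (fun y => Υ y (coordField x i y)) x) :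
    OneFormSmoothAt Υ x :=
  contMDiffAt_hom_of_coordField (V := Bundle.Trivial M ℝ) Υ fun i =>
    contMDiffAt_trivial_iff.mpr (h i)

/-- Smoothness at `x` of a field of bilinear forms on the tangent bundle. -/
def BilinSmoothAt (g : Π y : M, TangentSpace (𝓡 n) y →L[ℝ] TangentSpace (𝓡 n) y →L[ℝ] ℝ)
    (x : M) : Prop :=
  ContMDiffAt (𝓡 n)
    ((𝓡 n).prod 𝓘(ℝ, EuclideanSpace ℝ (Fin n) →L[ℝ] EuclideanSpace ℝ (Fin n) →L[ℝ] ℝ)) ∞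
    (fun y => TotalSpace.mk' (EuclideanSpace ℝ (Fin n) →L[ℝ] EuclideanSpace ℝ (Fin n) →L[ℝ] ℝ)
      (E := fun y : M => TangentSpace (𝓡 n) y →L[ℝ] TangentSpace (𝓡 n) y →L[ℝ] ℝ) y (g y)) x

lemma BilinSmoothAt.apply
    {g : Π y : M, TangentSpace (𝓡 n) y →L[ℝ] TangentSpace (𝓡 n) y →L[ℝ] ℝ} {x : M}
    (h : BilinSmoothAt g x) {Y Z : Π y : M, TangentSpace (𝓡 n) y} (hY : FieldSmoothAt Y x)
    (hZ : FieldSmoothAt Z x) :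
    ContMDiffAt (𝓡 n) 𝓘(ℝ, ℝ) ∞ (fun y => g y (Y y) (Z y)) x := by
  have h1 : OneFormSmoothAt (fun y => g y (Y y)) x :=
    ContMDiffAt.clm_bundle_apply (F₁ := EuclideanSpace ℝ (Fin n))
      (F₂ := EuclideanSpace ℝ (Fin n) →L[ℝ] ℝ)
      (E₁ := (TangentSpace (𝓡 n) : M → Type _))
      (E₂ := fun y : M => TangentSpace (𝓡 n) y →L[ℝ] ℝ) (b := id) h hY
  exact h1.apply hZ

lemma bilinSmoothAt_of_coordField
    {g : Π y : M, TangentSpace (𝓡 n) y →L[ℝ] TangentSpace (𝓡 n) y →L[ℝ] ℝ} {x : M}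
    (h : ∀ i j : Fin n, ContMDiffAt (𝓡 n) 𝓘(ℝ, ℝ) ∞
      (fun y => g y (coordField x i y) (coordField x j y)) x) :
    BilinSmoothAt g x :=
  contMDiffAt_hom_of_coordField (V := fun y : M => TangentSpace (𝓡 n) y →L[ℝ] ℝ) g fun i =>
    oneFormSmoothAt_of_coordField fun j => h i j

end TensorFields

/-! ## Affine connections in coordinates -/

section ConnectionCoordinates

variable {n : ℕ} {M : Type*} [TopologicalSpace M] [ChartedSpace (EuclideanSpace ℝ (Fin n)) M]
  [IsManifold (𝓡 n) ∞ M]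

/-- A covariant derivative obeys its laws only on differentiable fields, so locality carries a
differentiability hypothesis; for the same reason connections are compared below only on such
fields. -/
lemma connection_congr (D : AffineConnection n M) {Y Z : Π y : M, TangentSpace (𝓡 n) y} {x : M}
    (hY : FieldDiffAt Y x) (hYZ : ∀ᶠ y in 𝓝 x, Z y = Y y) : D Z x = D Y x :=
  D.isCovariantDerivativeOnUniv.congr_of_eventuallyEq (hY.congr hYZ) hY univ_mem hYZ

lemma connection_add (D : AffineConnection n M) {Y Z : Π y : M, TangentSpace (𝓡 n) y} {x : M}
    (hY : FieldDiffAt Y x) (hZ : FieldDiffAt Z x) (v : TangentSpace (𝓡 n) x) :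
    D (fun y => Y y + Z y) x v = D Y x v + D Z x v :=
  congrArg (fun T => T v) (D.isCovariantDerivativeOnUniv.add hY hZ)

lemma connection_smul (D : AffineConnection n M) {f : M → ℝ}
    {Y : Π y : M, TangentSpace (𝓡 n) y} {x : M}
    (hf : MDifferentiableAt (𝓡 n) 𝓘(ℝ, ℝ) f x) (hY : FieldDiffAt Y x)
    (v : TangentSpace (𝓡 n) x) :
    D (fun y => f y • Y y) x v = f x • D Y x v + mvfderiv (𝓡 n) f x v • Y x :=
  congrArg (fun T => T v) (D.isCovariantDerivativeOnUniv.leibniz hY hf)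

lemma connection_sum (D : AffineConnection n M) {ι : Type*} {s : Finset ι}
    {Y : ι → Π y : M, TangentSpace (𝓡 n) y} {x : M} (hY : ∀ i ∈ s, FieldDiffAt (Y i) x)
    (v : TangentSpace (𝓡 n) x) :
    D (fun y => ∑ i ∈ s, Y i y) x v = ∑ i ∈ s, D (Y i) x v := by
  classical
  induction s using Finset.induction_on with
  | empty =>
    simp only [Finset.sum_empty]
    exact congrArg (fun T => T x v) D.zero
  | insert a s ha ih =>
    simp only [Finset.sum_insert ha]
    rw [connection_add D (hY a (by simp)) (FieldDiffAt.sum fun i hi => hY i (by simp [hi])),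
      ih fun i hi => hY i (by simp [hi])]

lemma connection_eq_sum (D : AffineConnection n M) {Y : Π y : M, TangentSpace (𝓡 n) y} {x y : M}
    (hy : y ∈ frameDomain n x) (hY : FieldDiffAt Y y) (v : TangentSpace (𝓡 n) y) :
    D Y y v = ∑ i, (coordForm x i y (Y y) • D (coordField x i) y v
      + mvfderiv (𝓡 n) (fun z => coordForm x i z (Y z)) y v • coordField x i y) := by
  have h1 : ∀ i ∈ Finset.univ, FieldDiffAt
      (fun z => coordForm x i z (Y z) • coordField (n := n) x i z) y :=
    fun i _ => FieldDiffAt.smul (hY.coordForm hy i) (coordField_diffAt hy i)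
  have h2 : ∀ᶠ z in 𝓝 y, Y z = ∑ i, coordForm x i z (Y z) • coordField x i z := by
    filter_upwards [frameDomain_mem_nhds hy] with z hz using (sum_coordForm_smul hz _).symm
  rw [connection_congr D (FieldDiffAt.sum h1) h2, connection_sum D h1]
  exact Finset.sum_congr rfl fun i _ => connection_smul D (hY.coordForm hy i)
    (coordField_diffAt hy i) v

/-- Two connections that agree on the coordinate fields at `x` agree on all fields that are
differentiable at `x`. -/
lemma connection_eq_of_coordField {D D' : AffineConnection n M} {x y : M}
    (hy : y ∈ frameDomain n x) (h : ∀ i, D' (coordField x i) y = D (coordField x i) y)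
    {Y : Π y : M, TangentSpace (𝓡 n) y} (hY : FieldDiffAt Y y) : D' Y y = D Y y := by
  ext1 v
  rw [connection_eq_sum D hy hY, connection_eq_sum D' hy hY]
  simp only [h]

lemma frameDomain_eq (x : M) :
    frameDomain n x = (chartAt (EuclideanSpace ℝ (Fin n)) x).source :=
  TangentBundle.trivializationAt_baseSet x

/-- A vector field that is smooth near the preferred chart at `x` can be cut off. -/
lemma exists_smooth_extension [T2Space M] (x : M) {Y : Π y : M, TangentSpace (𝓡 n) y}
    (hY : ∀ y ∈ frameDomain n x, FieldSmoothAt Y y) :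
    ∃ Z : Π y : M, TangentSpace (𝓡 n) y, (∀ y, FieldSmoothAt Z y) ∧ ∀ᶠ y in 𝓝 x, Z y = Y y := by
  obtain ⟨ρ⟩ : Nonempty (SmoothBumpFunction (𝓡 n) x) := inferInstance
  -- The bump function has its support inside the chart domain and equals 1 near x, so the product
  -- is smooth where Y is and vanishes locally elsewhere.
  refine ⟨fun y => ρ y • Y y, fun y => ?_, ?_⟩
  · by_cases hy : y ∈ tsupport ρ
    · have hy' : y ∈ frameDomain n x := by
        rw [frameDomain_eq]; exact ρ.tsupport_subset_chartAt_source hy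
      exact FieldSmoothAt.smul ρ.contMDiffAt (hY y hy')
    · have h0 : ∀ᶠ z in 𝓝 y, ρ z • Y z = 0 := by
        filter_upwards [(isClosed_tsupport ρ).isOpen_compl.mem_nhds hy] with z hz
        rw [image_eq_zero_of_notMem_tsupport hz, zero_smul]
      exact FieldSmoothAt.congr (Y := fun _ => 0)
        (Bundle.contMDiff_zeroSection ℝ (TangentSpace (𝓡 n) : M → Type _)).contMDiffAt h0
  · filter_upwards [ρ.eventuallyEq_one] with y hy
    rw [hy]; simp

/-- Smoothness of `D` is a condition on globally smooth fields, whereas Y is smooth only on a chart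
domain. Cutting Y off repairs this, and by locality the derivative near x does not notice. -/
lemma connection_smoothAt [T2Space M] {D : AffineConnection n M}
    (hD : CovariantDerivative.ContMDiffCovariantDerivative D ∞) (x : M)
    {Y Z : Π y : M, TangentSpace (𝓡 n) y}
    (hY : ∀ y ∈ frameDomain n x, FieldSmoothAt Y y) (hZ : FieldSmoothAt Z x) :
    FieldSmoothAt (fun y => D Y y (Z y)) x := by
  obtain ⟨W, hW, hWY⟩ := exists_smooth_extension x hY
  -- A connection of class k takes fields of class k + 1; here ∞ + 1 is ∞.
  have h1 : ContMDiffOn (𝓡 n) ((𝓡 n).prod 𝓘(ℝ, EuclideanSpace ℝ (Fin n))) (∞ + 1)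
    (fun y => TotalSpace.mk' (EuclideanSpace ℝ (Fin n))
      (E := (TangentSpace (𝓡 n) : M → Type _)) y (W y)) Set.univ :=
    fun y _ => (hW y).contMDiffWithinAt
  have h2 := hD.contMDiff.contMDiff h1
  have h3 := (h2.contMDiffAt (x := x) univ_mem)
  have h4 : FieldSmoothAt (fun y => D W y (Z y)) x :=
    ContMDiffAt.clm_bundle_apply (F₁ := EuclideanSpace ℝ (Fin n))
      (F₂ := EuclideanSpace ℝ (Fin n))
      (E₁ := (TangentSpace (𝓡 n) : M → Type _))
      (E₂ := (TangentSpace (𝓡 n) : M → Type _)) (b := id) h3 hZ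
  refine h4.congr ?_
  filter_upwards [hWY.eventually_nhds] with y hy
  rw [connection_congr D (hW y).fieldDiffAt (hy.mono fun z hz => hz.symm)]

lemma connection_coordField_smoothAt [T2Space M] {D : AffineConnection n M}
    (hD : IsSmoothTorsionFree D) (x : M) (i j : Fin n) :
    FieldSmoothAt (fun y => D (coordField x i) y (coordField x j y)) x :=
  connection_smoothAt hD.1 x (fun _ hy => coordField_smoothAt hy i)
    (coordField_smoothAt (mem_frameDomain x) j)

end ConnectionCoordinates

/-! ### Commuting coordinate fields and symmetric Christoffel symbols -/

section TorsionFree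

variable {n : ℕ} {M : Type*} [TopologicalSpace M] [ChartedSpace (EuclideanSpace ℝ (Fin n)) M]
  [IsManifold (𝓡 n) ∞ M]

lemma lieBracketWithin_eq_zero {E : Type*} [NormedAddCommGroup E] [NormedSpace ℝ E] {V W : E → E}
    {s : Set E} {z : E} (hV : fderivWithin ℝ V s z = 0) (hW : fderivWithin ℝ W s z = 0) :
    VectorField.lieBracketWithin ℝ V W s z = 0 := by
  simp [VectorField.lieBracketWithin, hV, hW]

/-- Pulled back by the inverse chart, the coordinate fields are constant near the image of x, so
their derivatives, and with them the bracket, vanish. -/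
lemma mlieBracket_coordField (x : M) (i j : Fin n) :
    VectorField.mlieBracket (𝓡 n) (coordField x i) (coordField x j) x = 0 := by
  have key : ∀ k : Fin n, VectorField.mpullbackWithin 𝓘(ℝ, EuclideanSpace ℝ (Fin n)) (𝓡 n)
      (extChartAt (𝓡 n) x).symm (coordField x k) (Set.range (𝓡 n))
      =ᶠ[𝓝 (extChartAt (𝓡 n) x x)] fun _ => (EuclideanSpace.basisFun (Fin n) ℝ).toBasis k := by
    intro k
    filter_upwards [extChartAt_target_mem_nhds (I := 𝓡 n) x] with z hz
    have hz' : (extChartAt (𝓡 n) x).symm z ∈ (chartAt (EuclideanSpace ℝ (Fin n)) x).source := by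
      have := (extChartAt (𝓡 n) x).map_target hz
      rwa [extChartAt_source] at this
    have h1 : coordField x k ((extChartAt (𝓡 n) x).symm z)
        = mfderivWithin 𝓘(ℝ, EuclideanSpace ℝ (Fin n)) (𝓡 n) (extChartAt (𝓡 n) x).symm
          (Set.range (𝓡 n)) z ((EuclideanSpace.basisFun (Fin n) ℝ).toBasis k) := by
      have h2 := TangentBundle.symmL_trivializationAt (I := 𝓡 n) (𝕜 := ℝ) hz'
      rw [(extChartAt (𝓡 n) x).right_inv hz] at h2
      have hy : (extChartAt (𝓡 n) x).symm z ∈ frameDomain n x := by rwa [frameDomain_eq]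
      rw [← h2, ← frameBasis_apply hy]
      simp only [frameBasis, Trivialization.basisAt, Module.Basis.map_apply]
      exact (Trivialization.symmL_apply (trivializationAt (EuclideanSpace ℝ (Fin n))
        (TangentSpace (𝓡 n) : M → Type _) x) hy _).symm
    rw [VectorField.mpullbackWithin_apply, h1]
    exact (isInvertible_mfderivWithin_extChartAt_symm hz).inverse_apply_self _
  have hd : ∀ (k : Fin n) (S : Set (EuclideanSpace ℝ (Fin n))), fderivWithin ℝ
      (VectorField.mpullbackWithin 𝓘(ℝ, EuclideanSpace ℝ (Fin n)) (𝓡 n)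
        (extChartAt (𝓡 n) x).symm (coordField x k) (Set.range (𝓡 n)) :
        EuclideanSpace ℝ (Fin n) → EuclideanSpace ℝ (Fin n)) S (extChartAt (𝓡 n) x x) = 0 := by
    intro k S
    refine (key k).fderivWithin_eq_of_nhds.trans ?_
    exact congrFun (fderivWithin_const (𝕜 := ℝ) (s := S)
      ((EuclideanSpace.basisFun (Fin n) ℝ).toBasis k)) _
  rw [← VectorField.mlieBracketWithin_univ, VectorField.mlieBracketWithin_apply]
  exact (congrArg _ (lieBracketWithin_eq_zero (hd i _) (hd j _))).trans (map_zero _)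

/-- On commuting fields the torsion is the difference of the two covariant derivatives. It suffices
to know this at the centre of the chart, because every tensor here is evaluated in the preferred
chart at its own base point. -/
lemma connection_coordField_symm {D : AffineConnection n M} (hD : IsSmoothTorsionFree D) (x : M)
    (i j : Fin n) : D (coordField x j) x (coordField x i x)
      = D (coordField x i) x (coordField x j x) := by
  have h := D.torsion_eq_zero_iff.mp hD.2 (coordField_diffAt (mem_frameDomain (n := n) x) i)
    (coordField_diffAt (mem_frameDomain x) j)
  rw [mlieBracket_coordField] at h
  exact sub_eq_zero.mp h

end TorsionFree

/-! ### Connection form and Ricci tensor in the coordinate frame -/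

section Curvature

variable {n : ℕ} {M : Type*} [TopologicalSpace M] [ChartedSpace (EuclideanSpace ℝ (Fin n)) M]
  [IsManifold (𝓡 n) ∞ M]

/-- The connection form of `D` at `x` in the coordinate frame of the preferred chart at `x`. -/
def connForm (D : AffineConnection n M) (x : M) (v : TangentSpace (𝓡 n) x) :
    Matrix (Fin n) (Fin n) ℝ :=
  Matrix.of fun k j => coordForm x k x (D (coordField x j) x v)

lemma connTrace_eq_trace (D : AffineConnection n M) (x : M) (v : TangentSpace (𝓡 n) x) :
    connTrace D x v = (connForm D x v).trace := by
  simp [connTrace, connForm, Matrix.trace, LinearMap.sum_apply]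

lemma ricci_coordField (D : AffineConnection n M) (x : M) (j k : Fin n) :
    ricci D x (coordField x j x) (coordField x k x) = ∑ i : Fin n,
      coordForm x i x (curvature D (coordField x i) (coordField x j) (coordField x k) x) := by
  rw [← coordBasis_apply, ← coordBasis_apply, ricci, ← LinearMap.BilinForm.toMatrix_apply,
    LinearMap.BilinForm.toMatrix_toBilin]
  rfl

lemma bilin_ext_coordField {x : M} {B C : LinearMap.BilinForm ℝ (TangentSpace (𝓡 n) x)}
    (h : ∀ i j : Fin n, B (coordField x i x) (coordField x j x)
      = C (coordField x i x) (coordField x j x)) : B = C :=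
  LinearMap.BilinForm.ext_basis (coordBasis x) fun i j => by
    simpa only [coordBasis_apply] using h i j

/-- Connections that agree on differentiable fields have the same curvature. -/
lemma ricci_congr [T2Space M] {D D' : AffineConnection n M} (hD : IsSmoothTorsionFree D)
    (h : ∀ (Y : Π y : M, TangentSpace (𝓡 n) y) (y : M), FieldDiffAt Y y → D' Y y = D Y y)
    (x : M) : ricci D' x = ricci D x := by
  refine bilin_ext_coordField fun j k => ?_
  rw [ricci_coordField, ricci_coordField]
  refine Finset.sum_congr rfl fun i _ => ?_
  congr 1
  have h1 : ∀ a b : Fin n, D' (fun y => D' (coordField x a) y (coordField x b y)) x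
      = D (fun y => D (coordField x a) y (coordField x b y)) x := by
    intro a b
    -- The second derivative is taken of a first derivative, which must itself be differentiable
    -- before the two connections may be exchanged on it; smoothness of `D` provides this.
    have h2 : FieldDiffAt (fun y => D (coordField x a) y (coordField x b y)) x :=
      (connection_coordField_smoothAt hD x a b).fieldDiffAt
    rw [← h _ x h2]
    refine connection_congr D' h2 ?_
    filter_upwards [frameDomain_mem_nhds (mem_frameDomain (n := n) x)] with y hy
    rw [h _ y (coordField_diffAt hy a)]
  simp only [curvature]
  rw [h1, h1, h _ x (coordField_diffAt (mem_frameDomain x) k)]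

lemma schouten_congr [T2Space M] {D D' : AffineConnection n M} (hD : IsSmoothTorsionFree D)
    (h : ∀ (Y : Π y : M, TangentSpace (𝓡 n) y) (y : M), FieldDiffAt Y y → D' Y y = D Y y)
    (x : M) : schouten D' x = schouten D x := by
  simp only [schouten, ricci_congr hD h]

lemma connTrace_congr {D D' : AffineConnection n M}
    (h : ∀ (Y : Π y : M, TangentSpace (𝓡 n) y) (y : M), FieldDiffAt Y y → D' Y y = D Y y)
    (x : M) : connTrace D' x = connTrace D x := by
  simp only [connTrace, fun i => h _ x (coordField_diffAt (mem_frameDomain (n := n) x) i)]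

lemma split_congr {D D' : AffineConnection n M}
    (h : ∀ (Y : Π y : M, TangentSpace (𝓡 n) y) (y : M), FieldDiffAt Y y → D' Y y = D Y y)
    (x : M) : split D' x = split D x := by
  simp only [split, connTrace_congr h]

end Curvature

/-! ## The cotractor frame -/

section CotractorCoordinates

variable {n : ℕ} {M : Type*} [TopologicalSpace M] [ChartedSpace (EuclideanSpace ℝ (Fin n)) M]
  [IsManifold (𝓡 n) ∞ M]

/-- The value of a density on the coordinate volume form, as a linear form. -/
def densityCoord (x y : M) : Density n y →ₗ[ℝ] ℝ where
  toFun s := s.1 (coordVol x y)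
  map_add' _ _ := rfl
  map_smul' _ _ := rfl

lemma densityCoord_apply (x y : M) (s : Density n y) : densityCoord x y s = s.1 (coordVol x y) :=
  rfl

/-- Top forms are multiples of the coordinate volume form, and homogeneity then reduces a density to
its value there. In contrast to `density_eq`, the point y ranges over the whole chart domain, as is
needed for differentiating components. -/
lemma density_eq_smul {x y : M} (hy : y ∈ frameDomain n x) (s : Density n y) :
    s = densityCoord x y s • coordDensity x y := by
  apply Subtype.ext
  funext η
  have hη : η = η (fun i : Fin n => coordField x i y) • coordVol x y := by
    have h1 := AlternatingMap.eq_smul_basis_det (frameBasis hy) η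
    have h2 := AlternatingMap.eq_smul_basis_det (frameBasis hy) (coordVol x y)
    have hb : (frameBasis hy : Fin n → TangentSpace (𝓡 n) y) =
        fun i : Fin n => coordField x i y := funext (frameBasis_apply hy)
    rw [hb] at h1 h2
    rw [coordVol_coordField hy, one_smul] at h2
    rw [h2]; exact h1
  have hs := s.2 (η (fun i : Fin n => coordField x i y)) (coordVol x y)
  rw [← hη] at hs
  rw [hs, mul_comm]; rfl

lemma densityCoord_coordDensity {x y : M} (hy : y ∈ frameDomain n x) :
    densityCoord x y (coordDensity (n := n) x y) = 1 := by
  have := coeff_smul_coordDensity (n := n) hy (fun _ => 1)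
  rw [densityCoord_apply]
  simpa [coeff] using this

lemma density_ext {x y : M} (hy : y ∈ frameDomain n x) {s t : Density n y}
    (h : densityCoord x y s = densityCoord x y t) : s = t := by
  rw [density_eq_smul hy s, density_eq_smul hy t, h]

/-- The coordinates on `𝒯*` dual to the cotractor frame of the preferred chart at `x`. -/
def frameCoord (D : AffineConnection n M) (x : M) : Option (Fin n) → Π y : M, Tractor n y
  | none => fun y => densityCoord x y ∘ₗ LinearMap.snd ℝ _ _ ∘ₗ (split D y).toLinearMap
  | some i => fun y => densityCoord x y ∘ₗ LinearMap.applyₗ (coordField x i y) ∘ₗ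
      LinearMap.fst ℝ _ _ ∘ₗ (split D y).toLinearMap

lemma frameCoord_none (D : AffineConnection n M) (x y : M) (u : Cotractor n y) :
    frameCoord D x none y u = densityCoord x y (split D y u).2 := rfl

lemma frameCoord_some (D : AffineConnection n M) (x y : M) (i : Fin n) (u : Cotractor n y) :
    frameCoord D x (some i) y u = densityCoord x y ((split D y u).1 (coordField x i y)) := rfl

lemma cotractorCoord_eq (D : AffineConnection n M) (x : M) (a : Option (Fin n)) :
    cotractorCoord D x a = frameCoord D x a x := by
  cases a <;> rfl

lemma split_cotractorFrame_none (D : AffineConnection n M) (x y : M) :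
    split D y (cotractorFrame D x none y) = (0, coordDensity x y) :=
  (split D y).apply_symm_apply _

lemma split_cotractorFrame_some (D : AffineConnection n M) (x y : M) (i : Fin n) :
    split D y (cotractorFrame D x (some i) y)
      = ((coordForm x i y).smulRight (coordDensity x y), 0) :=
  (split D y).apply_symm_apply _

lemma frameCoord_cotractorFrame (D : AffineConnection n M) {x y : M} (hy : y ∈ frameDomain n x)
    (a b : Option (Fin n)) :
    frameCoord D x a y (cotractorFrame D x b y) = (1 : Matrix _ _ ℝ) a b := by
  rcases a with _ | i <;> rcases b with _ | j
  · rw [frameCoord_none, split_cotractorFrame_none, densityCoord_coordDensity hy]; simp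
  · rw [frameCoord_none, split_cotractorFrame_some, map_zero]; simp
  · rw [frameCoord_some, split_cotractorFrame_none, LinearMap.zero_apply, map_zero]; simp
  · rw [frameCoord_some, split_cotractorFrame_some, LinearMap.smulRight_apply, map_smul,
      densityCoord_coordDensity hy, coordForm_coordField hy]
    simp [Matrix.one_apply, eq_comm]

lemma cotractor_ext (D : AffineConnection n M) {x y : M} (hy : y ∈ frameDomain n x)
    {u w : Cotractor n y} (h : ∀ a, frameCoord D x a y u = frameCoord D x a y w) : u = w := by
  apply (split D y).injective
  refine Prod.ext ?_ (density_ext hy (h none))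
  refine (frameBasis hy).ext fun i => density_ext hy ?_
  rw [frameBasis_apply]
  exact h (some i)

lemma sum_frameCoord_smul (D : AffineConnection n M) {x y : M} (hy : y ∈ frameDomain n x)
    (u : Cotractor n y) : ∑ a, frameCoord D x a y u • cotractorFrame D x a y = u := by
  refine cotractor_ext D hy fun b => ?_
  rw [map_sum]
  simp only [map_smul, frameCoord_cotractorFrame D hy, smul_eq_mul]
  simp [Matrix.one_apply]

/-- The basis of `𝒯*` formed by the cotractor frame. -/
def cotractorBasis (D : AffineConnection n M) {x y : M} (hy : y ∈ frameDomain n x) :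
    Module.Basis (Option (Fin n)) ℝ (Cotractor n y) :=
  Module.Basis.mk (v := fun a => cotractorFrame D x a y)
    (by
      rw [Fintype.linearIndependent_iff]
      intro c hc a
      have := congrArg (frameCoord D x a y) hc
      rw [map_sum, map_zero] at this
      simpa [frameCoord_cotractorFrame D hy, Matrix.one_apply] using this)
    (by
      intro u _
      rw [← sum_frameCoord_smul D hy u]
      exact Submodule.sum_mem _ fun a _ =>
        Submodule.smul_mem _ _ (Submodule.subset_span ⟨a, rfl⟩))

lemma cotractorBasis_apply (D : AffineConnection n M) {x y : M} (hy : y ∈ frameDomain n x)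
    (a : Option (Fin n)) : cotractorBasis D hy a = cotractorFrame D x a y := by
  simp [cotractorBasis]

lemma finite_cotractor (D : AffineConnection n M) (x : M) : Module.Finite ℝ (Cotractor n x) :=
  Module.Finite.of_basis (cotractorBasis D (mem_frameDomain x))

lemma tractor_eq_sum (D : AffineConnection n M) {x y : M} (hy : y ∈ frameDomain n x)
    (φ : Tractor n y) : φ = ∑ a, φ (cotractorFrame D x a y) • frameCoord D x a y := by
  refine (cotractorBasis D hy).ext fun b => ?_
  rw [cotractorBasis_apply]
  simp only [LinearMap.sum_apply, LinearMap.smul_apply, frameCoord_cotractorFrame D hy,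
    Matrix.one_apply, smul_eq_mul, mul_ite, mul_one, mul_zero, Finset.sum_ite_eq',
    Finset.mem_univ, if_true]

lemma cotractorSmoothNear_iff (D : AffineConnection n M) (U : Π y : M, Cotractor n y) (x : M) :
    CotractorSmoothNear D U x ↔ ∀ a, ∀ᶠ y in 𝓝 x,
      ContMDiffAt (𝓡 n) 𝓘(ℝ, ℝ) ∞ (fun z => frameCoord D x a z (U z)) y := by
  constructor
  · rintro ⟨h1, h2⟩ (_ | i)
    exacts [h1, h2 i]
  · intro h
    exact ⟨h none, fun i => h (some i)⟩

lemma CotractorSmoothNear.frameCoord {D : AffineConnection n M} {U : Π y : M, Cotractor n y}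
    {x : M} (h : CotractorSmoothNear D U x) (a : Option (Fin n)) :
    ContMDiffAt (𝓡 n) 𝓘(ℝ, ℝ) ∞ (fun z => ProjTractor.frameCoord D x a z (U z)) x :=
  ((cotractorSmoothNear_iff D U x).mp h a).self_of_nhds

lemma cotractorFrame_smoothNear (D : AffineConnection n M) (x : M) (a : Option (Fin n)) :
    CotractorSmoothNear D (cotractorFrame D x a) x := by
  rw [cotractorSmoothNear_iff]
  intro b
  filter_upwards [frameDomain_mem_nhds (mem_frameDomain (n := n) x)] with y hy
  refine (contMDiffAt_const (c := (1 : Matrix _ _ ℝ) b a)).congr_of_eventuallyEq ?_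
  filter_upwards [frameDomain_mem_nhds hy] with z hz using frameCoord_cotractorFrame D hz b a

/-- The connection form of the cotractor connection in the cotractor frame at `x`. -/
def tractorConnForm (D : AffineConnection n M) (x : M) (v : TangentSpace (𝓡 n) x) :
    Matrix (Option (Fin n)) (Option (Fin n)) ℝ :=
  Matrix.of fun
    | none, none => ((n : ℝ) + 1)⁻¹ * connTrace D x v
    | none, some i => -coordForm x i x v
    | some j, none => schouten D x v (coordField x j x)
    | some j, some k => (((n : ℝ) + 1)⁻¹ * connTrace D x v) * (1 : Matrix _ _ ℝ) j k
        - connForm D x v k j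

lemma densityCoord_covDensity (D : AffineConnection n M) (σ : Π y : M, Density n y) (x : M)
    (v : TangentSpace (𝓡 n) x) :
    densityCoord x x (covDensity D σ x v) = mvfderiv (𝓡 n) (fun y => densityCoord x y (σ y)) x v
      + ((n : ℝ) + 1)⁻¹ * connTrace D x v * densityCoord x x (σ x) := by
  rw [covDensity, LinearMap.smulRight_apply, map_smul,
    densityCoord_coordDensity (mem_frameDomain x), smul_eq_mul, mul_one]
  simp only [LinearMap.add_apply, LinearMap.smul_apply, smul_eq_mul]
  have h1 : coeff x σ = fun y => densityCoord x y (σ y) := rfl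
  rw [h1]
  change mvfderiv (𝓡 n) (fun y => densityCoord x y (σ y)) x v + _ = _
  ring

/-- The connection becomes d + Γ on component vectors, with Γ = `tractorConnForm`: the form -μ(v)
expands in the entries -dxⁱ(v), the term Pσ sits in the column `none`, and the remaining entries are
the induced connections on ℰ(1) and ℰₐ(1). From here on, parallelism is a statement about matrices.
-/
lemma frameCoord_cotractorDeriv (D : AffineConnection n M) (U : Π y : M, Cotractor n y) (x : M)
    (v : TangentSpace (𝓡 n) x) (b : Option (Fin n)) :
    frameCoord D x b x (cotractorDeriv D U x v)
      = mvfderiv (𝓡 n) (fun y => frameCoord D x b y (U y)) x v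
        + ∑ a, tractorConnForm D x v b a * frameCoord D x a x (U x) := by
  rw [Fintype.sum_option]
  rcases b with _ | j
  · rw [frameCoord_none, cotractorDeriv, LinearEquiv.apply_symm_apply, map_sub,
      densityCoord_covDensity]
    rw [linearMap_eq_sum (mem_frameDomain x) (formPart D U x) v, map_sum]
    simp only [map_smul, smul_eq_mul, tractorConnForm, Matrix.of_apply, neg_mul,
      Finset.sum_neg_distrib]
    simp only [frameCoord_none, frameCoord_some, densityPart, formPart]
    ring
  · rw [frameCoord_some, cotractorDeriv, LinearEquiv.apply_symm_apply, LinearMap.add_apply,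
      map_add, covWeightedForm, ← coordBasis_apply, Module.Basis.constr_basis, map_sub,
      densityCoord_covDensity, LinearMap.smulRight_apply, map_smul, smul_eq_mul,
      coordBasis_apply,
      linearMap_eq_sum (mem_frameDomain x) (formPart D U x) (D (coordField x j) x v), map_sum]
    simp only [map_smul, smul_eq_mul, tractorConnForm, Matrix.of_apply, sub_mul,
      Finset.sum_sub_distrib, mul_assoc, ← Finset.mul_sum]
    simp only [frameCoord_none, frameCoord_some, densityPart, formPart, connForm,
      Matrix.of_apply, Matrix.one_apply, ite_mul, one_mul, zero_mul, Finset.sum_ite_eq,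
      Finset.mem_univ, if_true]
    ring

end CotractorCoordinates

/-! ## Bilinear forms in a frame -/

section BilinearCalculus

open Matrix

variable {n : ℕ} {M : Type*} [TopologicalSpace M] [ChartedSpace (EuclideanSpace ℝ (Fin n)) M]
variable {ι : Type*} [Fintype ι]

lemma dotProduct_mulVec_eq_sum (u w : ι → ℝ) (A : Matrix ι ι ℝ) :
    u ⬝ᵥ A *ᵥ w = ∑ a, ∑ b, u a * (A a b * w b) := by
  simp [dotProduct, mulVec, Finset.mul_sum]

lemma contMDiffAt_bilin {A : M → Matrix ι ι ℝ} {u w : ι → M → ℝ} {x : M}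
    (hA : MatSmoothAt n A x) (hu : ∀ a, ContMDiffAt (𝓡 n) 𝓘(ℝ, ℝ) ∞ (u a) x)
    (hw : ∀ a, ContMDiffAt (𝓡 n) 𝓘(ℝ, ℝ) ∞ (w a) x) :
    ContMDiffAt (𝓡 n) 𝓘(ℝ, ℝ) ∞ (fun y => (fun a => u a y) ⬝ᵥ A y *ᵥ fun a => w a y) x := by
  simp only [dotProduct_mulVec_eq_sum]
  exact contMDiffAt_finsetSum fun a _ => contMDiffAt_finsetSum fun b _ =>
    (hu a).mul ((hA a b).mul (hw b))

lemma mvfderiv_bilin {A : M → Matrix ι ι ℝ} {u w : ι → M → ℝ} {x : M}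
    (hA : MatDiffAt n A x) (hu : ∀ a, MDifferentiableAt (𝓡 n) 𝓘(ℝ, ℝ) (u a) x)
    (hw : ∀ a, MDifferentiableAt (𝓡 n) 𝓘(ℝ, ℝ) (w a) x) (v : TangentSpace (𝓡 n) x) :
    mvfderiv (𝓡 n) (fun y => (fun a => u a y) ⬝ᵥ A y *ᵥ fun a => w a y) x v
      = (fun a => mvfderiv (𝓡 n) (u a) x v) ⬝ᵥ A x *ᵥ (fun a => w a x)
        + (fun a => u a x) ⬝ᵥ A x *ᵥ (fun a => mvfderiv (𝓡 n) (w a) x v)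
        + (fun a => u a x) ⬝ᵥ matDeriv A x v *ᵥ fun a => w a x := by
  simp only [dotProduct_mulVec_eq_sum]
  rw [mvfderiv_sum_apply (f := fun a y => ∑ b, u a y * (A y a b * w b y)) fun a _ =>
    mdifferentiableAt_sum fun b _ =>
      mdifferentiableAt_fun_mul (hu a) (mdifferentiableAt_fun_mul (hA a b) (hw b)),
    ← Finset.sum_add_distrib, ← Finset.sum_add_distrib]
  refine Finset.sum_congr rfl fun a _ => ?_
  rw [mvfderiv_sum_apply (f := fun b y => u a y * (A y a b * w b y)) fun b _ =>
      mdifferentiableAt_fun_mul (hu a) (mdifferentiableAt_fun_mul (hA a b) (hw b)),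
    ← Finset.sum_add_distrib, ← Finset.sum_add_distrib]
  refine Finset.sum_congr rfl fun b _ => ?_
  rw [mvfderiv_mul_apply (f := u a) (g := fun y => A y a b * w b y) (hu a)
    (mdifferentiableAt_fun_mul (hA a b) (hw b)),
    mvfderiv_mul_apply (f := fun y => A y a b) (g := w b) (hA a b) (hw b)]
  simp only [matDeriv, Matrix.of_apply]
  ring

/-- The Leibniz rule for a matrix that is parallel with respect to the connection matrix `Γ`. -/
lemma mvfderiv_bilin_of_parallel {A : M → Matrix ι ι ℝ} {u w : ι → M → ℝ} {x : M}
    (hA : MatDiffAt n A x) (hu : ∀ a, MDifferentiableAt (𝓡 n) 𝓘(ℝ, ℝ) (u a) x)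
    (hw : ∀ a, MDifferentiableAt (𝓡 n) 𝓘(ℝ, ℝ) (w a) x) (v : TangentSpace (𝓡 n) x)
    {Γ : Matrix ι ι ℝ} (hΓ : matDeriv A x v = Γᵀ * A x + A x * Γ) :
    mvfderiv (𝓡 n) (fun y => (fun a => u a y) ⬝ᵥ A y *ᵥ fun a => w a y) x v
      = (fun a => mvfderiv (𝓡 n) (u a) x v + (Γ *ᵥ fun a => u a x) a) ⬝ᵥ A x *ᵥ (fun a => w a x)
        + (fun a => u a x) ⬝ᵥ A x *ᵥ
          (fun a => mvfderiv (𝓡 n) (w a) x v + (Γ *ᵥ fun a => w a x) a) := by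
  rw [mvfderiv_bilin hA hu hw, hΓ]
  have h1 : ∀ (p : ι → ℝ) (q : ι → ℝ), (fun a => p a + q a) = p + q := fun _ _ => rfl
  rw [h1, h1, add_dotProduct, mulVec_add, dotProduct_add, add_mulVec, dotProduct_add,
    ← mulVec_mulVec, ← mulVec_mulVec, dotProduct_mulVec _ Γᵀ, vecMul_transpose]
  ring

end BilinearCalculus

/-! ## Cotractor and tractor forms in the cotractor frame -/

section FormMatrices

open Matrix

variable {n : ℕ} {M : Type*} [TopologicalSpace M] [ChartedSpace (EuclideanSpace ℝ (Fin n)) M]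
  [IsManifold (𝓡 n) ∞ M]

/-- The matrix of a form on the cotractor bundle in the cotractor frame at `x`. -/
def formMatrix (D : AffineConnection n M) (x : M) (h : CotractorForm n M) (y : M) :
    Matrix (Option (Fin n)) (Option (Fin n)) ℝ :=
  Matrix.of fun a b => h y (cotractorFrame D x a y) (cotractorFrame D x b y)

lemma cotractorForm_eq (D : AffineConnection n M) (h : CotractorForm n M) {x y : M}
    (hy : y ∈ frameDomain n x) (u w : Cotractor n y) :
    h y u w = (fun a => frameCoord D x a y u) ⬝ᵥ formMatrix D x h y *ᵥ
      fun a => frameCoord D x a y w := by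
  conv_lhs => rw [← sum_frameCoord_smul D hy u, ← sum_frameCoord_smul D hy w]
  simp only [dotProduct_mulVec_eq_sum, map_sum, LinearMap.sum_apply, map_smul,
    LinearMap.smul_apply, smul_eq_mul, formMatrix, Matrix.of_apply]
  simp only [Finset.mul_sum]
  rw [Finset.sum_comm]
  refine Finset.sum_congr rfl fun a _ => ?_
  exact Finset.sum_congr rfl fun b _ => by ring

/-- The frame members are smooth fields and can be tested directly; conversely the value on any two
smooth fields is, near x, a polynomial in their components and the matrix entries. -/
lemma cotractorFormSmooth_iff (D : AffineConnection n M) (h : CotractorForm n M) :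
    CotractorFormSmooth D h ↔ ∀ x, MatSmoothAt n (formMatrix D x h) x := by
  constructor
  · intro hh x a b
    exact hh x _ _ (cotractorFrame_smoothNear D x a) (cotractorFrame_smoothNear D x b)
  · intro hh x U V hU hV
    refine (contMDiffAt_bilin (hh x) (fun a => hU.frameCoord a)
      (fun a => hV.frameCoord a)).congr_of_eventuallyEq ?_
    filter_upwards [frameDomain_mem_nhds (mem_frameDomain (n := n) x)] with y hy
      using cotractorForm_eq D h hy _ _

/-- The frame has constant components, so only Γ contributes. -/
lemma cotractorDeriv_cotractorFrame (D : AffineConnection n M) (x : M)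
    (v : TangentSpace (𝓡 n) x) (c : Option (Fin n)) :
    cotractorDeriv D (cotractorFrame D x c) x v
      = ∑ d, tractorConnForm D x v d c • cotractorFrame D x d x := by
  rw [← sum_frameCoord_smul D (mem_frameDomain x) (cotractorDeriv D _ x v)]
  refine Finset.sum_congr rfl fun d _ => ?_
  rw [frameCoord_cotractorDeriv]
  have h3 : (fun y => frameCoord D x d y (cotractorFrame D x c y)) =ᶠ[𝓝 x]
      fun _ => (1 : Matrix _ _ ℝ) d c := by
    filter_upwards [frameDomain_mem_nhds (mem_frameDomain (n := n) x)] with y hy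
      using frameCoord_cotractorFrame D hy d c
  rw [mvfderiv_congr_nhds h3, mvfderiv_const_apply, zero_add]
  simp only [frameCoord_cotractorFrame D (mem_frameDomain x), Matrix.one_apply, mul_ite,
    mul_one, mul_zero, Finset.sum_ite_eq', Finset.mem_univ, if_true]

/-- Testing on the frame yields the equation m' = Γᵀm + mΓ for the matrix m at the centre of each
chart, and the Leibniz rule recovers the identity for arbitrary smooth fields from it. -/
lemma cotractorFormParallel_iff (D : AffineConnection n M) {h : CotractorForm n M}
    (hh : CotractorFormSmooth D h) :
    CotractorFormParallel D h ↔ ∀ (x : M) (v : TangentSpace (𝓡 n) x),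
      matDeriv (formMatrix D x h) x v = (tractorConnForm D x v)ᵀ * formMatrix D x h x
        + formMatrix D x h x * tractorConnForm D x v := by
  have hd : ∀ (x : M) (v : TangentSpace (𝓡 n) x) (U : Π y : M, Cotractor n y),
      (fun a => frameCoord D x a x (cotractorDeriv D U x v)) = fun a =>
        mvfderiv (𝓡 n) (fun y => frameCoord D x a y (U y)) x v
          + (tractorConnForm D x v *ᵥ fun a => frameCoord D x a x (U x)) a := by
    intro x v U
    funext a
    rw [frameCoord_cotractorDeriv]
    rfl
  constructor
  · intro hp x v
    ext a b
    have h1 := hp x _ _ (cotractorFrame_smoothNear D x a) (cotractorFrame_smoothNear D x b) v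
    rw [cotractorDeriv_cotractorFrame, cotractorDeriv_cotractorFrame] at h1
    simp only [map_sum, LinearMap.sum_apply, map_smul, LinearMap.smul_apply, smul_eq_mul] at h1
    simp only [Matrix.add_apply, Matrix.mul_apply, Matrix.transpose_apply, formMatrix,
      Matrix.of_apply]
    refine Eq.trans h1 ?_
    congr 1
    exact Finset.sum_congr rfl fun c _ => mul_comm _ _
  · intro hp x U V hU hV v
    have h1 : (fun y => h y (U y) (V y)) =ᶠ[𝓝 x] fun y =>
        (fun a => frameCoord D x a y (U y)) ⬝ᵥ formMatrix D x h y *ᵥ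
          fun a => frameCoord D x a y (V y) := by
      filter_upwards [frameDomain_mem_nhds (mem_frameDomain (n := n) x)] with y hy
        using cotractorForm_eq D h hy _ _
    rw [mvfderiv_congr_nhds h1, mvfderiv_bilin_of_parallel
      ((cotractorFormSmooth_iff D h).mp hh x).matDiffAt
      (u := fun a y => frameCoord D x a y (U y)) (w := fun a y => frameCoord D x a y (V y))
      (fun a => (hU.frameCoord a).mdifferentiableAt (by simp))
      (fun a => (hV.frameCoord a).mdifferentiableAt (by simp)) v (hp x v),
      cotractorForm_eq D h (mem_frameDomain x), cotractorForm_eq D h (mem_frameDomain x), hd, hd]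

/-- The matrix of a form on the tractor bundle in the frame dual to the cotractor frame at `x`. -/
def tractorFormMatrix (D : AffineConnection n M) (x : M) (H : TractorForm n M) (y : M) :
    Matrix (Option (Fin n)) (Option (Fin n)) ℝ :=
  Matrix.of fun a b => H y (frameCoord D x a y) (frameCoord D x b y)

lemma tractorForm_eq (D : AffineConnection n M) (H : TractorForm n M) {x y : M}
    (hy : y ∈ frameDomain n x) (φ ψ : Tractor n y) :
    H y φ ψ = (fun a => φ (cotractorFrame D x a y)) ⬝ᵥ tractorFormMatrix D x H y *ᵥ
      fun a => ψ (cotractorFrame D x a y) := by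
  conv_lhs => rw [tractor_eq_sum D hy φ, tractor_eq_sum D hy ψ]
  simp only [dotProduct_mulVec_eq_sum, map_sum, LinearMap.sum_apply, map_smul,
    LinearMap.smul_apply, smul_eq_mul, tractorFormMatrix, Matrix.of_apply]
  simp only [Finset.mul_sum]
  rw [Finset.sum_comm]
  refine Finset.sum_congr rfl fun a _ => ?_
  exact Finset.sum_congr rfl fun b _ => by ring

lemma frameCoord_tractorSmoothNear (D : AffineConnection n M) (x : M) (a : Option (Fin n)) :
    TractorSmoothNear D (frameCoord D x a) x := fun U hU =>
  (cotractorSmoothNear_iff D U x).mp hU a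

lemma TractorSmoothNear.apply_frame {D : AffineConnection n M} {Φ : Π y : M, Tractor n y} {x : M}
    (h : TractorSmoothNear D Φ x) (a : Option (Fin n)) :
    ContMDiffAt (𝓡 n) 𝓘(ℝ, ℝ) ∞ (fun y => Φ y (cotractorFrame D x a y)) x :=
  (h _ (cotractorFrame_smoothNear D x a)).self_of_nhds

lemma tractorFormSmooth_iff (D : AffineConnection n M) (H : TractorForm n M) :
    TractorFormSmooth D H ↔ ∀ x, MatSmoothAt n (tractorFormMatrix D x H) x := by
  constructor
  · intro hh x a b
    exact hh x _ _ (frameCoord_tractorSmoothNear D x a) (frameCoord_tractorSmoothNear D x b)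
  · intro hh x Φ Ψ hΦ hΨ
    refine (contMDiffAt_bilin (hh x) (fun a => hΦ.apply_frame a)
      (fun a => hΨ.apply_frame a)).congr_of_eventuallyEq ?_
    filter_upwards [frameDomain_mem_nhds (mem_frameDomain (n := n) x)] with y hy
      using tractorForm_eq D H hy _ _

/-- The dual of d + Γ is d - Γᵀ, so the matrix calculus of cotractor forms applies to tractor forms
with Γ replaced by -Γᵀ. -/
lemma tractorDeriv_apply_frame (D : AffineConnection n M) (Φ : Π y : M, Tractor n y) (x : M)
    (v : TangentSpace (𝓡 n) x) (b : Option (Fin n)) :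
    tractorDeriv D Φ x v (cotractorFrame D x b x)
      = mvfderiv (𝓡 n) (fun y => Φ y (cotractorFrame D x b y)) x v
        + ((-(tractorConnForm D x v)ᵀ) *ᵥ fun a => Φ x (cotractorFrame D x a x)) b := by
  rw [tractorDeriv, LinearMap.sum_apply]
  simp only [LinearMap.smul_apply, cotractorCoord_eq, smul_eq_mul,
    frameCoord_cotractorFrame D (mem_frameDomain x), Matrix.one_apply, mul_ite, mul_one, mul_zero,
    Finset.sum_ite_eq', Finset.mem_univ, if_true]
  rw [sub_eq_add_neg]
  congr 1
  rw [cotractorDeriv_cotractorFrame, map_sum, neg_mulVec, Pi.neg_apply]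
  simp [mulVec, dotProduct]

lemma tractorFormParallel_iff (D : AffineConnection n M) {H : TractorForm n M}
    (hH : TractorFormSmooth D H) :
    TractorFormParallel D H ↔ ∀ (x : M) (v : TangentSpace (𝓡 n) x),
      matDeriv (tractorFormMatrix D x H) x v
        = (-(tractorConnForm D x v)ᵀ)ᵀ * tractorFormMatrix D x H x
          + tractorFormMatrix D x H x * (-(tractorConnForm D x v)ᵀ) := by
  have hd : ∀ (x : M) (v : TangentSpace (𝓡 n) x) (Φ : Π y : M, Tractor n y),
      (fun a => tractorDeriv D Φ x v (cotractorFrame D x a x)) = fun a =>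
        mvfderiv (𝓡 n) (fun y => Φ y (cotractorFrame D x a y)) x v
          + ((-(tractorConnForm D x v)ᵀ) *ᵥ fun a => Φ x (cotractorFrame D x a x)) a := by
    intro x v Φ
    funext a
    exact tractorDeriv_apply_frame D Φ x v a
  constructor
  · intro hp x v
    ext a b
    have h1 := hp x _ _ (frameCoord_tractorSmoothNear D x a)
      (frameCoord_tractorSmoothNear D x b) v
    have h2 : ∀ c, tractorDeriv D (frameCoord D x c) x v
        = ∑ d, (-(tractorConnForm D x v)ᵀ) d c • frameCoord D x d x := by
      intro c
      rw [tractor_eq_sum D (mem_frameDomain x) (tractorDeriv D _ x v)]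
      refine Finset.sum_congr rfl fun d _ => ?_
      rw [tractorDeriv_apply_frame]
      have h3 : (fun y => frameCoord D x c y (cotractorFrame D x d y)) =ᶠ[𝓝 x]
          fun _ => (1 : Matrix _ _ ℝ) c d := by
        filter_upwards [frameDomain_mem_nhds (mem_frameDomain (n := n) x)] with y hy
          using frameCoord_cotractorFrame D hy c d
      rw [mvfderiv_congr_nhds h3, mvfderiv_const_apply, zero_add]
      congr 1
      simp only [mulVec, dotProduct, frameCoord_cotractorFrame D (mem_frameDomain x),
        Matrix.one_apply, mul_ite, mul_one, mul_zero, Finset.sum_ite_eq, Finset.mem_univ, if_true]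
    rw [h2, h2] at h1
    simp only [map_sum, LinearMap.sum_apply, map_smul, LinearMap.smul_apply, smul_eq_mul] at h1
    simp only [Matrix.add_apply, Matrix.mul_apply, Matrix.transpose_apply _ a, tractorFormMatrix,
      Matrix.of_apply]
    refine Eq.trans h1 ?_
    congr 1
    exact Finset.sum_congr rfl fun c _ => mul_comm _ _
  · intro hp x Φ Ψ hΦ hΨ v
    have h1 : (fun y => H y (Φ y) (Ψ y)) =ᶠ[𝓝 x] fun y =>
        (fun a => Φ y (cotractorFrame D x a y)) ⬝ᵥ tractorFormMatrix D x H y *ᵥ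
          fun a => Ψ y (cotractorFrame D x a y) := by
      filter_upwards [frameDomain_mem_nhds (mem_frameDomain (n := n) x)] with y hy
        using tractorForm_eq D H hy _ _
    rw [mvfderiv_congr_nhds h1, mvfderiv_bilin_of_parallel
      ((tractorFormSmooth_iff D H).mp hH x).matDiffAt
      (u := fun a y => Φ y (cotractorFrame D x a y)) (w := fun a y => Ψ y (cotractorFrame D x a y))
      (fun a => (hΦ.apply_frame a).mdifferentiableAt (by simp))
      (fun a => (hΨ.apply_frame a).mdifferentiableAt (by simp)) v (hp x v),
      tractorForm_eq D H (mem_frameDomain x), tractorForm_eq D H (mem_frameDomain x), hd, hd]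

end FormMatrices

/-! ## Projective changes of connection -/

section ProjectiveChange

variable {n : ℕ} {M : Type*} [TopologicalSpace M] [ChartedSpace (EuclideanSpace ℝ (Fin n)) M]
  [IsManifold (𝓡 n) ∞ M]

/-- `D'` is obtained from `D` by the projective change given by the smooth one-form `Υ`. -/
structure IsProjectiveChange (D D' : AffineConnection n M)
    (Υ : Π x : M, TangentSpace (𝓡 n) x →L[ℝ] ℝ) : Prop where
  smooth : ∀ x, OneFormSmoothAt Υ x
  eq : ∀ (Y : Π x : M, TangentSpace (𝓡 n) x) (x : M), FieldDiffAt Y x →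
      ∀ v : TangentSpace (𝓡 n) x, D' Y x v = D Y x v + Υ x v • Y x + Υ x (Y x) • v

lemma projectivelyEquivalent_iff {D D' : AffineConnection n M} :
    ProjectivelyEquivalent D D' ↔ ∃ Υ, IsProjectiveChange D D' Υ :=
  ⟨fun ⟨Υ, h1, h2⟩ => ⟨Υ, ⟨h1, h2⟩⟩, fun ⟨Υ, h⟩ => ⟨Υ, h.1, h.2⟩⟩

variable {D D' : AffineConnection n M} {Υ : Π x : M, TangentSpace (𝓡 n) x →L[ℝ] ℝ}

namespace IsProjectiveChange

lemma coordField (h : IsProjectiveChange D D' Υ) {x y : M} (hy : y ∈ frameDomain n x)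
    (j : Fin n) (v : TangentSpace (𝓡 n) y) :
    D' (ProjTractor.coordField x j) y v = D (ProjTractor.coordField x j) y v
      + Υ y v • ProjTractor.coordField x j y + Υ y (ProjTractor.coordField x j y) • v :=
  h.eq _ y (coordField_diffAt hy j) v

lemma contMDiffAt_coord (h : IsProjectiveChange D D' Υ) {x y : M} (hy : y ∈ frameDomain n x)
    (j : Fin n) :
    ContMDiffAt (𝓡 n) 𝓘(ℝ, ℝ) ∞ (fun z => Υ z (ProjTractor.coordField x j z)) y :=
  (h.smooth y).apply (coordField_smoothAt hy j)

lemma mdifferentiableAt_coord (h : IsProjectiveChange D D' Υ) {x y : M}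
    (hy : y ∈ frameDomain n x) (j : Fin n) :
    MDifferentiableAt (𝓡 n) 𝓘(ℝ, ℝ) (fun z => Υ z (ProjTractor.coordField x j z)) y :=
  (h.contMDiffAt_coord hy j).mdifferentiableAt (by simp)

lemma connForm (h : IsProjectiveChange D D' Υ) (x : M) (v : TangentSpace (𝓡 n) x)
    (k j : Fin n) :
    ProjTractor.connForm D' x v k j = ProjTractor.connForm D x v k j
      + Υ x v * (1 : Matrix _ _ ℝ) k j
      + Υ x (ProjTractor.coordField x j x) * coordForm x k x v := by
  simp only [ProjTractor.connForm, Matrix.of_apply]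
  rw [h.coordField (mem_frameDomain x)]
  simp only [map_add, map_smul, smul_eq_mul, coordForm_coordField (mem_frameDomain x),
    Matrix.one_apply]

end IsProjectiveChange

lemma oneForm_eq_sum {x y : M} (hy : y ∈ frameDomain n x) (θ : TangentSpace (𝓡 n) y →L[ℝ] ℝ)
    (v : TangentSpace (𝓡 n) y) :
    θ v = ∑ i, coordForm x i y v * θ (coordField x i y) :=
  linearMap_eq_sum hy θ.toLinearMap v

namespace IsProjectiveChange

/-- The term Υ(v)Y has trace nΥ(v) and the term Υ(Y)v has trace Υ(v). The resulting factor n + 1 is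
the one that the weight of ℰ(1) divides out. -/
lemma connTrace (h : IsProjectiveChange D D' Υ) (x : M) (v : TangentSpace (𝓡 n) x) :
    ProjTractor.connTrace D' x v = ProjTractor.connTrace D x v + ((n : ℝ) + 1) * Υ x v := by
  rw [connTrace_eq_trace, connTrace_eq_trace]
  simp only [Matrix.trace, Matrix.diag_apply, h.connForm, Finset.sum_add_distrib,
    Matrix.one_apply_eq]
  have h1 := oneForm_eq_sum (mem_frameDomain x) (Υ x) v
  simp only [mul_comm (coordForm x _ x v)] at h1
  rw [← h1]
  simp only [mul_one, Finset.sum_const, Finset.card_univ, Fintype.card_fin, nsmul_eq_mul]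
  ring

/-- On ℰ(1) the induced derivative changes by exactly Υσ, since the weight (n+1)⁻¹ cancels the
factor in `IsProjectiveChange.connTrace`. This shear is what later moves the orthogonal complement
of ℰₐ(1) into the ℰ(1) summand. -/
lemma split (h : IsProjectiveChange D D' Υ) (x : M) (u : Cotractor n x) :
    ProjTractor.split D' x u = ((ProjTractor.split D x u).1
      + (Υ x).toLinearMap.smulRight (ProjTractor.split D x u).2, (ProjTractor.split D x u).2) := by
  have hn : ((n : ℝ) + 1) ≠ 0 := by positivity
  refine Prod.ext (LinearMap.ext fun v => ?_) rfl
  simp only [ProjTractor.split, LinearEquiv.trans_apply, shear, LinearEquiv.coe_mk,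
    LinearMap.coe_mk, AddHom.coe_mk, LinearMap.add_apply, LinearMap.smulRight_apply,
    LinearMap.smul_apply, smul_eq_mul, h.connTrace, add_assoc]
  congr 1
  rw [← add_smul]
  congr 1
  rw [mul_add, inv_mul_cancel_left₀ hn]
  rfl

lemma frameCoord_none (h : IsProjectiveChange D D' Υ) (x y : M) (u : Cotractor n y) :
    frameCoord D' x none y u = frameCoord D x none y u := by
  rw [ProjTractor.frameCoord_none, ProjTractor.frameCoord_none, h.split]

lemma frameCoord_some (h : IsProjectiveChange D D' Υ) (x y : M) (j : Fin n)
    (u : Cotractor n y) :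
    frameCoord D' x (some j) y u = frameCoord D x (some j) y u
      + Υ y (ProjTractor.coordField x j y) * frameCoord D x none y u := by
  rw [ProjTractor.frameCoord_none, ProjTractor.frameCoord_some, ProjTractor.frameCoord_some,
    h.split, LinearMap.add_apply, map_add, LinearMap.smulRight_apply, map_smul]
  rfl

lemma cotractorSmoothNear (h : IsProjectiveChange D D' Υ) {U : Π y : M, Cotractor n y} {x : M}
    (hU : CotractorSmoothNear D U x) : CotractorSmoothNear D' U x := by
  rw [cotractorSmoothNear_iff] at hU ⊢
  rintro (_ | j)
  · simpa only [h.frameCoord_none] using hU none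
  · filter_upwards [hU none, hU (some j), frameDomain_mem_nhds (mem_frameDomain (n := n) x)]
      with y h0 hj hy
    simp only [h.frameCoord_some]
    exact hj.add ((h.contMDiffAt_coord hy j).mul h0)

/-- The change of the curvature on coordinate fields. -/
lemma curvature [T2Space M] (h : IsProjectiveChange D D' Υ) (hD : IsSmoothTorsionFree D) (x : M)
    (i j k : Fin n) :
    ProjTractor.curvature D' (ProjTractor.coordField x i) (ProjTractor.coordField x j)
        (ProjTractor.coordField x k) x
      = ProjTractor.curvature D (ProjTractor.coordField x i) (ProjTractor.coordField x j)
        (ProjTractor.coordField x k) x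
      + (mvfderiv (𝓡 n) (fun y => Υ y (ProjTractor.coordField x j y)) x
          (ProjTractor.coordField x i x)
        - mvfderiv (𝓡 n) (fun y => Υ y (ProjTractor.coordField x i y)) x
          (ProjTractor.coordField x j x)) • ProjTractor.coordField x k x
      + (mvfderiv (𝓡 n) (fun y => Υ y (ProjTractor.coordField x k y)) x
          (ProjTractor.coordField x i x)
          - Υ x (D (ProjTractor.coordField x k) x (ProjTractor.coordField x i x))
          - Υ x (ProjTractor.coordField x i x) * Υ x (ProjTractor.coordField x k x))
          • ProjTractor.coordField x j x
      - (mvfderiv (𝓡 n) (fun y => Υ y (ProjTractor.coordField x k y)) x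
          (ProjTractor.coordField x j x)
          - Υ x (D (ProjTractor.coordField x k) x (ProjTractor.coordField x j x))
          - Υ x (ProjTractor.coordField x j x) * Υ x (ProjTractor.coordField x k x))
          • ProjTractor.coordField x i x := by
  have hx := mem_frameDomain (n := n) x
  have key : ∀ a b : Fin n, D' (fun y => D' (ProjTractor.coordField x k) y
        (ProjTractor.coordField x b y)) x (ProjTractor.coordField x a x)
      = D (fun y => D (ProjTractor.coordField x k) y (ProjTractor.coordField x b y)) x
          (ProjTractor.coordField x a x)
        + (Υ x (ProjTractor.coordField x b x)
            • D (ProjTractor.coordField x k) x (ProjTractor.coordField x a x)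
          + mvfderiv (𝓡 n) (fun y => Υ y (ProjTractor.coordField x b y)) x
            (ProjTractor.coordField x a x) • ProjTractor.coordField x k x)
        + (Υ x (ProjTractor.coordField x k x)
            • D (ProjTractor.coordField x b) x (ProjTractor.coordField x a x)
          + mvfderiv (𝓡 n) (fun y => Υ y (ProjTractor.coordField x k y)) x
            (ProjTractor.coordField x a x) • ProjTractor.coordField x b x)
        + Υ x (ProjTractor.coordField x a x)
          • (D (ProjTractor.coordField x k) x (ProjTractor.coordField x b x)
            + Υ x (ProjTractor.coordField x b x) • ProjTractor.coordField x k x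
            + Υ x (ProjTractor.coordField x k x) • ProjTractor.coordField x b x)
        + (Υ x (D (ProjTractor.coordField x k) x (ProjTractor.coordField x b x))
            + Υ x (ProjTractor.coordField x b x) * Υ x (ProjTractor.coordField x k x)
            + Υ x (ProjTractor.coordField x k x) * Υ x (ProjTractor.coordField x b x))
          • ProjTractor.coordField x a x := by
    intro a b
    have e1 : FieldDiffAt (fun y => D (ProjTractor.coordField x k) y
        (ProjTractor.coordField x b y)) x :=
      (connection_coordField_smoothAt hD x k b).fieldDiffAt
    have e2 : FieldDiffAt (fun y => Υ y (ProjTractor.coordField x b y)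
        • ProjTractor.coordField x k y) x :=
      FieldDiffAt.smul (h.mdifferentiableAt_coord hx b) (coordField_diffAt hx k)
    have e3 : FieldDiffAt (fun y => Υ y (ProjTractor.coordField x k y)
        • ProjTractor.coordField x b y) x :=
      FieldDiffAt.smul (h.mdifferentiableAt_coord hx k) (coordField_diffAt hx b)
    have e4 := FieldDiffAt.add e1 e2
    have e5 := FieldDiffAt.add e4 e3
    -- The inner derivative is differentiated once more, so its expansion is needed on a
    -- neighbourhood and not only at x.
    have e6 : ∀ᶠ y in 𝓝 x, D' (ProjTractor.coordField x k) y (ProjTractor.coordField x b y)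
        = D (ProjTractor.coordField x k) y (ProjTractor.coordField x b y)
          + Υ y (ProjTractor.coordField x b y) • ProjTractor.coordField x k y
          + Υ y (ProjTractor.coordField x k y) • ProjTractor.coordField x b y := by
      filter_upwards [frameDomain_mem_nhds hx] with y hy using h.coordField hy k _
    rw [connection_congr D' e5 e6, h.eq _ x e5, connection_add D e4 e3, connection_add D e1 e2,
      connection_smul D (h.mdifferentiableAt_coord hx b) (coordField_diffAt hx k),
      connection_smul D (h.mdifferentiableAt_coord hx k) (coordField_diffAt hx b)]
    simp only [map_add, map_smul, smul_eq_mul]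
  simp only [ProjTractor.curvature, mlieBracket_coordField, map_zero, sub_zero]
  -- Antisymmetrising in i and j removes the symmetric terms: the products Υᵢ∇ⱼ∂ₖ + Υⱼ∇ᵢ∂ₖ, the term
  -- ΥᵢΥⱼ∂ₖ and, by symmetry of the Christoffel symbols, Υₖ∇ᵢ∂ⱼ.
  rw [key i j, key j i, connection_coordField_symm hD x i j]
  module

end IsProjectiveChange

lemma schouten_coordField (D : AffineConnection n M) (x : M) (j k : Fin n) :
    schouten D x (coordField x j x) (coordField x k x)
      = ((n : ℝ) ^ 2 - 1)⁻¹ * (n * ricci D x (coordField x j x) (coordField x k x)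
        + ricci D x (coordField x k x) (coordField x j x)) := by
  simp only [schouten, LinearMap.smul_apply, LinearMap.add_apply, LinearMap.flip_apply,
    smul_eq_mul]

namespace IsProjectiveChange

/-- With Λⱼₖ = ∇ⱼΥₖ - ΥⱼΥₖ, tracing the change of curvature over i turns the last two terms into Λⱼₖ
- nΛⱼₖ and the first into the exterior derivative of Υ; the total is Λₖⱼ - nΛⱼₖ. -/
lemma ricci [T2Space M] (h : IsProjectiveChange D D' Υ) (hD : IsSmoothTorsionFree D) (x : M)
    (j k : Fin n) :
    ProjTractor.ricci D' x (ProjTractor.coordField x j x) (ProjTractor.coordField x k x)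
      = ProjTractor.ricci D x (ProjTractor.coordField x j x) (ProjTractor.coordField x k x)
      + (mvfderiv (𝓡 n) (fun y => Υ y (ProjTractor.coordField x j y)) x
          (ProjTractor.coordField x k x)
        - Υ x (D (ProjTractor.coordField x j) x (ProjTractor.coordField x k x)))
      - n * (mvfderiv (𝓡 n) (fun y => Υ y (ProjTractor.coordField x k y)) x
          (ProjTractor.coordField x j x)
        - Υ x (D (ProjTractor.coordField x k) x (ProjTractor.coordField x j x)))
      + (n - 1) * (Υ x (ProjTractor.coordField x j x) * Υ x (ProjTractor.coordField x k x)) := by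
  have hx := mem_frameDomain (n := n) x
  rw [ricci_coordField, ricci_coordField]
  simp only [h.curvature hD, map_add, map_sub, map_smul, smul_eq_mul,
    coordForm_coordField hx, mul_ite, mul_one, mul_zero, Finset.sum_add_distrib,
    Finset.sum_sub_distrib, Finset.sum_ite_eq', Finset.mem_univ, if_true,
    Finset.sum_const, Finset.card_univ, Fintype.card_fin, nsmul_eq_mul]
  rw [connection_coordField_symm hD x j k]
  ring

/-- In the combination n Ricⱼₖ + Ricₖⱼ the transposed terms Λₖⱼ cancel and -(n² - 1)Λⱼₖ remains. The
normalisation of P thus makes it change by exactly -Λⱼₖ. -/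
lemma schouten_coordField [T2Space M] (hn : 2 ≤ n) (h : IsProjectiveChange D D' Υ)
    (hD : IsSmoothTorsionFree D) (x : M) (j k : Fin n) :
    schouten D' x (ProjTractor.coordField x j x) (ProjTractor.coordField x k x)
      = schouten D x (ProjTractor.coordField x j x) (ProjTractor.coordField x k x)
      - (mvfderiv (𝓡 n) (fun y => Υ y (ProjTractor.coordField x k y)) x
          (ProjTractor.coordField x j x)
        - Υ x (D (ProjTractor.coordField x k) x (ProjTractor.coordField x j x)))
      + Υ x (ProjTractor.coordField x j x) * Υ x (ProjTractor.coordField x k x) := by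
  have hn' : (2 : ℝ) ≤ n := by exact_mod_cast hn
  have h0 : ((n : ℝ) ^ 2 - 1) ≠ 0 := by nlinarith
  rw [ProjTractor.schouten_coordField, ProjTractor.schouten_coordField, h.ricci hD, h.ricci hD]
  field_simp
  ring

/-- Both sides are linear in the first slot, so the coordinate fields there may be replaced by any
vector; the second slot keeps ∂ₖ, which is differentiated. -/
lemma schouten_apply [T2Space M] (hn : 2 ≤ n) (h : IsProjectiveChange D D' Υ)
    (hD : IsSmoothTorsionFree D) (x : M) (v : TangentSpace (𝓡 n) x) (k : Fin n) :
    schouten D' x v (ProjTractor.coordField x k x)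
      = schouten D x v (ProjTractor.coordField x k x)
      - (mvfderiv (𝓡 n) (fun y => Υ y (ProjTractor.coordField x k y)) x v
        - Υ x (D (ProjTractor.coordField x k) x v))
      + Υ x v * Υ x (ProjTractor.coordField x k x) := by
  let f : TangentSpace (𝓡 n) x →ₗ[ℝ] ℝ :=
    LinearMap.flip (schouten D' x) (ProjTractor.coordField x k x)
  let g : TangentSpace (𝓡 n) x →ₗ[ℝ] ℝ :=
    LinearMap.flip (schouten D x) (ProjTractor.coordField x k x)
      - ((mvfderiv (𝓡 n) (fun y => Υ y (ProjTractor.coordField x k y)) x).toLinearMap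
        - (Υ x).toLinearMap ∘ₗ (D (ProjTractor.coordField x k) x).toLinearMap)
      + (Υ x (ProjTractor.coordField x k x)) • (Υ x).toLinearMap
  have hfg : f = g := by
    refine (coordBasis x).ext fun j => ?_
    rw [coordBasis_apply]
    refine (h.schouten_coordField hn hD x j k).trans ?_
    rw [mul_comm]
    rfl
  refine (congrArg (fun L => L v) hfg).trans ?_
  rw [mul_comm]
  rfl

/-- In the new splitting μ becomes μ + Υσ. Differentiating the extra term produces (∇Υ)σ, which the
change of P absorbs, and the quadratic terms in Υ cancel as well. Parallelism may hence be checked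
for whichever connection of the class is convenient. -/
lemma cotractorDeriv [T2Space M] (hn : 2 ≤ n) (h : IsProjectiveChange D D' Υ)
    (hD : IsSmoothTorsionFree D) {U : Π y : M, Cotractor n y} {x : M}
    (hU : CotractorSmoothNear D U x) (v : TangentSpace (𝓡 n) x) :
    ProjTractor.cotractorDeriv D' U x v = ProjTractor.cotractorDeriv D U x v := by
  have hx := mem_frameDomain (n := n) x
  have hn1 : ((n : ℝ) + 1) ≠ 0 := by positivity
  have hU0 : MDifferentiableAt (𝓡 n) 𝓘(ℝ, ℝ) (fun y => frameCoord D x none y (U y)) x :=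
    (hU.frameCoord none).mdifferentiableAt (by simp)
  have hv : ∑ k, coordForm x k x v * Υ x (ProjTractor.coordField x k x) = Υ x v :=
    (oneForm_eq_sum hx (Υ x) v).symm
  refine cotractor_ext D' hx ?_
  rintro (_ | j)
  -- In the ℰ(1) component the added Υ(v)σ from the density derivative cancels the one in -μ(v).
  · rw [h.frameCoord_none _ _ (ProjTractor.cotractorDeriv D U x v), frameCoord_cotractorDeriv,
      frameCoord_cotractorDeriv, Fintype.sum_option, Fintype.sum_option]
    simp only [tractorConnForm, Matrix.of_apply, h.frameCoord_none, h.frameCoord_some,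
      h.connTrace, mul_add, neg_mul, Finset.sum_add_distrib, Finset.sum_neg_distrib,
      ← mul_assoc, ← Finset.sum_mul, hv]
    field_simp
    ring
  · have hUj : MDifferentiableAt (𝓡 n) 𝓘(ℝ, ℝ) (fun y => frameCoord D x (some j) y (U y)) x :=
      (hU.frameCoord (some j)).mdifferentiableAt (by simp)
    have hDj : ∑ k, ProjTractor.connForm D x v k j * Υ x (ProjTractor.coordField x k x)
        = Υ x (D (ProjTractor.coordField x j) x v) :=
      (oneForm_eq_sum hx (Υ x) _).symm
    rw [h.frameCoord_some _ _ _ (ProjTractor.cotractorDeriv D U x v), frameCoord_cotractorDeriv,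
      frameCoord_cotractorDeriv, frameCoord_cotractorDeriv, Fintype.sum_option,
      Fintype.sum_option, Fintype.sum_option]
    simp only [h.frameCoord_none, h.frameCoord_some]
    rw [mvfderiv_add_apply hUj (mdifferentiableAt_fun_mul (h.mdifferentiableAt_coord hx j) hU0),
      mvfderiv_mul_apply (h.mdifferentiableAt_coord hx j) hU0]
    simp only [tractorConnForm, Matrix.of_apply, h.connTrace, h.connForm, h.schouten_apply hn hD,
      sub_mul, add_mul, mul_add, neg_mul, Finset.sum_add_distrib, Finset.sum_sub_distrib,
      Finset.sum_neg_distrib, mul_assoc, ← Finset.mul_sum, Matrix.one_apply, ite_mul, one_mul,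
      zero_mul, Finset.sum_ite_eq, Finset.sum_ite_eq', Finset.mem_univ, if_true]
    simp only [← mul_assoc, ← Finset.sum_mul, hv, hDj]
    field_simp
    ring

lemma cotractorFormSmooth (h : IsProjectiveChange D' D Υ) {k : CotractorForm n M}
    (hk : CotractorFormSmooth D k) : CotractorFormSmooth D' k := fun x U V hU hV =>
  hk x U V (h.cotractorSmoothNear hU) (h.cotractorSmoothNear hV)

lemma cotractorFormParallel [T2Space M] (hn : 2 ≤ n) (h : IsProjectiveChange D' D Υ)
    (hD : IsSmoothTorsionFree D') {k : CotractorForm n M}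
    (hk : CotractorFormParallel D k) : CotractorFormParallel D' k := fun x U V hU hV v => by
  rw [hk x U V (h.cotractorSmoothNear hU) (h.cotractorSmoothNear hV) v,
    h.cotractorDeriv hn hD hU, h.cotractorDeriv hn hD hV]

end IsProjectiveChange

/-- For a parallel smooth form on the cotractor bundle it is enough to consider one connection of
the projective class. -/
lemma cotractorForm_parallel_of_mem [T2Space M] (hn : 2 ≤ n) (p : ProjectiveStructure n M)
    (hD : D ∈ p) {k : CotractorForm n M} (hk : CotractorFormSmooth D k)
    (hk' : CotractorFormParallel D k) :
    ∀ D' ∈ p, CotractorFormSmooth D' k ∧ CotractorFormParallel D' k := by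
  intro D' hD'
  obtain ⟨Υ, h⟩ := projectivelyEquivalent_iff.mp
    ((p.mem_iff D' hD' D (p.smooth D hD)).mp hD)
  exact ⟨h.cotractorFormSmooth hk, h.cotractorFormParallel hn (p.smooth D' hD') hk'⟩

end ProjectiveChange

/-! ## Normalised inverse matrices -/

section NormalisedInverse

variable {n : ℕ}

lemma rpow_inv_pow_succ {t : ℝ} (ht : 0 < t) : (t ^ (1 / ((n : ℝ) + 1))) ^ (n + 1) = t := by
  rw [← Real.rpow_natCast, ← Real.rpow_mul ht.le]
  have : (n : ℝ) + 1 ≠ 0 := by positivity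
  push_cast
  rw [one_div, inv_mul_cancel₀ this, Real.rpow_one]

/-- The exponents add up to zero: the unit density carries -1/(2n+2) and enters bilinear forms
twice, which the weight 1/(n+1) compensates. -/
lemma unit_rpow_mul {t : ℝ} (ht : 0 < t) :
    t ^ (-(1 / (2 * (n : ℝ) + 2))) * t ^ (-(1 / (2 * (n : ℝ) + 2))) * t ^ (1 / ((n : ℝ) + 1))
      = 1 := by
  rw [← Real.rpow_add ht, ← Real.rpow_add ht]
  have h6 : (n : ℝ) + 1 ≠ 0 := by positivity
  have : -(1 / (2 * (n : ℝ) + 2)) + -(1 / (2 * (n : ℝ) + 2)) + 1 / ((n : ℝ) + 1) = 0 := by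
    rw [show 2 * (n : ℝ) + 2 = 2 * ((n : ℝ) + 1) by ring]
    field_simp
    ring
  rw [this, Real.rpow_zero]

lemma abs_det_smul_inv {G : Matrix (Fin n) (Fin n) ℝ} {c : ℝ} (hc : 0 < c) :
    |(c • G⁻¹).det| = c ^ n * |G.det|⁻¹ := by
  rw [Matrix.det_smul, Matrix.det_nonsing_inv, Ring.inverse_eq_inv', abs_mul, abs_pow,
    abs_of_pos hc, abs_inv, Fintype.card_fin]

/-- Put c = |det G|^(1/(n+1)), so cⁿ⁺¹ = |det G|. Then |det Z| = cⁿ / |det G| = c⁻¹, and multiplying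
Z by |det Z| strips off the weight. -/
lemma eq_inv_of_eq_smul_inv {G Z : Matrix (Fin n) (Fin n) ℝ} (hG : G.det ≠ 0)
    (h : Z = |G.det| ^ (1 / ((n : ℝ) + 1)) • G⁻¹) : G = (|Z.det| • Z)⁻¹ := by
  have h0 : 0 < |G.det| := abs_pos.mpr hG
  have hc : 0 < |G.det| ^ (1 / ((n : ℝ) + 1)) := Real.rpow_pos_of_pos h0 _
  have hp := rpow_inv_pow_succ (n := n) h0
  have h1 : |Z.det| • Z = G⁻¹ := by
    rw [h, abs_det_smul_inv hc, smul_smul]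
    have : (|G.det| ^ (1 / ((n : ℝ) + 1))) ^ n * |G.det|⁻¹ * |G.det| ^ (1 / ((n : ℝ) + 1)) = 1 := by
      calc _ = (|G.det| ^ (1 / ((n : ℝ) + 1))) ^ (n + 1) * |G.det|⁻¹ := by ring
        _ = 1 := by rw [hp, mul_inv_cancel₀ h0.ne']
    rw [this, one_smul]
  rw [h1, Matrix.nonsing_inv_nonsing_inv _ (isUnit_iff_ne_zero.mpr hG)]

lemma det_smul_abs_ne_zero {Z : Matrix (Fin n) (Fin n) ℝ} (hZ : Z.det ≠ 0) :
    (|Z.det| • Z).det ≠ 0 := by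
  rw [Matrix.det_smul]
  exact mul_ne_zero (pow_ne_zero _ (abs_ne_zero.mpr hZ)) hZ

lemma det_inv_smul_abs_ne_zero {Z : Matrix (Fin n) (Fin n) ℝ} (hZ : Z.det ≠ 0) :
    ((|Z.det| • Z)⁻¹).det ≠ 0 := by
  rw [Matrix.det_nonsing_inv, Ring.inverse_eq_inv']
  exact inv_ne_zero (det_smul_abs_ne_zero hZ)

/-- Here |det G| = |det Z|⁻⁽ⁿ⁺¹⁾, so its (n+1)-th root is |det Z|⁻¹. Together with
`eq_inv_of_eq_smul_inv` this makes G and Z determine each other. -/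
lemma eq_smul_inv_of_eq_inv {G Z : Matrix (Fin n) (Fin n) ℝ} (hZ : Z.det ≠ 0)
    (h : G = (|Z.det| • Z)⁻¹) : Z = |G.det| ^ (1 / ((n : ℝ) + 1)) • G⁻¹ := by
  have h0 : 0 < |Z.det| := abs_pos.mpr hZ
  have h1 : |G.det| = (|Z.det|⁻¹) ^ (n + 1) := by
    rw [h, Matrix.det_nonsing_inv, Ring.inverse_eq_inv', Matrix.det_smul, abs_inv, abs_mul,
      abs_pow, abs_abs, Fintype.card_fin, inv_pow, pow_succ]
  have h2 : |G.det| ^ (1 / ((n : ℝ) + 1)) = |Z.det|⁻¹ := by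
    rw [h1, ← Real.rpow_natCast, ← Real.rpow_mul (inv_pos.mpr h0).le]
    have : (n : ℝ) + 1 ≠ 0 := by positivity
    push_cast
    rw [mul_one_div_cancel this, Real.rpow_one]
  rw [h2, h, Matrix.nonsing_inv_nonsing_inv _ (isUnit_iff_ne_zero.mpr (det_smul_abs_ne_zero hZ)),
    smul_smul, inv_mul_cancel₀ h0.ne', one_smul]

end NormalisedInverse

/-! ## Bilinear forms on the tangent space and restrictions of cotractor forms -/

section Restriction

open Matrix

variable {n : ℕ} {M : Type*} [TopologicalSpace M] [ChartedSpace (EuclideanSpace ℝ (Fin n)) M]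
  [IsManifold (𝓡 n) ∞ M]

/-- The Gram matrix of `B` in the coordinate frame of the preferred chart at `x`. -/
def gram (x : M) {y : M} (B : LinearMap.BilinForm ℝ (TangentSpace (𝓡 n) y)) :
    Matrix (Fin n) (Fin n) ℝ :=
  Matrix.of fun i j => B (coordField x i y) (coordField x j y)

/-- The positive density of unit length for `B`. -/
def unitDensity {y : M} (B : LinearMap.BilinForm ℝ (TangentSpace (𝓡 n) y)) : Density n y :=
  |(gram y B).det| ^ (-(1 / (2 * (n : ℝ) + 2))) • coordDensity y y

lemma gram_eq_toMatrix {x y : M} (hy : y ∈ frameDomain n x)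
    (B : LinearMap.BilinForm ℝ (TangentSpace (𝓡 n) y)) :
    gram x B = LinearMap.BilinForm.toMatrix (frameBasis hy) B := by
  ext i j
  simp [gram, LinearMap.BilinForm.toMatrix_apply, frameBasis_apply]

lemma bilin_ext_gram {x y : M} (hy : y ∈ frameDomain n x)
    {B C : LinearMap.BilinForm ℝ (TangentSpace (𝓡 n) y)} (h : gram x B = gram x C) : B = C := by
  rw [gram_eq_toMatrix hy, gram_eq_toMatrix hy] at h
  exact (LinearMap.BilinForm.toMatrix (frameBasis hy)).injective h

lemma gram_det_ne_zero_iff {x y : M} (hy : y ∈ frameDomain n x)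
    (B : LinearMap.BilinForm ℝ (TangentSpace (𝓡 n) y)) :
    (gram x B).det ≠ 0 ↔ B.Nondegenerate := by
  rw [gram_eq_toMatrix hy, LinearMap.BilinForm.nondegenerate_iff_det_ne_zero (frameBasis hy)]

lemma gram_transpose {x y : M} {B : LinearMap.BilinForm ℝ (TangentSpace (𝓡 n) y)}
    (hB : B.IsSymm) : (gram x B)ᵀ = gram x B := by
  ext i j
  exact hB.eq _ _

/-- A change of frame by P multiplies the Gram determinant by (det P)² and the coordinate density by
|det P|^(1/(n+1)), and the powers cancel. The unit density, defined in the chart at its own point,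
can so be followed in one fixed chart. -/
lemma unitDensity_eq {x y : M} (hy : y ∈ frameDomain n x)
    {B : LinearMap.BilinForm ℝ (TangentSpace (𝓡 n) y)} :
    unitDensity B = |(gram x B).det| ^ (-(1 / (2 * (n : ℝ) + 2))) • coordDensity x y := by
  set b := frameBasis hy
  set c := frameBasis (mem_frameDomain (n := n) y)
  set P := c.toMatrix b
  have hP : P.det ≠ 0 := by
    have := c.isUnit_det b
    rw [Module.Basis.det_apply] at this
    exact this.ne_zero
  have h1 : gram x B = Pᵀ * gram y B * P := by
    rw [gram_eq_toMatrix hy, gram_eq_toMatrix (mem_frameDomain y),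
      LinearMap.BilinForm.toMatrix_mul_basis_toMatrix]
  have h2 : coordDensity (n := n) x y = |P.det| ^ (1 / ((n : ℝ) + 1)) • coordDensity y y := by
    apply Subtype.ext
    funext η
    have h3 := AlternatingMap.eq_smul_basis_det c η
    have h4 : η b = η c * P.det := by
      conv_lhs => rw [h3]
      rw [AlternatingMap.smul_apply, Module.Basis.det_apply, smul_eq_mul]
    have hb : (b : Fin n → TangentSpace (𝓡 n) y) = fun i => coordField x i y :=
      funext (frameBasis_apply hy)
    have hc : (c : Fin n → TangentSpace (𝓡 n) y) = fun i => coordField y i y :=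
      funext (frameBasis_apply (mem_frameDomain y))
    rw [hb, hc] at h4
    change |η fun i => coordField x i y| ^ (1 / ((n : ℝ) + 1))
      = |P.det| ^ (1 / ((n : ℝ) + 1)) * |η fun i => coordField y i y| ^ (1 / ((n : ℝ) + 1))
    rw [h4, abs_mul, Real.mul_rpow (abs_nonneg _) (abs_nonneg _), mul_comm]
  have hp : 0 < |P.det| := abs_pos.mpr hP
  have h5 := unit_rpow_mul (n := n) hp
  rw [unitDensity, h1, h2, Matrix.det_mul, Matrix.det_mul, Matrix.det_transpose, smul_smul,
    abs_mul, abs_mul, Real.mul_rpow (by positivity) (abs_nonneg _),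
    Real.mul_rpow (abs_nonneg _) (abs_nonneg _)]
  congr 1
  linear_combination -|(gram y B).det| ^ (-(1 / (2 * (n : ℝ) + 2))) * h5

/-- The matrix of the restriction of `h` to `ℰₐ(1)` in the coordinate frame at `x`. -/
def restrictMatrix (x : M) (h : CotractorForm n M) (y : M) : Matrix (Fin n) (Fin n) ℝ :=
  Matrix.of fun i j => h y (jetIncl y ((coordForm x i y).smulRight (coordDensity x y)))
    (jetIncl y ((coordForm x j y).smulRight (coordDensity x y)))

lemma split_jetIncl (D : AffineConnection n M) (y : M)
    (μ : TangentSpace (𝓡 n) y →ₗ[ℝ] Density n y) : split D y (jetIncl y μ) = (μ, 0) := by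
  have h : chartSplit y (jetIncl y μ) = (μ, 0) := (chartSplit y).apply_symm_apply _
  have h1 : split D y (jetIncl y μ)
      = shear (((n : ℝ) + 1)⁻¹ • connTrace D y) (chartSplit y (jetIncl y μ)) := rfl
  rw [h1, h]
  refine Prod.ext (LinearMap.ext fun v => ?_) rfl
  simp [shear]

lemma cotractorFrame_some_eq (D : AffineConnection n M) (x y : M) (i : Fin n) :
    cotractorFrame D x (some i) y
      = jetIncl y ((coordForm x i y).smulRight (coordDensity x y)) := by
  apply (split D y).injective
  rw [split_jetIncl, split_cotractorFrame_some]

lemma restrictMatrix_apply (D : AffineConnection n M) (x : M) (h : CotractorForm n M) (y : M)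
    (i j : Fin n) : restrictMatrix x h y i j = formMatrix D x h y (some i) (some j) := by
  simp only [restrictMatrix, formMatrix, Matrix.of_apply, cotractorFrame_some_eq]

/-- The form `h` on `𝒯*ₓ` restricts to the inverse of `B`. -/
def RestrictsAt (h : CotractorForm n M) {y : M}
    (B : LinearMap.BilinForm ℝ (TangentSpace (𝓡 n) y)) : Prop :=
  ∀ v w, h y (jetIncl y ((B v).smulRight (unitDensity B)))
    (jetIncl y ((B w).smulRight (unitDensity B))) = B v w

/-- With f the coefficient of the unit density, the condition on the coordinate fields reads f² G Z
G = G. Solve for Z and use f⁻² = |det G|^(1/(n+1)). -/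
lemma restrictsAt_iff {x y : M} (hy : y ∈ frameDomain n x) (h : CotractorForm n M)
    {B : LinearMap.BilinForm ℝ (TangentSpace (𝓡 n) y)} (hB : B.IsSymm) (hB' : B.Nondegenerate) :
    RestrictsAt h B ↔
      restrictMatrix x h y = |(gram x B).det| ^ (1 / ((n : ℝ) + 1)) • (gram x B)⁻¹ := by
  set G := gram x B
  have hG : G.det ≠ 0 := (gram_det_ne_zero_iff hy B).mpr hB'
  have hG0 : 0 < |G.det| := abs_pos.mpr hG
  set f := |G.det| ^ (-(1 / (2 * (n : ℝ) + 2)))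
  have hff : f * f * |G.det| ^ (1 / ((n : ℝ) + 1)) = 1 := unit_rpow_mul hG0
  -- `J` is v ↦ B(v, ·) ⊗ s expanded in the frame. As a linear map it turns the condition into an
  -- equality between B and the pullback `C` of the form.
  let J : TangentSpace (𝓡 n) y →ₗ[ℝ] Cotractor n y :=
    ∑ i, f • (B.flip (coordField x i y)).smulRight
      (jetIncl y ((coordForm x i y).smulRight (coordDensity x y)))
  have hJ : ∀ v, jetIncl y ((B v).smulRight (unitDensity B)) = J v := by
    intro v
    have h1 : (B v).smulRight (unitDensity B)
        = ∑ i, (f * B v (coordField x i y)) • (coordForm x i y).smulRight (coordDensity x y) := by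
      refine LinearMap.ext fun w => ?_
      rw [LinearMap.smulRight_apply, linearMap_eq_sum hy (B v) w, unitDensity_eq hy,
        LinearMap.sum_apply, Finset.sum_smul]
      refine Finset.sum_congr rfl fun i _ => ?_
      rw [LinearMap.smul_apply, LinearMap.smulRight_apply, smul_smul, smul_smul, smul_eq_mul]
      congr 1
      ring
    rw [h1, map_sum, LinearMap.sum_apply]
    refine Finset.sum_congr rfl fun i _ => ?_
    rw [map_smul, LinearMap.smul_apply, LinearMap.smulRight_apply, smul_smul]
    rfl
  let C : LinearMap.BilinForm ℝ (TangentSpace (𝓡 n) y) := (h y).compl₁₂ J J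
  have hC : gram x C = (f * f) • (G * restrictMatrix x h y * G) := by
    ext a b
    have hGs : ∀ i j, G i j = G j i := fun i j => congrFun (congrFun (gram_transpose hB) j) i
    simp only [gram, C, Matrix.of_apply, LinearMap.compl₁₂_apply, J, LinearMap.sum_apply,
      LinearMap.smul_apply, LinearMap.smulRight_apply, map_sum, map_smul, smul_eq_mul,
      Matrix.smul_apply, Matrix.mul_apply, Finset.mul_sum, Finset.sum_mul]
    refine Finset.sum_congr rfl fun i _ => Finset.sum_congr rfl fun j _ => ?_
    have e1 : B.flip (coordField x i y) (coordField x b y) = G i b := (hGs b i)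
    have e2 : B.flip (coordField x j y) (coordField x a y) = G a j := rfl
    rw [e1, e2]
    simp only [restrictMatrix, Matrix.of_apply]
    ring
  have hiff : RestrictsAt h B ↔ gram x C = G := by
    constructor
    · intro hr
      have : C = B := LinearMap.ext fun v => LinearMap.ext fun w => by
        have := hr v w
        rw [hJ, hJ] at this
        exact this
      rw [this]
    · intro hr v w
      rw [hJ, hJ]
      exact congrArg (fun C : LinearMap.BilinForm ℝ (TangentSpace (𝓡 n) y) => C v w)
        (bilin_ext_gram hy hr)
  have hu : IsUnit G.det := isUnit_iff_ne_zero.mpr hG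
  rw [hiff, hC]
  constructor
  · intro h1
    have h2 : G⁻¹ * ((f * f) • (G * restrictMatrix x h y * G)) * G⁻¹ = G⁻¹ := by
      rw [h1, Matrix.nonsing_inv_mul _ hu, one_mul]
    rw [Matrix.mul_smul, Matrix.smul_mul, Matrix.mul_assoc, Matrix.mul_assoc, Matrix.mul_assoc,
      Matrix.mul_nonsing_inv _ hu, mul_one, ← Matrix.mul_assoc, Matrix.nonsing_inv_mul _ hu,
      one_mul] at h2
    rw [← h2, smul_smul, mul_comm, hff, one_smul]
  · intro h1
    rw [h1, Matrix.mul_smul, Matrix.mul_nonsing_inv _ hu, Matrix.smul_mul, one_mul, smul_smul,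
      hff, one_smul]

lemma restrictsAt_iff_gram {x y : M} (hy : y ∈ frameDomain n x) (h : CotractorForm n M)
    (hZ : (restrictMatrix x h y).det ≠ 0)
    {B : LinearMap.BilinForm ℝ (TangentSpace (𝓡 n) y)} (hB : B.IsSymm) (hB' : B.Nondegenerate) :
    RestrictsAt h B ↔ gram x B = (|(restrictMatrix x h y).det| • restrictMatrix x h y)⁻¹ := by
  rw [restrictsAt_iff hy h hB hB']
  exact ⟨eq_inv_of_eq_smul_inv ((gram_det_ne_zero_iff hy B).mpr hB'), eq_smul_inv_of_eq_inv hZ⟩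

lemma jetIncl_injective (y : M) : Function.Injective (jetIncl (n := n) y) := fun μ ν hμν => by
  have := congrArg (fun u => (chartSplit y u).1) hμν
  simpa [jetIncl] using this

lemma weightedForm_eq_sum {x y : M} (hy : y ∈ frameDomain n x)
    (μ : TangentSpace (𝓡 n) y →ₗ[ℝ] Density n y) :
    μ = ∑ i, densityCoord x y (μ (coordField x i y))
      • (coordForm x i y).smulRight (coordDensity x y) := by
  refine LinearMap.ext fun v => ?_
  rw [linearMap_eq_sum hy μ v, LinearMap.sum_apply]
  refine Finset.sum_congr rfl fun i _ => ?_
  conv_lhs => rw [density_eq_smul hy (μ (coordField x i y))]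
  rw [LinearMap.smul_apply, LinearMap.smulRight_apply, smul_comm]

/-- The forms dxⁱ ⊗ ε are a basis of ℰₐ(1), and the restriction has `restrictMatrix` as its Gram
matrix. Symmetry reduces left to right nondegeneracy. -/
lemma restrict_nondegenerate_iff {x y : M} (hy : y ∈ frameDomain n x) (h : CotractorForm n M)
    (hs : (h y).IsSymm) :
    ((h y).restrict (LinearMap.range (jetIncl (n := n) y))).Nondegenerate ↔
      (restrictMatrix x h y).det ≠ 0 := by
  have hZ : ∀ (c : Fin n → ℝ) (i : Fin n), (restrictMatrix x h y *ᵥ c) i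
      = h y (jetIncl y ((coordForm x i y).smulRight (coordDensity x y)))
        (jetIncl y (∑ j, c j • (coordForm x j y).smulRight (coordDensity x y))) := by
    intro c i
    simp only [map_sum, map_smul, smul_eq_mul, mulVec, dotProduct, restrictMatrix, Matrix.of_apply]
    exact Finset.sum_congr rfl fun j _ => mul_comm _ _
  have hr : ∀ (μ ν : TangentSpace (𝓡 n) y →ₗ[ℝ] Density n y), h y (jetIncl y μ) (jetIncl y ν)
      = ∑ i, densityCoord x y (μ (coordField x i y)) *
        h y (jetIncl y ((coordForm x i y).smulRight (coordDensity x y))) (jetIncl y ν) := by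
    intro μ ν
    conv_lhs => rw [weightedForm_eq_sum hy μ]
    simp only [map_sum, map_smul, LinearMap.sum_apply, LinearMap.smul_apply, smul_eq_mul]
  constructor
  · intro hn hdet
    obtain ⟨c, hc, hc0⟩ := Matrix.exists_mulVec_eq_zero_iff.mpr hdet
    apply hc
    set ν := ∑ j, c j • (coordForm x j y).smulRight (coordDensity (n := n) x y) with hν
    have h1 := hn.2 ⟨jetIncl y ν, ν, rfl⟩ (by
      rintro ⟨_, μ, rfl⟩
      refine (hr μ ν).trans (Finset.sum_eq_zero fun i _ => ?_)
      rw [← hZ c i, hc0]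
      simp)
    have h2 : ν = 0 := jetIncl_injective y (by simpa using congrArg Subtype.val h1)
    funext j
    have h3 := congrArg (fun μ => densityCoord x y (μ (coordField x j y))) h2
    simpa [hν, LinearMap.sum_apply, coordForm_coordField hy, densityCoord_coordDensity hy] using h3
  · intro hdet
    have hl : ∀ ν : TangentSpace (𝓡 n) y →ₗ[ℝ] Density n y,
        (∀ μ, h y (jetIncl y μ) (jetIncl y ν) = 0) → ν = 0 := by
      intro ν h0
      by_contra hne
      refine hdet (Matrix.exists_mulVec_eq_zero_iff.mp
        ⟨fun j => densityCoord x y (ν (coordField x j y)), fun hc => hne ?_, ?_⟩)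
      · rw [weightedForm_eq_sum hy ν]
        exact Finset.sum_eq_zero fun j _ => by rw [congrFun hc j]; simp
      · funext i
        rw [hZ, ← weightedForm_eq_sum hy ν]
        exact h0 _
    constructor
    · rintro ⟨_, μ, rfl⟩ h0
      refine Subtype.ext ?_
      rw [hl μ fun ν => by
        rw [← hs.eq]
        exact h0 ⟨jetIncl y ν, ν, rfl⟩]
      exact map_zero _
    · rintro ⟨_, μ, rfl⟩ h0
      refine Subtype.ext ?_
      rw [hl μ fun ν => h0 ⟨jetIncl y ν, ν, rfl⟩]
      exact map_zero _

end Restriction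

/-! ## Metrics and their Levi-Civita connections -/

section LeviCivita

open Matrix

variable {n : ℕ} {M : Type*} [TopologicalSpace M] [ChartedSpace (EuclideanSpace ℝ (Fin n)) M]
  [IsManifold (𝓡 n) ∞ M]

/-- Linear maps on the tangent space are continuous. -/
def tangentCLM {F : Type*} [AddCommGroup F] [Module ℝ F] [TopologicalSpace F]
    [IsTopologicalAddGroup F] [ContinuousSMul ℝ F] {y : M} (θ : TangentSpace (𝓡 n) y →ₗ[ℝ] F) :
    TangentSpace (𝓡 n) y →L[ℝ] F where
  toLinearMap := θ
  cont := by
    let θ' : EuclideanSpace ℝ (Fin n) →ₗ[ℝ] F := θ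
    exact θ'.continuous_of_finiteDimensional

/-- The bilinear form on the tangent space at `y` given by `g`. -/
def PseudoMetric.bilin (g : PseudoMetric n M) (y : M) :
    LinearMap.BilinForm ℝ (TangentSpace (𝓡 n) y) :=
  (ContinuousLinearMap.coeLM ℝ) ∘ₗ (g.inner y).toLinearMap

namespace PseudoMetric

lemma bilin_apply (g : PseudoMetric n M) (y : M) (v w : TangentSpace (𝓡 n) y) :
    g.bilin y v w = g.inner y v w := rfl

lemma bilin_isSymm (g : PseudoMetric n M) (y : M) : (g.bilin y).IsSymm :=
  ⟨fun v w => g.symm y v w⟩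

lemma bilin_nondegenerate (g : PseudoMetric n M) (y : M) : (g.bilin y).Nondegenerate :=
  ⟨fun v hv => g.nondegenerate y v hv, fun v hv => g.nondegenerate y v fun w => by
    rw [g.symm]; exact hv w⟩

lemma gram_det_ne_zero (g : PseudoMetric n M) {x y : M} (hy : y ∈ frameDomain n x) :
    (gram x (g.bilin y)).det ≠ 0 :=
  (gram_det_ne_zero_iff hy _).mpr (g.bilin_nondegenerate y)

lemma ext_bilin {g g' : PseudoMetric n M} (h : ∀ y, g.bilin y = g'.bilin y) : g = g' := by
  have h1 : g.inner = g'.inner := by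
    funext y
    ext v w
    exact congrArg (fun B : LinearMap.BilinForm ℝ (TangentSpace (𝓡 n) y) => B v w) (h y)
  cases g
  cases g'
  cases h1
  rfl

lemma bilinSmoothAt (g : PseudoMetric n M) (x : M) : BilinSmoothAt g.inner x := g.contMDiff x

lemma gram_smoothAt (g : PseudoMetric n M) (x : M) :
    MatSmoothAt n (fun y => gram x (g.bilin y)) x := fun i j =>
  (g.bilinSmoothAt x).apply (coordField_smoothAt (mem_frameDomain x) i)
    (coordField_smoothAt (mem_frameDomain x) j)

/-- The metric given by a smooth field of nondegenerate symmetric bilinear forms. -/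
def ofBilin (B : Π y : M, LinearMap.BilinForm ℝ (TangentSpace (𝓡 n) y))
    (hs : ∀ y, (B y).IsSymm) (hn : ∀ y, (B y).Nondegenerate)
    (hB : ∀ x, MatSmoothAt n (fun y => gram x (B y)) x) : PseudoMetric n M where
  inner y := tangentCLM
    { toFun := fun v => tangentCLM (B y v)
      map_add' := fun v w => by rw [map_add]; rfl
      map_smul' := fun r v => by rw [map_smul]; rfl }
  symm y v w := (hs y).eq v w
  nondegenerate y v hv := (hn y).1 v hv
  contMDiff x := bilinSmoothAt_of_coordField fun i j => hB x i j

end PseudoMetric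

lemma restrictsTo_iff (h : CotractorForm n M) (g : PseudoMetric n M) :
    RestrictsTo h g ↔ ∀ y, RestrictsAt h (g.bilin y) := Iff.rfl

lemma connection_coordField_eq (D : AffineConnection n M) (x : M) (j : Fin n)
    (v : TangentSpace (𝓡 n) x) :
    D (coordField x j) x v = ∑ k, connForm D x v k j • coordField x k x :=
  (sum_coordForm_smul (mem_frameDomain x) _).symm

lemma coordForm_connection (D : AffineConnection n M) {Y : Π y : M, TangentSpace (𝓡 n) y} {x : M}
    (hY : FieldDiffAt Y x) (v : TangentSpace (𝓡 n) x) :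
    (fun k => coordForm x k x (D Y x v)) = fun k =>
      mvfderiv (𝓡 n) (fun y => coordForm x k y (Y y)) x v
        + (connForm D x v *ᵥ fun j => coordForm x j x (Y x)) k := by
  funext k
  rw [connection_eq_sum D (mem_frameDomain x) hY, map_sum]
  simp only [map_add, map_smul, smul_eq_mul, coordForm_coordField (mem_frameDomain x),
    Finset.sum_add_distrib, mul_ite, mul_one, mul_zero, Finset.sum_ite_eq, Finset.mem_univ, if_true]
  rw [add_comm]
  congr 1
  exact Finset.sum_congr rfl fun j _ => mul_comm _ _

lemma bilin_eq_gram {x y : M} (hy : y ∈ frameDomain n x)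
    (B : LinearMap.BilinForm ℝ (TangentSpace (𝓡 n) y)) (v w : TangentSpace (𝓡 n) y) :
    B v w = (fun i => coordForm x i y v) ⬝ᵥ gram x B *ᵥ fun i => coordForm x i y w := by
  conv_lhs => rw [← sum_coordForm_smul hy v, ← sum_coordForm_smul hy w]
  simp only [dotProduct_mulVec_eq_sum, map_sum, LinearMap.sum_apply, map_smul,
    LinearMap.smul_apply, smul_eq_mul, gram, Matrix.of_apply]
  simp only [Finset.mul_sum]
  rw [Finset.sum_comm]
  refine Finset.sum_congr rfl fun a _ => ?_
  exact Finset.sum_congr rfl fun b _ => by ring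

/-- Metric compatibility is parallelism of the Gram matrix for d + A, with A the connection form of
the coordinate frame; the translation is the one already used for cotractor forms. -/
lemma isLeviCivita_iff (g : PseudoMetric n M) {D : AffineConnection n M}
    (hD : IsSmoothTorsionFree D) :
    IsLeviCivita g D ↔ ∀ (x : M) (v : TangentSpace (𝓡 n) x),
      matDeriv (fun y => gram x (g.bilin y)) x v
        = (connForm D x v)ᵀ * gram x (g.bilin x) + gram x (g.bilin x) * connForm D x v := by
  constructor
  · intro h x v
    ext i j
    have h1 := h.2 _ _ x (coordField_diffAt (mem_frameDomain (n := n) x) i)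
      (coordField_diffAt (mem_frameDomain x) j) v
    simp only [← PseudoMetric.bilin_apply] at h1
    rw [connection_coordField_eq, connection_coordField_eq] at h1
    simp only [map_sum, LinearMap.sum_apply, map_smul, LinearMap.smul_apply, smul_eq_mul] at h1
    refine Eq.trans h1 ?_
    simp only [Matrix.add_apply, Matrix.mul_apply, Matrix.transpose_apply, gram, Matrix.of_apply]
    congr 1
    exact Finset.sum_congr rfl fun c _ => mul_comm _ _
  · intro h
    refine ⟨hD, fun Y Z x hY hZ v => ?_⟩
    have h1 : (fun y => g.inner y (Y y) (Z y)) =ᶠ[𝓝 x] fun y =>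
        (fun a => coordForm x a y (Y y)) ⬝ᵥ gram x (g.bilin y) *ᵥ
          fun a => coordForm x a y (Z y) := by
      filter_upwards [frameDomain_mem_nhds (mem_frameDomain (n := n) x)] with y hy
        using bilin_eq_gram hy (g.bilin y) _ _
    rw [mvfderiv_congr_nhds h1, mvfderiv_bilin_of_parallel (g.gram_smoothAt x).matDiffAt
      (u := fun a y => coordForm x a y (Y y)) (w := fun a y => coordForm x a y (Z y))
      (fun a => hY.coordForm (mem_frameDomain x) a) (fun a => hZ.coordForm (mem_frameDomain x) a)
      v (h x v), ← PseudoMetric.bilin_apply, ← PseudoMetric.bilin_apply,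
      bilin_eq_gram (mem_frameDomain x), bilin_eq_gram (mem_frameDomain x),
      coordForm_connection D hY, coordForm_connection D hZ]

/-- The Levi-Civita connection is unique. -/
lemma IsLeviCivita.unique {g : PseudoMetric n M} {D D' : AffineConnection n M}
    (h : IsLeviCivita g D) (h' : IsLeviCivita g D') (Y : Π y : M, TangentSpace (𝓡 n) y) (y : M)
    (hY : FieldDiffAt Y y) : D' Y y = D Y y := by
  refine connection_eq_of_coordField (mem_frameDomain y) (fun j => ?_) hY
  -- The difference tensor with its index lowered: symmetric in i, j as both connections are
  -- torsion-free, skew in j, k as both preserve g. Alternating the two symmetries returns T with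
  -- the opposite sign.
  let T : Fin n → Fin n → Fin n → ℝ := fun i j k =>
    g.inner y (D' (coordField y j) y (coordField y i y) - D (coordField y j) y (coordField y i y))
      (coordField y k y)
  have hsymm : ∀ i j k, T i j k = T j i k := by
    intro i j k
    simp only [T, connection_coordField_symm h.1 y i j, connection_coordField_symm h'.1 y i j]
  have hanti : ∀ i j k, T i j k = -T i k j := by
    intro i j k
    have h1 := h.2 _ _ y (coordField_diffAt (mem_frameDomain (n := n) y) j)
      (coordField_diffAt (mem_frameDomain y) k) (coordField y i y)
    have h2 := h'.2 _ _ y (coordField_diffAt (mem_frameDomain (n := n) y) j)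
      (coordField_diffAt (mem_frameDomain y) k) (coordField y i y)
    simp only [T, map_sub, _root_.sub_apply]
    rw [g.symm y (coordField y j y)] at h1 h2
    linarith
  have hT : ∀ i j k, T i j k = 0 := by
    intro i j k
    have h1 := hanti i j k
    have h2 := hsymm i k j
    have h3 := hanti k i j
    have h4 := hsymm k j i
    have h5 := hanti j k i
    have h6 := hsymm j i k
    linarith
  ext1 v
  rw [← sum_coordForm_smul (mem_frameDomain y) v, map_sum, map_sum]
  refine Finset.sum_congr rfl fun i _ => ?_
  rw [map_smul, map_smul]
  congr 1
  refine sub_eq_zero.mp (g.nondegenerate y _ fun w => ?_)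
  rw [← sum_coordForm_smul (mem_frameDomain y) w, map_sum]
  refine Finset.sum_eq_zero fun k _ => ?_
  rw [map_smul]
  exact (congrArg _ (hT i j k)).trans (smul_zero _)

end LeviCivita

/-! ## Construction of projectively equivalent connections -/

section AddOneForm

variable {n : ℕ} {M : Type*} [TopologicalSpace M] [ChartedSpace (EuclideanSpace ℝ (Fin n)) M]
  [IsManifold (𝓡 n) ∞ M]

/-- The connection `∇_v Y + Υ(v) Y + Υ(Y) v`. -/
def projectiveChange (D : AffineConnection n M) (Υ : Π x : M, TangentSpace (𝓡 n) x →L[ℝ] ℝ) :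
    AffineConnection n M :=
  D.addOneForm fun x =>
    let θ : EuclideanSpace ℝ (Fin n) →L[ℝ] ℝ := Υ x
    (ContinuousLinearMap.smulRightL ℝ (EuclideanSpace ℝ (Fin n)) (EuclideanSpace ℝ (Fin n)) θ
      + θ.smulRight (ContinuousLinearMap.id ℝ (EuclideanSpace ℝ (Fin n))) :
      EuclideanSpace ℝ (Fin n) →L[ℝ] EuclideanSpace ℝ (Fin n) →L[ℝ] EuclideanSpace ℝ (Fin n))

lemma projectiveChange_apply (D : AffineConnection n M)
    (Υ : Π x : M, TangentSpace (𝓡 n) x →L[ℝ] ℝ) (Y : Π x : M, TangentSpace (𝓡 n) x) (x : M)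
    (v : TangentSpace (𝓡 n) x) :
    projectiveChange D Υ Y x v = D Y x v + Υ x v • Y x + Υ x (Y x) • v := by
  rw [add_assoc]
  rfl

lemma isProjectiveChange_projectiveChange (D : AffineConnection n M)
    {Υ : Π x : M, TangentSpace (𝓡 n) x →L[ℝ] ℝ} (hΥ : ∀ x, OneFormSmoothAt Υ x) :
    IsProjectiveChange D (projectiveChange D Υ) Υ :=
  ⟨hΥ, fun Y x _ v => projectiveChange_apply D Υ Y x v⟩

/-- The added tensor Υ(v)Y + Υ(Y)v is symmetric in v and Y, so the torsion is untouched, and it is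
smooth because Υ is. -/
lemma isSmoothTorsionFree_projectiveChange {D : AffineConnection n M}
    (hD : IsSmoothTorsionFree D) {Υ : Π x : M, TangentSpace (𝓡 n) x →L[ℝ] ℝ}
    (hΥ : ∀ x, OneFormSmoothAt Υ x) : IsSmoothTorsionFree (projectiveChange D Υ) := by
  constructor
  · refine ⟨⟨fun {σ} hσ x _ => ContMDiffAt.contMDiffWithinAt ?_⟩⟩
    have hσx : FieldSmoothAt σ x :=
      ((hσ x (Set.mem_univ x)).contMDiffAt univ_mem).of_le (by simp)
    have h1 : ContMDiffAt (𝓡 n)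
        ((𝓡 n).prod 𝓘(ℝ, EuclideanSpace ℝ (Fin n) →L[ℝ] EuclideanSpace ℝ (Fin n))) ∞
        (fun y => TotalSpace.mk' (EuclideanSpace ℝ (Fin n) →L[ℝ] EuclideanSpace ℝ (Fin n))
          (E := fun y : M => TangentSpace (𝓡 n) y →L[ℝ] TangentSpace (𝓡 n) y) y (D σ y)) x :=
      (hD.1.contMDiff.contMDiff hσ x (Set.mem_univ x)).contMDiffAt univ_mem
    refine contMDiffAt_hom_of_coordField (V := (TangentSpace (𝓡 n) : M → Type _)) _ fun i => ?_
    have hi := coordField_smoothAt (mem_frameDomain (n := n) x) i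
    have h2 : FieldSmoothAt (fun y => D σ y (coordField x i y)) x :=
      ContMDiffAt.clm_bundle_apply (F₁ := EuclideanSpace ℝ (Fin n))
        (F₂ := EuclideanSpace ℝ (Fin n))
        (E₁ := (TangentSpace (𝓡 n) : M → Type _)) (E₂ := (TangentSpace (𝓡 n) : M → Type _))
        (b := id) h1 hi
    exact ((h2.add (FieldSmoothAt.smul ((hΥ x).apply hi) hσx)).add
      (FieldSmoothAt.smul ((hΥ x).apply hσx) hi)).congr
        (Eventually.of_forall fun y => projectiveChange_apply D Υ σ y _)
  · rw [CovariantDerivative.torsion_eq_zero_iff]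
    intro X Y x hX hY
    have h := D.torsion_eq_zero_iff.mp hD.2 hX hY
    rw [projectiveChange_apply, projectiveChange_apply, ← h]
    abel

lemma projectiveChange_mem {p : ProjectiveStructure n M} {D : AffineConnection n M} (hD : D ∈ p)
    {Υ : Π x : M, TangentSpace (𝓡 n) x →L[ℝ] ℝ} (hΥ : ∀ x, OneFormSmoothAt Υ x) :
    projectiveChange D Υ ∈ p :=
  (p.mem_iff D hD _ (isSmoothTorsionFree_projectiveChange (p.smooth D hD) hΥ)).mpr
    (projectivelyEquivalent_iff.mpr ⟨Υ, isProjectiveChange_projectiveChange D hΥ⟩)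

end AddOneForm

/-! ## Cotractor forms that are block diagonal in a splitting -/

section DerivativeOfNormalisedInverse

open Matrix

variable {n : ℕ} {M : Type*} [TopologicalSpace M] [ChartedSpace (EuclideanSpace ℝ (Fin n)) M]

lemma trace_inv_mul_parallel {G A : Matrix (Fin n) (Fin n) ℝ} (hG : G.det ≠ 0) :
    (G⁻¹ * (Aᵀ * G + G * A)).trace = 2 * A.trace := by
  have hu : IsUnit G.det := isUnit_iff_ne_zero.mpr hG
  rw [mul_add, ← Matrix.mul_assoc, ← Matrix.mul_assoc, Matrix.nonsing_inv_mul _ hu, one_mul,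
    trace_add, Matrix.trace_mul_comm, ← Matrix.mul_assoc, Matrix.mul_nonsing_inv _ hu, one_mul,
    trace_transpose, two_mul]

/-- For a parallel G the logarithmic derivative of |det G| is 2 tr A, and the power divides it by n
+ 1. So |det G|^(1/(n+1)) obeys the equation of a parallel component of weight -2, the same as the
`none` entry of a parallel block diagonal form. -/
lemma mvfderiv_abs_det_rpow {G : M → Matrix (Fin n) (Fin n) ℝ} {x : M} (hG : MatDiffAt n G x)
    (h0 : (G x).det ≠ 0) {v : TangentSpace (𝓡 n) x} {A : Matrix (Fin n) (Fin n) ℝ}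
    (hA : matDeriv G x v = Aᵀ * G x + G x * A) :
    mvfderiv (𝓡 n) (fun y => |(G y).det| ^ (1 / ((n : ℝ) + 1))) x v
      = 2 * (((n : ℝ) + 1)⁻¹ * A.trace) * |(G x).det| ^ (1 / ((n : ℝ) + 1)) := by
  have hp : 0 < |(G x).det| := abs_pos.mpr h0
  have hd : MDifferentiableAt (𝓡 n) 𝓘(ℝ, ℝ) (fun y => |(G y).det|) x :=
    ((hasDerivAt_abs h0).differentiableAt.mdifferentiableAt).comp x hG.det
  rw [mvfderiv_comp_real (φ := fun t => t ^ (1 / ((n : ℝ) + 1))) (f := fun y => |(G y).det|) hd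
    (Real.hasDerivAt_rpow_const (Or.inl hp.ne')), mvfderiv_abs_det hG h0, hA,
    trace_inv_mul_parallel h0, Real.rpow_sub_one hp.ne']
  field_simp

/-- A matrix `G` is parallel if and only if the weighted matrix `|det G| ^ (1/(n+1)) G⁻¹` is. -/
lemma matDeriv_normalised_iff {G : M → Matrix (Fin n) (Fin n) ℝ} {x : M} (hG : MatSmoothAt n G x)
    (h0 : (G x).det ≠ 0) (v : TangentSpace (𝓡 n) x) (A : Matrix (Fin n) (Fin n) ℝ) :
    matDeriv G x v = Aᵀ * G x + G x * A ↔
      matDeriv (fun y => |(G y).det| ^ (1 / ((n : ℝ) + 1)) • (G y)⁻¹) x v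
        = (2 * (((n : ℝ) + 1)⁻¹ * A.trace)) • (|(G x).det| ^ (1 / ((n : ℝ) + 1)) • (G x)⁻¹)
          - A * (|(G x).det| ^ (1 / ((n : ℝ) + 1)) • (G x)⁻¹)
          - (|(G x).det| ^ (1 / ((n : ℝ) + 1)) • (G x)⁻¹) * Aᵀ := by
  have hp : 0 < |(G x).det| := abs_pos.mpr h0
  have hu : IsUnit (G x).det := isUnit_iff_ne_zero.mpr h0
  have hne := eventually_det_ne_zero hG.matDiffAt h0
  have hc : ContMDiffAt (𝓡 n) 𝓘(ℝ, ℝ) ∞ (fun y => |(G y).det| ^ (1 / ((n : ℝ) + 1))) x :=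
    contMDiffAt_comp_real (φ := fun t => t ^ (1 / ((n : ℝ) + 1)))
      (Real.contDiffAt_rpow_const_of_ne hp.ne') (hG.abs_det h0)
  have hi := hG.inv h0
  have hn1 : ((n : ℝ) + 1) ≠ 0 := by positivity
  constructor
  · intro hA
    have h1 : matDeriv (fun y => (G y)⁻¹) x v = -((G x)⁻¹ * Aᵀ + A * (G x)⁻¹) := by
      rw [matDeriv_of_mul_eq_one hG.matDiffAt hi.matDiffAt
        (hne.mono fun y hy => Matrix.mul_nonsing_inv _ (isUnit_iff_ne_zero.mpr hy)), hA,
        mul_add, add_mul, ← Matrix.mul_assoc, ← Matrix.mul_assoc,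
        Matrix.nonsing_inv_mul _ hu, one_mul, Matrix.mul_assoc _ (G x),
        Matrix.mul_nonsing_inv _ hu, mul_one]
    rw [matDeriv_smul (f := fun y => |(G y).det| ^ (1 / ((n : ℝ) + 1)))
      (hc.mdifferentiableAt (by simp)) hi.matDiffAt, h1,
      mvfderiv_abs_det_rpow hG.matDiffAt h0 hA, Matrix.mul_smul, Matrix.smul_mul]
    module
  · intro hZ
    set Z : M → Matrix (Fin n) (Fin n) ℝ := fun y => |(G y).det| ^ (1 / ((n : ℝ) + 1)) • (G y)⁻¹
      with hZdef
    change matDeriv Z x v = (2 * (((n : ℝ) + 1)⁻¹ * A.trace)) • Z x - A * Z x - Z x * Aᵀ at hZ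
    have hZs : MatSmoothAt n Z x := fun i j => hc.mul (hi i j)
    have hZ0 : (Z x).det ≠ 0 := by
      rw [hZdef, Matrix.det_smul, Matrix.det_nonsing_inv, Ring.inverse_eq_inv']
      exact mul_ne_zero (pow_ne_zero _ (Real.rpow_pos_of_pos hp _).ne') (inv_ne_zero h0)
    have hZu : IsUnit (Z x).det := isUnit_iff_ne_zero.mpr hZ0
    have hW : MatSmoothAt n (fun y => |(Z y).det| • Z y) x := fun i j =>
      (hZs.abs_det hZ0).mul (hZs i j)
    have hGW : ∀ᶠ y in 𝓝 x, (|(Z y).det| • Z y) * G y = 1 := by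
      filter_upwards [hne, eventually_det_ne_zero hZs.matDiffAt hZ0] with y hy hy'
      have h2 : G y = (|(Z y).det| • Z y)⁻¹ := eq_inv_of_eq_smul_inv hy rfl
      conv_lhs => rw [h2]
      exact Matrix.mul_nonsing_inv _ (isUnit_iff_ne_zero.mpr (det_smul_abs_ne_zero hy'))
    clear_value Z
    -- The trace of Z⁻¹Z' is (2n/(n+1) - 2) tr A = -(2/(n+1)) tr A. This cancels the weight term in
    -- Z', so |det Z| Z is parallel as an unweighted tensor, and its inverse is G.
    have hd : mvfderiv (𝓡 n) (fun y => |(Z y).det|) x v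
        = -(2 * (((n : ℝ) + 1)⁻¹ * A.trace)) * |(Z x).det| := by
      rw [mvfderiv_abs_det hZs.matDiffAt hZ0, hZ, mul_sub, mul_sub, Matrix.mul_smul,
        Matrix.nonsing_inv_mul _ hZu, ← Matrix.mul_assoc, ← Matrix.mul_assoc,
        Matrix.nonsing_inv_mul _ hZu, one_mul, trace_sub, trace_sub, trace_smul, trace_one,
        Matrix.mul_assoc, Matrix.trace_mul_comm, Matrix.mul_assoc, Matrix.mul_nonsing_inv _ hZu,
        mul_one, trace_transpose, Fintype.card_fin, smul_eq_mul]
      field_simp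
      ring
    have h3 : matDeriv (fun y => |(Z y).det| • Z y) x v
        = -(A * (|(Z x).det| • Z x) + (|(Z x).det| • Z x) * Aᵀ) := by
      rw [matDeriv_smul (f := fun y => |(Z y).det|) ((hZs.abs_det hZ0).mdifferentiableAt (by simp))
        hZs.matDiffAt, hd, hZ, Matrix.mul_smul, Matrix.smul_mul]
      module
    have h4 := hGW.self_of_nhds
    have h5 : G x * (|(Z x).det| • Z x) = 1 := mul_eq_one_comm.mp h4
    rw [matDeriv_of_mul_eq_one hW.matDiffAt hG.matDiffAt hGW, h3, mul_neg, neg_mul, neg_neg,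
      mul_add, add_mul, Matrix.mul_assoc, Matrix.mul_assoc A, h4, mul_one, ← Matrix.mul_assoc (G x)
      _ Aᵀ, h5, one_mul, add_comm]

end DerivativeOfNormalisedInverse

/-! ### Block diagonal matrices and the parallel equation -/

section Diagonal

open Matrix

variable {n : ℕ} {M : Type*} [TopologicalSpace M] [ChartedSpace (EuclideanSpace ℝ (Fin n)) M]
  [IsManifold (𝓡 n) ∞ M]

/-- The block diagonal matrix with blocks `Z` and `ν`. -/
def optionBlock (Z : Matrix (Fin n) (Fin n) ℝ) (ν : ℝ) :
    Matrix (Option (Fin n)) (Option (Fin n)) ℝ :=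
  Matrix.of fun
    | none, none => ν
    | none, some _ => 0
    | some _, none => 0
    | some i, some j => Z i j

lemma optionBlock_transpose (Z : Matrix (Fin n) (Fin n) ℝ) (ν : ℝ) :
    (optionBlock Z ν)ᵀ = optionBlock Zᵀ ν := by
  ext a b
  rcases a with _ | i <;> rcases b with _ | j <;> rfl

lemma optionBlock_mul (Z Z' : Matrix (Fin n) (Fin n) ℝ) (ν ν' : ℝ) :
    optionBlock Z ν * optionBlock Z' ν' = optionBlock (Z * Z') (ν * ν') := by
  ext a b
  rw [Matrix.mul_apply, Fintype.sum_option]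
  rcases a with _ | i <;> rcases b with _ | j <;> simp [optionBlock, Matrix.mul_apply]

lemma optionBlock_one : optionBlock (1 : Matrix (Fin n) (Fin n) ℝ) 1 = 1 := by
  ext a b
  rcases a with _ | i <;> rcases b with _ | j <;> simp [optionBlock, Matrix.one_apply]

lemma optionBlock_det_ne_zero_iff {Z : Matrix (Fin n) (Fin n) ℝ} (hZ : Z.det ≠ 0) (ν : ℝ) :
    (optionBlock Z ν).det ≠ 0 ↔ ν ≠ 0 := by
  constructor
  · rintro h rfl
    refine h (Matrix.det_eq_zero_of_row_eq_zero none fun b => ?_)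
    cases b <;> rfl
  · intro hν
    have h1 : optionBlock Z ν * optionBlock Z⁻¹ ν⁻¹ = 1 := by
      rw [optionBlock_mul, Matrix.mul_nonsing_inv _ (isUnit_iff_ne_zero.mpr hZ),
        mul_inv_cancel₀ hν, optionBlock_one]
    intro h0
    have h2 := congrArg Matrix.det h1
    rw [Matrix.det_mul, h0, zero_mul, Matrix.det_one] at h2
    exact zero_ne_one h2

/-- The diagonal blocks of Γ act on Z and ν separately; the off-diagonal ones, -v and P(v, ·), enter
only the mixed block, as Z P(v, ·) - νv. Since the left side has no mixed block, this must vanish,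
and that is where the Einstein equation comes from. -/
lemma parallel_optionBlock_iff (D : AffineConnection n M) (x : M) (v : TangentSpace (𝓡 n) x)
    {Z dZ : Matrix (Fin n) (Fin n) ℝ} (hZ : Zᵀ = Z) (ν dν : ℝ) :
    optionBlock dZ dν = (tractorConnForm D x v)ᵀ * optionBlock Z ν
        + optionBlock Z ν * tractorConnForm D x v ↔
      dZ = (2 * (((n : ℝ) + 1)⁻¹ * (connForm D x v).trace)) • Z - connForm D x v * Z
          - Z * (connForm D x v)ᵀ ∧
        (Z *ᵥ fun k => schouten D x v (coordField x k x)) = (ν • fun k => coordForm x k x v) ∧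
        dν = 2 * (((n : ℝ) + 1)⁻¹ * (connForm D x v).trace) * ν := by
  have hZs : ∀ i j, Z i j = Z j i := fun i j => congrFun (congrFun hZ j) i
  have hsome : ∀ i j, ((tractorConnForm D x v)ᵀ * optionBlock Z ν
      + optionBlock Z ν * tractorConnForm D x v) (some i) (some j)
      = ((2 * (((n : ℝ) + 1)⁻¹ * (connForm D x v).trace)) • Z - connForm D x v * Z
          - Z * (connForm D x v)ᵀ) i j := by
    intro i j
    rw [Matrix.add_apply, Matrix.mul_apply, Matrix.mul_apply, Fintype.sum_option,
      Fintype.sum_option]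
    simp only [Matrix.transpose_apply, tractorConnForm, optionBlock, Matrix.of_apply, mul_zero,
      zero_mul, zero_add, Matrix.sub_apply, Matrix.smul_apply, smul_eq_mul, Matrix.mul_apply,
      sub_mul, mul_sub, Finset.sum_sub_distrib, Matrix.one_apply, mul_ite, ite_mul, mul_one,
      Finset.sum_ite_eq', Finset.mem_univ, if_true, connTrace_eq_trace]
    ring
  have hmix : ∀ i, ((tractorConnForm D x v)ᵀ * optionBlock Z ν
      + optionBlock Z ν * tractorConnForm D x v) (some i) none
      = (Z *ᵥ fun k => schouten D x v (coordField x k x)) i - ν * coordForm x i x v := by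
    intro i
    rw [Matrix.add_apply, Matrix.mul_apply, Matrix.mul_apply, Fintype.sum_option,
      Fintype.sum_option]
    simp only [Matrix.transpose_apply, tractorConnForm, optionBlock, Matrix.of_apply, mul_zero,
      zero_mul, zero_add, Finset.sum_const_zero, add_zero, mulVec, dotProduct]
    ring
  have hmix' : ∀ i, ((tractorConnForm D x v)ᵀ * optionBlock Z ν
      + optionBlock Z ν * tractorConnForm D x v) none (some i)
      = (Z *ᵥ fun k => schouten D x v (coordField x k x)) i - ν * coordForm x i x v := by
    intro i
    rw [Matrix.add_apply, Matrix.mul_apply, Matrix.mul_apply, Fintype.sum_option,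
      Fintype.sum_option]
    simp only [Matrix.transpose_apply, tractorConnForm, optionBlock, Matrix.of_apply, mul_zero,
      zero_mul, zero_add, Finset.sum_const_zero, add_zero, mulVec, dotProduct]
    rw [Finset.sum_congr rfl fun k _ => by rw [hZs k i, mul_comm]]
    ring
  have hnone : ((tractorConnForm D x v)ᵀ * optionBlock Z ν
      + optionBlock Z ν * tractorConnForm D x v) none none
      = 2 * (((n : ℝ) + 1)⁻¹ * (connForm D x v).trace) * ν := by
    rw [Matrix.add_apply, Matrix.mul_apply, Matrix.mul_apply, Fintype.sum_option,
      Fintype.sum_option]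
    simp only [Matrix.transpose_apply, tractorConnForm, optionBlock, Matrix.of_apply, mul_zero,
      zero_mul, Finset.sum_const_zero, add_zero, connTrace_eq_trace]
    ring
  constructor
  · intro h
    refine ⟨?_, ?_, ?_⟩
    · ext i j
      rw [← hsome, ← h]; rfl
    · funext i
      have := congrFun (congrFun h (some i)) none
      rw [hmix] at this
      exact (sub_eq_zero.mp this.symm)
    · rw [← hnone, ← h]; rfl
  · rintro ⟨h1, h2, h3⟩
    ext a b
    rcases a with _ | i <;> rcases b with _ | j
    · rw [hnone, ← h3]; rfl
    · rw [hmix', h2]; exact (sub_self _).symm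
    · rw [hmix, h2]; exact (sub_self _).symm
    · rw [hsome, ← h1]; rfl

end Diagonal

/-! ## The block diagonal cotractor form of a metric -/

section MetricForms

open Matrix

variable {n : ℕ} {M : Type*} [TopologicalSpace M] [ChartedSpace (EuclideanSpace ℝ (Fin n)) M]
  [IsManifold (𝓡 n) ∞ M]

/-- In the splitting given by `D`, the form `h` is the sum of the inverse metric of `g` and of
`lam` times the square of the inverse of the unit density of `g`. -/
structure IsDiagonal (D : AffineConnection n M) (h : CotractorForm n M) (g : PseudoMetric n M)
    (lam : M → ℝ) : Prop where
  symm : ∀ y, (h y).IsSymm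
  restricts : RestrictsTo h g
  mixed : ∀ y μ s, h y ((split D y).symm (μ, 0)) ((split D y).symm (0, s)) = 0
  scalar : ∀ y, h y ((split D y).symm (0, unitDensity (g.bilin y)))
    ((split D y).symm (0, unitDensity (g.bilin y))) = lam y

/-- The matrix of a block diagonal form. -/
def diagonalMatrix (x : M) (g : PseudoMetric n M) (lam : M → ℝ) (y : M) :
    Matrix (Option (Fin n)) (Option (Fin n)) ℝ :=
  optionBlock (|(gram x (g.bilin y)).det| ^ (1 / ((n : ℝ) + 1)) • (gram x (g.bilin y))⁻¹)
    (lam y * |(gram x (g.bilin y)).det| ^ (1 / ((n : ℝ) + 1)))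

variable {D : AffineConnection n M} {h : CotractorForm n M} {g : PseudoMetric n M} {lam : M → ℝ}

lemma normalised_det_ne_zero {x y : M} (hy : y ∈ frameDomain n x) (g : PseudoMetric n M) :
    (|(gram x (g.bilin y)).det| ^ (1 / ((n : ℝ) + 1)) • (gram x (g.bilin y))⁻¹).det ≠ 0 := by
  rw [Matrix.det_smul, Matrix.det_nonsing_inv, Ring.inverse_eq_inv']
  have h0 := g.gram_det_ne_zero hy
  exact mul_ne_zero (pow_ne_zero _ (Real.rpow_pos_of_pos (abs_pos.mpr h0) _).ne') (inv_ne_zero h0)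

lemma normalised_transpose (x y : M) (g : PseudoMetric n M) :
    (|(gram x (g.bilin y)).det| ^ (1 / ((n : ℝ) + 1)) • (gram x (g.bilin y))⁻¹)ᵀ
      = |(gram x (g.bilin y)).det| ^ (1 / ((n : ℝ) + 1)) • (gram x (g.bilin y))⁻¹ := by
  rw [transpose_smul, transpose_nonsing_inv, gram_transpose (g.bilin_isSymm y)]

lemma split_symm_smul_density (D : AffineConnection n M) (y : M) (r : ℝ) (s : Density n y) :
    (split D y).symm (0, r • s) = r • (split D y).symm (0, s) := by
  rw [← map_smul]
  congr 1
  exact Prod.ext (smul_zero r).symm rfl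

/-- Passing from the unit density to the coordinate density multiplies the value by the inverse
square of its coefficient, which is |det G|^(1/(n+1)). -/
lemma scalar_unitDensity (D : AffineConnection n M) (h : CotractorForm n M) (g : PseudoMetric n M)
    {x y : M} (hy : y ∈ frameDomain n x) :
    h y ((split D y).symm (0, unitDensity (g.bilin y)))
        ((split D y).symm (0, unitDensity (g.bilin y)))
        * |(gram x (g.bilin y)).det| ^ (1 / ((n : ℝ) + 1))
      = formMatrix D x h y none none := by
  have h1 := unit_rpow_mul (n := n) (abs_pos.mpr (g.gram_det_ne_zero hy))
  rw [unitDensity_eq hy, split_symm_smul_density]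
  simp only [map_smul, LinearMap.smul_apply, smul_eq_mul]
  change _ * (_ * formMatrix D x h y none none) * _ = _
  linear_combination formMatrix D x h y none none * h1

lemma IsDiagonal.formMatrix_eq (hd : IsDiagonal D h g lam) {x y : M} (hy : y ∈ frameDomain n x) :
    formMatrix D x h y = diagonalMatrix x g lam y := by
  have h1 := (restrictsAt_iff hy h (g.bilin_isSymm y) (g.bilin_nondegenerate y)).mp
    (hd.restricts y)
  have hmix : ∀ i, formMatrix D x h y (some i) none = 0 := fun i => hd.mixed y _ _
  ext a b
  rcases a with _ | i <;> rcases b with _ | j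
  · rw [← scalar_unitDensity D h g hy, hd.scalar]; rfl
  · exact ((hd.symm y).eq _ _).trans (hmix j)
  · exact hmix i
  · rw [← restrictMatrix_apply, h1]; rfl

lemma jetIncl_eq_split_symm (D : AffineConnection n M) (y : M)
    (μ : TangentSpace (𝓡 n) y →ₗ[ℝ] Density n y) : jetIncl y μ = (split D y).symm (μ, 0) := by
  rw [LinearEquiv.eq_symm_apply, split_jetIncl]

lemma mixed_eq_zero {y x : M} (hy : y ∈ frameDomain n x)
    (hmix : ∀ i, formMatrix D x h y (some i) none = 0)
    (μ : TangentSpace (𝓡 n) y →ₗ[ℝ] Density n y) (s : Density n y) :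
    h y ((split D y).symm (μ, 0)) ((split D y).symm (0, s)) = 0 := by
  rw [density_eq_smul hy s, split_symm_smul_density, map_smul, ← jetIncl_eq_split_symm,
    weightedForm_eq_sum hy μ, map_sum, map_sum, LinearMap.sum_apply, Finset.sum_eq_zero,
    smul_zero]
  intro i _
  rw [map_smul, map_smul, LinearMap.smul_apply, ← cotractorFrame_some_eq D]
  exact (congrArg _ (hmix i)).trans (smul_zero _)

lemma isDiagonal_of_formMatrix (hs : ∀ y, (h y).IsSymm)
    (hh : ∀ y, formMatrix D y h y = diagonalMatrix y g lam y) : IsDiagonal D h g lam where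
  symm := hs
  restricts := (restrictsTo_iff h g).mpr fun y => by
    rw [restrictsAt_iff (mem_frameDomain y) h (g.bilin_isSymm y) (g.bilin_nondegenerate y)]
    ext i j
    rw [restrictMatrix_apply D, hh]
    rfl
  mixed y μ s := mixed_eq_zero (mem_frameDomain y) (fun i => by rw [hh]; rfl) μ s
  scalar y := by
    have h1 := scalar_unitDensity D h g (mem_frameDomain (n := n) y)
    rw [hh] at h1
    exact mul_right_cancel₀ (Real.rpow_pos_of_pos
      (abs_pos.mpr (g.gram_det_ne_zero (mem_frameDomain (n := n) y))) _).ne' h1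

lemma cotractorForm_ext {h h' : CotractorForm n M}
    (hh : ∀ y, formMatrix D y h y = formMatrix D y h' y) : h = h' := by
  funext y
  refine LinearMap.ext fun u => LinearMap.ext fun w => ?_
  rw [cotractorForm_eq D h (mem_frameDomain y), cotractorForm_eq D h' (mem_frameDomain y), hh]

/-- The block diagonal cotractor form. -/
def diagonalForm (D : AffineConnection n M) (g : PseudoMetric n M) (lam : M → ℝ) :
    CotractorForm n M := fun y =>
  Matrix.toBilin (cotractorBasis D (mem_frameDomain y)) (diagonalMatrix y g lam y)

lemma isDiagonal_diagonalForm (D : AffineConnection n M) (g : PseudoMetric n M) (lam : M → ℝ) :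
    IsDiagonal D (diagonalForm D g lam) g lam := by
  have h1 : ∀ y, LinearMap.BilinForm.toMatrix (cotractorBasis D (mem_frameDomain y))
      (diagonalForm D g lam y) = diagonalMatrix y g lam y := fun y =>
    LinearMap.BilinForm.toMatrix_toBilin _ _
  refine isDiagonal_of_formMatrix (fun y => ?_) fun y => ?_
  · refine (LinearMap.BilinForm.isSymm_iff_basis (cotractorBasis D (mem_frameDomain y))).mpr
      fun a b => ?_
    rw [← LinearMap.BilinForm.toMatrix_apply, ← LinearMap.BilinForm.toMatrix_apply, h1]
    have h2 : (diagonalMatrix y g lam y)ᵀ = diagonalMatrix y g lam y := by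
      rw [diagonalMatrix, optionBlock_transpose, normalised_transpose]
    exact congrFun (congrFun h2 b) a
  · rw [← h1]
    ext a b
    rw [LinearMap.BilinForm.toMatrix_apply, cotractorBasis_apply, cotractorBasis_apply]
    rfl

lemma normalised_smoothAt (g : PseudoMetric n M) (x : M) :
    ContMDiffAt (𝓡 n) 𝓘(ℝ, ℝ) ∞
      (fun y => |(gram x (g.bilin y)).det| ^ (1 / ((n : ℝ) + 1))) x := by
  have h0 := g.gram_det_ne_zero (mem_frameDomain (n := n) x)
  exact contMDiffAt_comp_real (φ := fun t => t ^ (1 / ((n : ℝ) + 1)))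
    (Real.contDiffAt_rpow_const_of_ne (abs_pos.mpr h0).ne') ((g.gram_smoothAt x).abs_det h0)

lemma IsDiagonal.formMatrix_eventuallyEq (hd : IsDiagonal D h g lam) (x : M) :
    formMatrix D x h =ᶠ[𝓝 x] diagonalMatrix x g lam := by
  filter_upwards [frameDomain_mem_nhds (mem_frameDomain (n := n) x)] with y hy
    using hd.formMatrix_eq hy

/-- The block built from g is smooth because g is; what is left is λ, the last entry divided by a
smooth nonvanishing weight. -/
lemma IsDiagonal.smooth_iff (hd : IsDiagonal D h g lam) :
    CotractorFormSmooth D h ↔ ∀ x, ContMDiffAt (𝓡 n) 𝓘(ℝ, ℝ) ∞ lam x := by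
  rw [cotractorFormSmooth_iff]
  refine forall_congr' fun x => ?_
  have hc := normalised_smoothAt g x
  have h0 : ∀ y ∈ frameDomain n x, |(gram x (g.bilin y)).det| ^ (1 / ((n : ℝ) + 1)) ≠ 0 :=
    fun y hy => (Real.rpow_pos_of_pos (abs_pos.mpr (g.gram_det_ne_zero hy)) _).ne'
  constructor
  · intro hs
    have h1 : ContMDiffAt (𝓡 n) 𝓘(ℝ, ℝ) ∞ (fun y => formMatrix D x h y none none
        * (|(gram x (g.bilin y)).det| ^ (1 / ((n : ℝ) + 1)))⁻¹) x :=
      (hs none none).mul (contMDiffAt_comp_real (φ := fun t => t⁻¹)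
        (contDiffAt_inv ℝ (h0 x (mem_frameDomain x))) hc)
    refine h1.congr_of_eventuallyEq ?_
    filter_upwards [frameDomain_mem_nhds (mem_frameDomain (n := n) x)] with y hy
    rw [hd.formMatrix_eq hy]
    exact (mul_inv_cancel_right₀ (h0 y hy) (lam y)).symm
  · intro hl
    refine MatSmoothAt.congr (A := diagonalMatrix x g lam) ?_ (hd.formMatrix_eventuallyEq x)
    have hi := (g.gram_smoothAt x).inv (g.gram_det_ne_zero (mem_frameDomain (n := n) x))
    rintro (_ | i) (_ | j)
    exacts [hl.mul hc, contMDiffAt_const (c := (0 : ℝ)), contMDiffAt_const (c := (0 : ℝ)),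
      hc.mul (hi i j)]

lemma mulVec_gram (B : Π y : M, LinearMap.BilinForm ℝ (TangentSpace (𝓡 n) y)) (x : M)
    (hB : (B x).IsSymm) (v : TangentSpace (𝓡 n) x) :
    (gram x (B x) *ᵥ fun k => coordForm x k x v) = fun k => B x v (coordField x k x) := by
  funext k
  rw [← hB.eq, linearMap_eq_sum (mem_frameDomain x) (B x (coordField x k x)) v]
  simp only [mulVec, dotProduct, gram, Matrix.of_apply, smul_eq_mul]
  exact Finset.sum_congr rfl fun j _ => mul_comm _ _

/-- A block diagonal form is parallel if and only if the connection is the Levi-Civita connection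
of the metric, the Schouten tensor is proportional to the metric with factor `lam`, and `lam` is
locally constant. -/
lemma IsDiagonal.parallel_iff (hd : IsDiagonal D h g lam) (hD : IsSmoothTorsionFree D)
    (hs : CotractorFormSmooth D h) :
    CotractorFormParallel D h ↔ IsLeviCivita g D ∧ (∀ x, schouten D x = lam x • g.bilin x) ∧
      ∀ (x : M) (v : TangentSpace (𝓡 n) x), mvfderiv (𝓡 n) lam x v = 0 := by
  rw [cotractorFormParallel_iff D hs, isLeviCivita_iff g hD]
  have key : ∀ (x : M) (v : TangentSpace (𝓡 n) x),
      matDeriv (formMatrix D x h) x v = (tractorConnForm D x v)ᵀ * formMatrix D x h x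
        + formMatrix D x h x * tractorConnForm D x v ↔
      (matDeriv (fun y => gram x (g.bilin y)) x v
        = (connForm D x v)ᵀ * gram x (g.bilin x) + gram x (g.bilin x) * connForm D x v) ∧
      schouten D x v = (lam x • g.bilin x) v ∧ mvfderiv (𝓡 n) lam x v = 0 := by
    intro x v
    have hx := mem_frameDomain (n := n) x
    have hG0 := g.gram_det_ne_zero hx
    have hu : IsUnit (gram x (g.bilin x)).det := isUnit_iff_ne_zero.mpr hG0
    have hc0 : |(gram x (g.bilin x)).det| ^ (1 / ((n : ℝ) + 1)) ≠ 0 :=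
      (Real.rpow_pos_of_pos (abs_pos.mpr hG0) _).ne'
    have hGs := g.gram_smoothAt x
    have hc := normalised_smoothAt g x
    have hl := hd.smooth_iff.mp hs x
    have hdm : matDeriv (diagonalMatrix x g lam) x v = optionBlock
        (matDeriv (fun y => |(gram x (g.bilin y)).det| ^ (1 / ((n : ℝ) + 1))
          • (gram x (g.bilin y))⁻¹) x v)
        (mvfderiv (𝓡 n) (fun y => lam y * |(gram x (g.bilin y)).det| ^ (1 / ((n : ℝ) + 1))) x v)
        := by
      ext a b
      rcases a with _ | i <;> rcases b with _ | j
      exacts [rfl, mvfderiv_const_apply 0 x v, mvfderiv_const_apply 0 x v, rfl]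
    rw [matDeriv_congr (hd.formMatrix_eventuallyEq x), hdm, hd.formMatrix_eq hx, diagonalMatrix,
      parallel_optionBlock_iff D x v (normalised_transpose x x g),
      ← matDeriv_normalised_iff hGs hG0 v (connForm D x v)]
    -- The first block now says that g is parallel. The equation for λ is simplified under this
    -- assumption, since the derivative of the weight is known only then.
    refine and_congr_right fun h1 => and_congr ?_ ?_
    · have e1 : schouten D x v = (lam x • g.bilin x) v ↔
          (fun k => schouten D x v (coordField x k x))
            = lam x • (gram x (g.bilin x) *ᵥ fun k => coordForm x k x v) := by
        rw [mulVec_gram g.bilin x (g.bilin_isSymm x)]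
        constructor
        · intro h2
          rw [h2]
          rfl
        · intro h2
          refine (frameBasis hx).ext fun k => ?_
          rw [frameBasis_apply]
          exact congrFun h2 k
      rw [e1, smul_mulVec, mul_comm (lam x), mul_smul]
      constructor
      · intro h2
        -- Cancelling the common weight and multiplying by G lowers the index and turns the mixed
        -- equation into P(v, ·) = λ g(v, ·).
        have h3 := congrArg (gram x (g.bilin x) *ᵥ ·) (smul_right_injective _ hc0 h2)
        simp only [mulVec_mulVec, Matrix.mul_nonsing_inv _ hu, one_mulVec, mulVec_smul] at h3
        exact h3
      · intro h2
        rw [h2, mulVec_smul, mulVec_mulVec, Matrix.nonsing_inv_mul _ hu, one_mulVec]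
    · rw [mvfderiv_mul_apply (f := lam)
        (g := fun y => |(gram x (g.bilin y)).det| ^ (1 / ((n : ℝ) + 1)))
        (hl.mdifferentiableAt (by simp)) (hc.mdifferentiableAt (by simp)),
        mvfderiv_abs_det_rpow hGs.matDiffAt hG0 h1]
      constructor
      · intro h2
        refine (mul_eq_zero.mp (?_ : mvfderiv (𝓡 n) lam x v
          * |(gram x (g.bilin x)).det| ^ (1 / ((n : ℝ) + 1)) = 0)).resolve_right hc0
        -- The derivative of the weight accounts for the whole connection term, so only λ' times the
        -- weight remains.
        linear_combination h2
      · intro h2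
        rw [h2]
        ring
  simp only [key]
  constructor
  · intro h1
    exact ⟨fun x v => (h1 x v).1, fun x => LinearMap.ext fun v => (h1 x v).2.1,
      fun x v => (h1 x v).2.2⟩
  · rintro ⟨h1, h2, h3⟩ x v
    exact ⟨h1 x v, by rw [h2], h3 x v⟩

/-- The block coming from g is always invertible, so the determinant vanishes exactly when the last
entry, λ times a positive weight, does. -/
lemma IsDiagonal.nondegenerate_iff (hd : IsDiagonal D h g lam) (x : M) :
    (h x).Nondegenerate ↔ lam x ≠ 0 := by
  have hx := mem_frameDomain (n := n) x
  have h1 : LinearMap.BilinForm.toMatrix (cotractorBasis D hx) (h x) = formMatrix D x h x := by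
    ext a b
    rw [LinearMap.BilinForm.toMatrix_apply, cotractorBasis_apply, cotractorBasis_apply]
    rfl
  rw [LinearMap.BilinForm.nondegenerate_iff_det_ne_zero (cotractorBasis D hx), h1,
    hd.formMatrix_eq hx, diagonalMatrix, optionBlock_det_ne_zero_iff (normalised_det_ne_zero hx g),
    mul_ne_zero_iff, and_iff_left]
  exact (Real.rpow_pos_of_pos (abs_pos.mpr (g.gram_det_ne_zero hx)) _).ne'

lemma IsDiagonal.isSubmetric (hd : IsDiagonal D h g lam) : IsSubmetric h := fun x => by
  refine ⟨hd.symm x, (restrict_nondegenerate_iff (mem_frameDomain x) h (hd.symm x)).mpr ?_⟩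
  rw [(restrictsAt_iff (mem_frameDomain x) h (g.bilin_isSymm x) (g.bilin_nondegenerate x)).mp
    (hd.restricts x)]
  exact normalised_det_ne_zero (mem_frameDomain x) g

end MetricForms

/-! ## From parallel sub-metrics to Einstein metrics -/

section LocallyConstant

variable {n : ℕ} {M : Type*} [TopologicalSpace M] [ChartedSpace (EuclideanSpace ℝ (Fin n)) M]
  [IsManifold (𝓡 n) ∞ M]

/-- Read in the chart, f has zero derivative on the open chart target, so its level sets there are
open. -/
lemma isLocallyConstant_of_mvfderiv_eq_zero {f : M → ℝ}
    (hf : ∀ x, ContMDiffAt (𝓡 n) 𝓘(ℝ, ℝ) ∞ f x)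
    (h0 : ∀ (x : M) (v : TangentSpace (𝓡 n) x), mvfderiv (𝓡 n) f x v = 0) :
    IsLocallyConstant f := by
  refine (IsLocallyConstant.iff_eventually_eq f).mpr fun x => ?_
  set e := extChartAt (𝓡 n) x with he
  have ho : IsOpen e.target := isOpen_extChartAt_target x
  have hm : ∀ z ∈ e.target, HasFDerivAt (f ∘ e.symm) (0 : EuclideanSpace ℝ (Fin n) →L[ℝ] ℝ) z := by
    intro z hz
    have h1 : MDifferentiableAt 𝓘(ℝ, EuclideanSpace ℝ (Fin n)) (𝓡 n) e.symm z :=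
      (((contMDiffOn_extChartAt_symm (I := 𝓡 n) (n := ∞) x) z hz).contMDiffAt
        (ho.mem_nhds hz)).mdifferentiableAt (by simp)
    have h2 := (((hf (e.symm z)).mdifferentiableAt (by simp)).hasMFDerivAt.comp z
      h1.hasMFDerivAt).hasFDerivAt
    refine HasFDerivAt.congr_fderiv h2 ?_
    ext1 v
    exact h0 (e.symm z) _
  have h1 : IsOpen (e.target ∩ (f ∘ e.symm) ⁻¹' {f x}) :=
    ho.isOpen_inter_preimage_of_fderiv_eq_zero (𝕜 := ℝ)
      (fun z hz => (hm z hz).differentiableAt.differentiableWithinAt)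
      (fun z hz => (hm z hz).fderiv) {f x}
  have h2 : e.target ∩ (f ∘ e.symm) ⁻¹' {f x} ∈ 𝓝 (e x) :=
    h1.mem_nhds ⟨mem_extChartAt_target x, by simp [he]⟩
  filter_upwards [(continuousAt_extChartAt (I := 𝓡 n) x).preimage_mem_nhds h2,
    extChartAt_source_mem_nhds (I := 𝓡 n) x] with y hy hy'
  have h3 : f (e.symm (e y)) = f x := hy.2
  rwa [e.left_inv hy'] at h3

end LocallyConstant

/-! ### Recovering the metric and the splitting from a sub-metric -/

section SubmetricMetric

open Matrix

variable {n : ℕ} {M : Type*} [TopologicalSpace M] [ChartedSpace (EuclideanSpace ℝ (Fin n)) M]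
  [IsManifold (𝓡 n) ∞ M] {D : AffineConnection n M} {h : CotractorForm n M}

lemma IsSubmetric.det_ne_zero (hh : IsSubmetric h) {x y : M} (hy : y ∈ frameDomain n x) :
    (restrictMatrix x h y).det ≠ 0 :=
  (restrict_nondegenerate_iff hy h (hh y).1).mp (hh y).2

lemma IsSubmetric.transpose (hh : IsSubmetric h) (x y : M) :
    (restrictMatrix x h y)ᵀ = restrictMatrix x h y := by
  ext i j
  exact (hh y).1.eq _ _

lemma restrictMatrix_smoothAt (hs : CotractorFormSmooth D h) (x : M) :
    MatSmoothAt n (restrictMatrix x h) x := fun i j => by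
  simp only [restrictMatrix_apply D]
  exact (cotractorFormSmooth_iff D h).mp hs x (some i) (some j)

/-- The bilinear form on the tangent space whose inverse is the restriction of `h`. -/
def submetricBilin (h : CotractorForm n M) (y : M) :
    LinearMap.BilinForm ℝ (TangentSpace (𝓡 n) y) :=
  Matrix.toBilin (coordBasis y) (|(restrictMatrix y h y).det| • restrictMatrix y h y)⁻¹

lemma gram_submetricBilin (h : CotractorForm n M) (y : M) :
    gram y (submetricBilin h y)
      = (|(restrictMatrix y h y).det| • restrictMatrix y h y)⁻¹ := by
  rw [gram_eq_toMatrix (mem_frameDomain y)]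
  exact LinearMap.BilinForm.toMatrix_toBilin _ _

lemma submetricBilin_isSymm (hh : IsSubmetric h) (y : M) : (submetricBilin h y).IsSymm := by
  refine (LinearMap.BilinForm.isSymm_iff_basis (frameBasis (mem_frameDomain y))).mpr fun i j => ?_
  rw [frameBasis_apply, frameBasis_apply]
  have h1 : (gram y (submetricBilin h y))ᵀ = gram y (submetricBilin h y) := by
    rw [gram_submetricBilin, transpose_nonsing_inv, transpose_smul, hh.transpose]
  exact congrFun (congrFun h1 j) i

lemma submetricBilin_nondegenerate (hh : IsSubmetric h) (y : M) :
    (submetricBilin h y).Nondegenerate := by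
  rw [← gram_det_ne_zero_iff (mem_frameDomain y), gram_submetricBilin]
  exact det_inv_smul_abs_ne_zero (hh.det_ne_zero (mem_frameDomain y))

lemma restrictsAt_submetricBilin (hh : IsSubmetric h) (y : M) :
    RestrictsAt h (submetricBilin h y) :=
  (restrictsAt_iff_gram (mem_frameDomain y) h (hh.det_ne_zero (mem_frameDomain y))
    (submetricBilin_isSymm hh y) (submetricBilin_nondegenerate hh y)).mpr (gram_submetricBilin h y)

/-- The form at y is defined in the chart at y, so smoothness is not visible from the definition.
The property `RestrictsAt` does not refer to a chart and determines the form, which gives the same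
matrix formula in the fixed chart at x. -/
lemma submetricBilin_smoothAt (hh : IsSubmetric h) (hs : CotractorFormSmooth D h) (x : M) :
    MatSmoothAt n (fun y => gram x (submetricBilin h y)) x := by
  have hx := mem_frameDomain (n := n) x
  have hZ := restrictMatrix_smoothAt hs x
  have h0 := hh.det_ne_zero hx
  have h1 : MatSmoothAt n (fun y => |(restrictMatrix x h y).det| • restrictMatrix x h y) x :=
    fun i j => (hZ.abs_det h0).mul (hZ i j)
  refine (h1.inv (det_smul_abs_ne_zero h0)).congr ?_
  filter_upwards [frameDomain_mem_nhds hx] with y hy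
  exact (restrictsAt_iff_gram hy h (hh.det_ne_zero hy) (submetricBilin_isSymm hh y)
    (submetricBilin_nondegenerate hh y)).mp (restrictsAt_submetricBilin hh y)

/-- A smooth sub-metric restricts to a metric. -/
lemma exists_restrictsTo (hh : IsSubmetric h) (hs : CotractorFormSmooth D h) :
    ∃ g : PseudoMetric n M, RestrictsTo h g :=
  ⟨.ofBilin (submetricBilin h) (submetricBilin_isSymm hh) (submetricBilin_nondegenerate hh)
    (submetricBilin_smoothAt hh hs),
    (restrictsTo_iff h _).mpr fun y => restrictsAt_submetricBilin hh y⟩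

lemma RestrictsTo.unique (hh : IsSubmetric h) {g g' : PseudoMetric n M} (hg : RestrictsTo h g)
    (hg' : RestrictsTo h g') : g = g' := by
  refine PseudoMetric.ext_bilin fun y => bilin_ext_gram (mem_frameDomain y) ?_
  have h0 := hh.det_ne_zero (mem_frameDomain (n := n) y)
  rw [(restrictsAt_iff_gram (mem_frameDomain y) h h0 (g.bilin_isSymm y)
    (g.bilin_nondegenerate y)).mp (hg y), (restrictsAt_iff_gram (mem_frameDomain y) h h0
    (g'.bilin_isSymm y) (g'.bilin_nondegenerate y)).mp (hg' y)]

/-- The horizontal complement of `ℰₐ(1)` given by the one-form `θ` is orthogonal to `ℰₐ(1)` if and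
only if the components of `θ` solve a linear system. -/
lemma mixed_iff {x y : M} (hy : y ∈ frameDomain n x) (θ : TangentSpace (𝓡 n) y →ₗ[ℝ] ℝ) :
    (∀ μ s, h y ((split D y).symm (μ, 0)) ((split D y).symm (-θ.smulRight s, s)) = 0) ↔
      (restrictMatrix x h y *ᵥ fun j => θ (coordField x j y))
        = fun i => formMatrix D x h y (some i) none := by
  have h1 : ∀ s : Density n y, (split D y).symm (-θ.smulRight s, s)
      = (split D y).symm (0, s) - jetIncl y (θ.smulRight s) := by
    intro s
    rw [jetIncl_eq_split_symm D, ← map_sub]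
    congr 1
    exact Prod.ext (zero_sub _).symm (sub_zero s).symm
  have h2 : ∀ i, h y (cotractorFrame D x (some i) y)
      ((split D y).symm (-θ.smulRight (coordDensity x y), coordDensity x y))
      = formMatrix D x h y (some i) none
        - (restrictMatrix x h y *ᵥ fun j => θ (coordField x j y)) i := by
    intro i
    rw [h1, map_sub]
    congr 1
    rw [weightedForm_eq_sum hy (θ.smulRight _), map_sum, map_sum]
    simp only [mulVec, dotProduct]
    refine Finset.sum_congr rfl fun j _ => ?_
    rw [map_smul, map_smul, LinearMap.smulRight_apply, map_smul, densityCoord_coordDensity hy,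
      smul_eq_mul, smul_eq_mul, mul_one, mul_comm, cotractorFrame_some_eq]
    rfl
  constructor
  · intro hm
    funext i
    have h3 := h2 i
    rw [cotractorFrame_some_eq, jetIncl_eq_split_symm D, hm] at h3
    linarith
  · intro hm μ s
    have h3 : (split D y).symm (-θ.smulRight s, s) = densityCoord x y s •
        (split D y).symm (-θ.smulRight (coordDensity x y), coordDensity x y) := by
      rw [← map_smul]
      congr 1
      refine Prod.ext (LinearMap.ext fun v => ?_) (density_eq_smul hy s)
      conv_lhs => rw [density_eq_smul hy s]
      rw [LinearMap.neg_apply, LinearMap.smulRight_apply, smul_comm, ← smul_neg]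
      rfl
    rw [h3, map_smul, ← jetIncl_eq_split_symm, weightedForm_eq_sum hy μ, map_sum, map_sum,
      LinearMap.sum_apply, Finset.sum_eq_zero, smul_zero]
    intro i _
    rw [map_smul, map_smul, LinearMap.smul_apply, ← cotractorFrame_some_eq D, h2, hm, sub_self,
      smul_zero]

/-- By nondegeneracy the orthogonal complement of ℰₐ(1) is a graph over ℰ(1), and the components of
Υ are found by inverting `restrictMatrix`. The pointwise solution is unique, so the formula from the
chart at each point agrees with the one from a single fixed chart, where smoothness is clear. -/
lemma exists_orthogonal_oneForm (hh : IsSubmetric h) (hs : CotractorFormSmooth D h) :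
    ∃ Υ : Π x : M, TangentSpace (𝓡 n) x →L[ℝ] ℝ, (∀ x, OneFormSmoothAt Υ x) ∧
      ∀ y μ s, h y ((split D y).symm (μ, 0))
        ((split D y).symm (-(Υ y).toLinearMap.smulRight s, s)) = 0 := by
  let Υ : Π x : M, TangentSpace (𝓡 n) x →L[ℝ] ℝ := fun y => tangentCLM
    (∑ j, ((restrictMatrix y h y)⁻¹ *ᵥ fun i => formMatrix D y h y (some i) none) j
      • coordForm y j y)
  have hΥ : ∀ y μ s, h y ((split D y).symm (μ, 0))
      ((split D y).symm (-(Υ y).toLinearMap.smulRight s, s)) = 0 := by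
    intro y
    have hy := mem_frameDomain (n := n) y
    rw [mixed_iff hy]
    have h1 : (fun j => (Υ y).toLinearMap (coordField y j y))
        = (restrictMatrix y h y)⁻¹ *ᵥ fun i => formMatrix D y h y (some i) none := by
      funext k
      change (∑ j, ((restrictMatrix y h y)⁻¹ *ᵥ fun i => formMatrix D y h y (some i) none) j
        • coordForm y j y) (coordField y k y) = _
      simp [LinearMap.sum_apply, coordForm_coordField hy]
    rw [h1, mulVec_mulVec, Matrix.mul_nonsing_inv _ (isUnit_iff_ne_zero.mpr (hh.det_ne_zero hy)),
      one_mulVec]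
  refine ⟨Υ, fun x => oneFormSmoothAt_of_coordField fun k => ?_, hΥ⟩
  have hx := mem_frameDomain (n := n) x
  have hi := (restrictMatrix_smoothAt hs x).inv (hh.det_ne_zero hx)
  have hm : ∀ i, ContMDiffAt (𝓡 n) 𝓘(ℝ, ℝ) ∞ (fun y => formMatrix D x h y (some i) none) x :=
    fun i => (cotractorFormSmooth_iff D h).mp hs x (some i) none
  refine ContMDiffAt.congr_of_eventuallyEq (f := fun y =>
    ∑ j, (restrictMatrix x h y)⁻¹ k j * formMatrix D x h y (some j) none)
    (contMDiffAt_finsetSum fun j _ => (hi k j).mul (hm j)) ?_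
  filter_upwards [frameDomain_mem_nhds hx] with y hy
  have h1 := congrArg ((restrictMatrix x h y)⁻¹ *ᵥ ·)
    ((mixed_iff hy (Υ y).toLinearMap).mp (hΥ y))
  simp only [mulVec_mulVec, Matrix.nonsing_inv_mul _
    (isUnit_iff_ne_zero.mpr (hh.det_ne_zero hy)), one_mulVec] at h1
  exact congrFun h1 k

/-- Every parallel sub-metric is block diagonal in the splitting of some connection in the
projective class. -/
lemma exists_isDiagonal {p : ProjectiveStructure n M} (hh : h ∈ parallelSubmetrics p) :
    ∃ D ∈ p, ∃ (g : PseudoMetric n M) (lam : M → ℝ), IsDiagonal D h g lam := by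
  obtain ⟨D, hD⟩ := p.nonempty
  obtain ⟨g, hg⟩ := exists_restrictsTo hh.1 (hh.2 D hD).1
  obtain ⟨Υ, hΥ, hm⟩ := exists_orthogonal_oneForm hh.1 (hh.2 D hD).1
  have hc := isProjectiveChange_projectiveChange D hΥ
  refine ⟨projectiveChange D Υ, projectiveChange_mem hD hΥ, g, _, ⟨fun y => (hh.1 y).1, hg,
    fun y μ s => ?_, fun y => rfl⟩⟩
  -- The sign matters: the new splitting adds Υs to the form part, so the cotractor (-Υs | s) of the
  -- old splitting, which is orthogonal to ℰₐ(1), is (0 | s) in the new one.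
  have h1 : (split (projectiveChange D Υ) y).symm (0, s)
      = (split D y).symm (-(Υ y).toLinearMap.smulRight s, s) := by
    rw [LinearEquiv.symm_apply_eq, hc.split, LinearEquiv.apply_symm_apply]
    exact Prod.ext (neg_add_cancel _).symm rfl
  rw [h1, ← jetIncl_eq_split_symm, jetIncl_eq_split_symm D]
  exact hm y μ s

end SubmetricMetric

/-! ## The correspondence between parallel sub-metrics and Einstein metrics -/

section Correspondence

variable {n : ℕ} {M : Type*} [TopologicalSpace M] [ChartedSpace (EuclideanSpace ℝ (Fin n)) M]
  [IsManifold (𝓡 n) ∞ M]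

/-- In the splitting of the Levi-Civita connection `D` of the Einstein metric `g`, whose Schouten
tensor is `lam • g`, the form `h` is the block diagonal form given by `g` and `lam`. -/
structure IsEinsteinPair (p : ProjectiveStructure n M) (D : AffineConnection n M)
    (h : CotractorForm n M) (g : PseudoMetric n M) (lam : M → ℝ) : Prop where
  mem : D ∈ p
  diagonal : IsDiagonal D h g lam
  leviCivita : IsLeviCivita g D
  schouten_eq : ∀ x, schouten D x = lam x • g.bilin x
  locallyConstant : IsLocallyConstant lam

variable {p : ProjectiveStructure n M} {D D' : AffineConnection n M} {h h' : CotractorForm n M}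
  {g : PseudoMetric n M} {lam lam' : M → ℝ}

/-- P is a multiple of g and hence symmetric, so the skew correction in the definition of P drops
out and Ric = (n-1)P. -/
lemma IsEinsteinPair.ricci_eq (hn : 2 ≤ n) (hp : IsEinsteinPair p D h g lam) (x : M) :
    ricci D x = (((n : ℝ) - 1) * lam x) • g.bilin x := by
  refine LinearMap.ext fun v => LinearMap.ext fun w => ?_
  have h1 := schouten_spec hn D x v w
  rw [hp.schouten_eq] at h1
  simp only [LinearMap.smul_apply, smul_eq_mul] at h1 ⊢
  rw [(g.bilin_isSymm x).eq v w] at h1 ⊢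
  linarith

lemma IsEinsteinPair.mem_einsteinMetrics (hn : 2 ≤ n) (hp : IsEinsteinPair p D h g lam) :
    g ∈ einsteinMetrics p := by
  refine ⟨⟨D, hp.leviCivita, fun x => ((n : ℝ) - 1) * lam x,
    hp.locallyConstant.comp fun t => ((n : ℝ) - 1) * t, fun x v w => ?_⟩, D, hp.mem, hp.leviCivita⟩
  rw [hp.ricci_eq hn]
  rfl

lemma exists_bilin_ne_zero (hn : 2 ≤ n) (g : PseudoMetric n M) (x : M) :
    ∃ v w, g.bilin x v w ≠ 0 := by
  by_contra! h0
  have h1 := g.nondegenerate x (coordField x ⟨0, by omega⟩ x) fun w => h0 _ w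
  have h2 := coordForm_coordField (mem_frameDomain (n := n) x) ⟨0, by omega⟩ ⟨0, by omega⟩
  rw [h1, map_zero] at h2
  simp at h2

/-- Any Levi-Civita connection of g has the Ricci tensor (n-1)λg of `D`, by uniqueness; as n ≥ 2,
neither n - 1 nor g vanishes. -/
lemma IsEinsteinPair.isRicciFlatAt_iff [T2Space M] (hn : 2 ≤ n)
    (hp : IsEinsteinPair p D h g lam) (x : M) : IsRicciFlatAt g x ↔ lam x = 0 := by
  constructor
  · rintro ⟨D', hD', h0⟩
    rw [ricci_congr hp.leviCivita.1 (hp.leviCivita.unique hD'), hp.ricci_eq hn] at h0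
    obtain ⟨v, w, hvw⟩ := exists_bilin_ne_zero hn g x
    have h1 := congrArg (fun B : LinearMap.BilinForm ℝ (TangentSpace (𝓡 n) x) => B v w) h0
    have hn' : (n : ℝ) - 1 ≠ 0 := by
      have : (2 : ℝ) ≤ n := by exact_mod_cast hn
      linarith
    have h2 : ((n : ℝ) - 1) * lam x * g.bilin x v w = 0 := h1
    simpa [hn', hvw] using h2
  · intro h0
    refine ⟨D, hp.leviCivita, ?_⟩
    rw [hp.ricci_eq hn, h0, mul_zero, zero_smul]

lemma IsEinsteinPair.nondegenerate_iff [T2Space M] (hn : 2 ≤ n)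
    (hp : IsEinsteinPair p D h g lam) (x : M) : (h x).Nondegenerate ↔ ¬ IsRicciFlatAt g x := by
  rw [hp.isRicciFlatAt_iff hn, hp.diagonal.nondegenerate_iff]

/-- The three equations hold for the Levi-Civita connection itself, and projective invariance
extends parallelism to all of `p`. -/
lemma IsEinsteinPair.mem_parallelSubmetrics [T2Space M] (hn : 2 ≤ n)
    (hp : IsEinsteinPair p D h g lam) : h ∈ parallelSubmetrics p := by
  have hc : ∀ x, lam =ᶠ[𝓝 x] fun _ => lam x :=
    (IsLocallyConstant.iff_eventually_eq lam).mp hp.locallyConstant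
  have hs : CotractorFormSmooth D h := hp.diagonal.smooth_iff.mpr fun x =>
    contMDiffAt_const.congr_of_eventuallyEq (hc x)
  refine ⟨hp.diagonal.isSubmetric, cotractorForm_parallel_of_mem hn p hp.mem hs ?_⟩
  refine (hp.diagonal.parallel_iff hp.leviCivita.1 hs).mpr
    ⟨hp.leviCivita, hp.schouten_eq, fun x v => ?_⟩
  rw [mvfderiv_congr_nhds (hc x), mvfderiv_const_apply]

lemma exists_isEinsteinPair_of_submetric (hh : h ∈ parallelSubmetrics p) :
    ∃ D g lam, IsEinsteinPair p D h g lam := by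
  obtain ⟨D, hD, g, lam, hd⟩ := exists_isDiagonal hh
  obtain ⟨hs, hpar⟩ := hh.2 D hD
  obtain ⟨h1, h2, h3⟩ := (hd.parallel_iff (p.smooth D hD) hs).mp hpar
  exact ⟨D, g, lam, hD, hd, h1, h2, isLocallyConstant_of_mvfderiv_eq_zero (hd.smooth_iff.mp hs) h3⟩

lemma exists_isEinsteinPair_of_metric [T2Space M] (hn : 2 ≤ n) (hg : g ∈ einsteinMetrics p) :
    ∃ D h lam, IsEinsteinPair p D h g lam := by
  obtain ⟨⟨D', hD', c, hc, hric⟩, D, hD, hLC⟩ := hg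
  -- For a symmetric Ricci tensor P = Ric/(n-1), so Ric = cg forces λ = c/(n-1).
  refine ⟨D, diagonalForm D g fun x => ((n : ℝ) - 1)⁻¹ * c x, fun x => ((n : ℝ) - 1)⁻¹ * c x, hD,
    isDiagonal_diagonalForm D g _, hLC, fun x => LinearMap.ext fun v => LinearMap.ext fun w => ?_,
    hc.comp fun t => ((n : ℝ) - 1)⁻¹ * t⟩
  -- The Einstein condition and membership in `p` may name two different connections; by uniqueness
  -- these have equal Ricci tensors.
  have h1 : ∀ v w, ricci D x v w = c x * g.bilin x v w := fun v w => by
    rw [← ricci_congr hLC.1 (hLC.unique hD') x]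
    exact hric x v w
  have hn' : (2 : ℝ) ≤ n := by exact_mod_cast hn
  have h2 : (n : ℝ) - 1 ≠ 0 := by linarith
  have h3 : (n : ℝ) + 1 ≠ 0 := by linarith
  simp only [schouten, LinearMap.smul_apply, LinearMap.add_apply, LinearMap.flip_apply, h1,
    smul_eq_mul]
  rw [(g.bilin_isSymm x).eq w v, show (n : ℝ) ^ 2 - 1 = (n - 1) * (n + 1) by ring]
  field_simp

/-- The two connections agree on differentiable fields, hence have the same Schouten tensor, which
fixes λ since g ≠ 0, and the same splitting. Splitting, g and λ determine every entry of the matrix.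
-/
lemma IsEinsteinPair.form_unique [T2Space M] (hn : 2 ≤ n) (hp : IsEinsteinPair p D h g lam)
    (hp' : IsEinsteinPair p D' h' g lam') : h = h' := by
  have hu := hp.leviCivita.unique hp'.leviCivita
  have hlam : lam = lam' := by
    funext x
    obtain ⟨v, w, hvw⟩ := exists_bilin_ne_zero hn g x
    have h1 := hp'.schouten_eq x
    rw [schouten_congr hp.leviCivita.1 hu, hp.schouten_eq] at h1
    exact mul_right_cancel₀ hvw
      (congrArg (fun B : LinearMap.BilinForm ℝ (TangentSpace (𝓡 n) x) => B v w) h1)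
  have hd : IsDiagonal D h' g lam := by
    have := hp'.diagonal
    rw [← hlam] at this
    obtain ⟨h1, h2, h3, h4⟩ := this
    simp only [split_congr hu] at h3 h4
    exact ⟨h1, h2, h3, h4⟩
  refine cotractorForm_ext (D := D) fun y => ?_
  rw [hp.diagonal.formMatrix_eq (mem_frameDomain y), hd.formMatrix_eq (mem_frameDomain y)]

/-- The bijection between parallel sub-metrics and Einstein metrics. -/
lemma exists_equiv_einsteinMetrics [T2Space M] (hn : 2 ≤ n) (p : ProjectiveStructure n M) :
    ∃ F : parallelSubmetrics p ≃ einsteinMetrics p,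
      ∀ h : parallelSubmetrics p, ∃ D lam, IsEinsteinPair p D h.1 (F h).1 lam := by
  choose D g lam hp using fun h : parallelSubmetrics p => exists_isEinsteinPair_of_submetric h.2
  let f : parallelSubmetrics p → einsteinMetrics p :=
    fun h => ⟨g h, (hp h).mem_einsteinMetrics hn⟩
  have hf : Function.Bijective f := by
    constructor
    · intro h h' hhh
      have h1 : g h = g h' := congrArg Subtype.val hhh
      have h2 := hp h'
      rw [← h1] at h2
      exact Subtype.ext ((hp h).form_unique hn h2)
    · rintro ⟨g', hg'⟩
      obtain ⟨D', h, lam', hp'⟩ := exists_isEinsteinPair_of_metric hn hg'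
      refine ⟨⟨h, hp'.mem_parallelSubmetrics hn⟩, Subtype.ext ?_⟩
      -- The metric chosen for this form need not a priori be the given one, but a sub-metric
      -- restricts to only one metric.
      exact RestrictsTo.unique hp'.diagonal.isSubmetric (hp ⟨h, _⟩).diagonal.restricts
        hp'.diagonal.restricts
  exact ⟨Equiv.ofBijective f hf, fun h => ⟨D h, lam h, hp h⟩⟩

end Correspondence

/-! ## Inverse forms on the tractor bundle -/

section InverseForms

open Matrix

/-- Transport B along the isomorphism of V with its dual that B defines. -/
lemma exists_inverse_bilinForm {V : Type*} [AddCommGroup V] [Module ℝ V] [Module.Finite ℝ V]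
    {B : LinearMap.BilinForm ℝ V} (hB : B.Nondegenerate) (hs : B.IsSymm) :
    ∃ C : LinearMap.BilinForm ℝ (Module.Dual ℝ V), C.IsSymm ∧ C.Nondegenerate ∧
      ∀ u w, C (B u) (B w) = B u w := by
  let e := B.toDual hB
  have he : ∀ u, e u = B u := fun u => rfl
  refine ⟨B.compl₁₂ e.symm.toLinearMap e.symm.toLinearMap, ⟨fun φ ψ => hs.eq _ _⟩, ⟨?_, ?_⟩, ?_⟩
  · intro φ hφ
    rw [← e.symm.map_eq_zero_iff]
    refine hB.1 _ fun w => ?_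
    have := hφ (e w)
    simpa using this
  · intro φ hφ
    rw [← e.symm.map_eq_zero_iff]
    refine hB.2 _ fun w => ?_
    have := hφ (e w)
    simpa using this
  · intro u w
    have h1 : ∀ u, e.symm (B u) = u := fun u => e.symm_apply_apply u
    rw [LinearMap.compl₁₂_apply, LinearEquiv.coe_coe, h1, h1]

variable {n : ℕ} {M : Type*} [TopologicalSpace M] [ChartedSpace (EuclideanSpace ℝ (Fin n)) M]
  [IsManifold (𝓡 n) ∞ M] {D : AffineConnection n M} {h : CotractorForm n M} {H H' : TractorForm n M}

/-- In finite dimension a nondegenerate form reaches every functional, so φ may be taken to be h(u,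
·). -/
lemma AreInverse.apply (D : AffineConnection n M) (hH : AreInverse h H) {x : M} (φ : Tractor n x)
    (w : Cotractor n x) : H x φ (h x w) = φ w := by
  have := finite_cotractor D x
  obtain ⟨u, rfl⟩ : ∃ u, h x u = φ :=
    ⟨((h x).toDual (hH x).1).symm φ, ((h x).toDual (hH x).1).apply_symm_apply φ⟩
  exact (hH x).2.2 u w

lemma AreInverse.form_unique (D : AffineConnection n M) {h' : CotractorForm n M}
    (hh : AreInverse h H) (hh' : AreInverse h' H) : h = h' := by
  funext x
  refine LinearMap.ext fun w => sub_eq_zero.mp ((hh x).2.1.2 _ fun φ => ?_)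
  rw [map_sub, hh.apply D, hh'.apply D, sub_self]

lemma AreInverse.unique (D : AffineConnection n M) (hH : AreInverse h H) (hH' : AreInverse h H') :
    H = H' := by
  funext x
  refine LinearMap.ext fun φ => LinearMap.ext fun ψ => ?_
  have := finite_cotractor D x
  obtain ⟨w, rfl⟩ : ∃ w, h x w = ψ :=
    ⟨((h x).toDual (hH x).1).symm ψ, ((h x).toDual (hH x).1).apply_symm_apply ψ⟩
  rw [hH.apply D, hH'.apply D]

/-- On the frame the inverse relation reads m K m = m, and nondegeneracy allows m to be cancelled.
Symmetry identifies m with its transpose. -/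
lemma AreInverse.mul_eq_one (hH : AreInverse h H) (hs : ∀ y, (h y).IsSymm) {x y : M}
    (hy : y ∈ frameDomain n x) : formMatrix D x h y * tractorFormMatrix D x H y = 1 := by
  set m := formMatrix D x h y
  set K := tractorFormMatrix D x H y
  have hmt : mᵀ = m := by
    ext a b
    exact (hs y).eq _ _
  have h1 : m * K * m = m := by
    ext a b
    have h2 := (hH y).2.2 (cotractorFrame D x a y) (cotractorFrame D x b y)
    rw [tractorForm_eq D H hy] at h2
    refine Eq.trans ?_ h2
    have h3 : (fun c => h y (cotractorFrame D x b y) (cotractorFrame D x c y)) = fun c => m c b := by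
      funext c
      exact (hs y).eq _ _
    rw [h3, Matrix.mul_assoc]
    rfl
  have hm : IsUnit m.det := by
    have h4 : LinearMap.BilinForm.toMatrix (cotractorBasis D hy) (h y) = m := by
      ext a b
      rw [LinearMap.BilinForm.toMatrix_apply, cotractorBasis_apply, cotractorBasis_apply]
      rfl
    rw [isUnit_iff_ne_zero, ← h4]
    exact (LinearMap.BilinForm.nondegenerate_iff_det_ne_zero (cotractorBasis D hy)).mp (hH y).1
  have h5 := congrArg (· * m⁻¹) h1
  simp only [Matrix.mul_assoc, Matrix.mul_nonsing_inv _ hm, mul_one] at h5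
  exact h5

omit [IsManifold (𝓡 n) ∞ M] in
lemma matSmoothAt_of_mul_eq_one {ι : Type*} [Fintype ι] [DecidableEq ι] {A B : M → Matrix ι ι ℝ}
    {x : M} (hA : MatSmoothAt n A x) (hAB : ∀ᶠ y in 𝓝 x, A y * B y = 1) : MatSmoothAt n B x := by
  have h0 : (A x).det ≠ 0 := by
    intro h0
    have := congrArg Matrix.det hAB.self_of_nhds
    rw [Matrix.det_mul, h0, zero_mul, Matrix.det_one] at this
    exact zero_ne_one this
  exact (hA.inv h0).congr (hAB.mono fun y hy => (Matrix.inv_eq_right_inv hy).symm)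

lemma AreInverse.eventually_mul_eq_one (D : AffineConnection n M) (hH : AreInverse h H)
    (hs : ∀ y, (h y).IsSymm) (x : M) :
    ∀ᶠ y in 𝓝 x, formMatrix D x h y * tractorFormMatrix D x H y = 1 := by
  filter_upwards [frameDomain_mem_nhds (mem_frameDomain (n := n) x)] with y hy
    using hH.mul_eq_one hs hy

lemma AreInverse.smooth_iff (hH : AreInverse h H) (hs : ∀ y, (h y).IsSymm) :
    CotractorFormSmooth D h ↔ TractorFormSmooth D H := by
  rw [cotractorFormSmooth_iff, tractorFormSmooth_iff]
  exact ⟨fun hh x => matSmoothAt_of_mul_eq_one (hh x) (hH.eventually_mul_eq_one D hs x),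
    fun hh x => matSmoothAt_of_mul_eq_one (hh x)
      ((hH.eventually_mul_eq_one D hs x).mono fun y hy => mul_eq_one_comm.mp hy)⟩

/-- For K = m⁻¹ one has K' = -K m' K. Inserting m' = Γᵀm + mΓ gives K' = -(KΓᵀ + ΓK), the parallel
equation for -Γᵀ; exchanging m and K gives the converse. -/
lemma AreInverse.parallel_iff (hH : AreInverse h H) (hs : ∀ y, (h y).IsSymm)
    (hsm : CotractorFormSmooth D h) : CotractorFormParallel D h ↔ TractorFormParallel D H := by
  have hsm' := (hH.smooth_iff hs).mp hsm
  rw [cotractorFormParallel_iff D hsm, tractorFormParallel_iff D hsm']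
  refine forall_congr' fun x => forall_congr' fun v => ?_
  have hm := ((cotractorFormSmooth_iff D h).mp hsm x).matDiffAt
  have hK := ((tractorFormSmooth_iff D H).mp hsm' x).matDiffAt
  have e1 := hH.eventually_mul_eq_one D hs x
  have e2 : ∀ᶠ y in 𝓝 x, tractorFormMatrix D x H y * formMatrix D x h y = 1 :=
    e1.mono fun y hy => mul_eq_one_comm.mp hy
  have u1 := e1.self_of_nhds
  have u2 := e2.self_of_nhds
  have l1 : ∀ X, formMatrix D x h x * (tractorFormMatrix D x H x * X) = X := fun X => by
    rw [← Matrix.mul_assoc, u1, one_mul]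
  have l2 : ∀ X, tractorFormMatrix D x H x * (formMatrix D x h x * X) = X := fun X => by
    rw [← Matrix.mul_assoc, u2, one_mul]
  constructor
  · intro hp
    rw [matDeriv_of_mul_eq_one hm hK e1, hp]
    simp only [Matrix.transpose_neg, Matrix.transpose_transpose, mul_add, add_mul,
      Matrix.mul_assoc, l2, u1, mul_one, Matrix.neg_mul, Matrix.mul_neg]
    abel
  · intro hp
    rw [matDeriv_of_mul_eq_one hK hm e2, hp]
    simp only [Matrix.transpose_neg, Matrix.transpose_transpose, mul_add, add_mul,
      Matrix.mul_assoc, l1, u2, mul_one, Matrix.neg_mul, Matrix.mul_neg]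
    abel

lemma exists_areInverse (D : AffineConnection n M) (hn : ∀ x, (h x).Nondegenerate)
    (hs : ∀ x, (h x).IsSymm) : ∃ H : TractorForm n M, (∀ x, (H x).IsSymm) ∧ AreInverse h H := by
  have h1 : ∀ x, ∃ C : LinearMap.BilinForm ℝ (Tractor n x), C.IsSymm ∧ C.Nondegenerate ∧
      ∀ u w, C (h x u) (h x w) = h x u w := fun x => by
    have := finite_cotractor D x
    exact exists_inverse_bilinForm (hn x) (hs x)
  choose H hH using h1
  exact ⟨H, fun x => (hH x).1, fun x => ⟨hn x, (hH x).2⟩⟩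

lemma mem_parallelSubmetrics_of_areInverse {p : ProjectiveStructure n M}
    (hH : H ∈ parallelTractorMetrics p) (hi : AreInverse h H) (hh : IsSubmetric h) :
    h ∈ parallelSubmetrics p := by
  refine ⟨hh, fun D hD => ?_⟩
  have hs := fun y => (hh y).1
  have h1 := (hi.smooth_iff hs).mpr (hH.2.1 D hD).1
  exact ⟨h1, (hi.parallel_iff hs h1).mpr (hH.2.1 D hD).2⟩

lemma mem_parallelTractorMetrics_of_areInverse {p : ProjectiveStructure n M}
    (hh : h ∈ parallelSubmetrics p) (hi : AreInverse h H) (hs : ∀ x, (H x).IsSymm) :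
    H ∈ parallelTractorMetrics p := by
  refine ⟨fun x => ⟨hs x, (hi x).2.1⟩, fun D hD => ?_, h, hi, hh.1⟩
  have hs' := fun y => (hh.1 y).1
  exact ⟨(hi.smooth_iff hs').mp (hh.2 D hD).1,
    (hi.parallel_iff hs' (hh.2 D hD).1).mp (hh.2 D hD).2⟩

end InverseForms

end ProjTractor
end

/-! ### The two correspondences -/

theorem theorem3p1 {n : ℕ} (hn : 2 ≤ n) {M : Type*} [TopologicalSpace M] [T2Space M]
    [ChartedSpace (EuclideanSpace ℝ (Fin n)) M] [IsManifold (𝓡 n) ∞ M]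
    (p : ProjectiveStructure n M) :
    ∃ F : parallelSubmetrics p ≃ einsteinMetrics p,
      (∀ h : parallelSubmetrics p, RestrictsTo h.1 (F h).1) ∧
      (∀ (h : parallelSubmetrics p) (x : M),
        (h.1 x).Nondegenerate ↔ ¬ IsRicciFlatAt (F h).1 x) ∧
      (PreconnectedSpace M → ∀ h : parallelSubmetrics p,
        ¬ (∀ x : M, IsRicciFlatAt (F h).1 x) → ∀ x : M, (h.1 x).Nondegenerate) ∧
      ∃ G : parallelTractorMetrics p ≃
          {g : PseudoMetric n M // g ∈ einsteinMetrics p ∧ ∀ x : M, ¬ IsRicciFlatAt g x},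
        ∀ H : parallelTractorMetrics p, ∃ h : parallelSubmetrics p,
          AreInverse h.1 H.1 ∧ (F h).1 = (G H).1 := by
  obtain ⟨F, hF⟩ := exists_equiv_einsteinMetrics hn p
  have hnd : ∀ (h : parallelSubmetrics p) (x : M),
      (h.1 x).Nondegenerate ↔ ¬ IsRicciFlatAt (F h).1 x := fun h x => by
    obtain ⟨D, lam, hp⟩ := hF h
    exact hp.nondegenerate_iff hn x
  refine ⟨F, fun h => ?_, hnd, fun _ h hR x => ?_, ?_⟩
  · obtain ⟨D, lam, hp⟩ := hF h
    exact hp.diagonal.restricts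
  · obtain ⟨D, lam, hp⟩ := hF h
    push Not at hR
    obtain ⟨y, hy⟩ := hR
    rw [hp.isRicciFlatAt_iff hn] at hy
    -- On a connected manifold λ is constant, so being nonzero at one point y makes it nonzero
    -- everywhere.
    rw [hp.diagonal.nondegenerate_iff, hp.locallyConstant.apply_eq_of_preconnectedSpace x y]
    exact hy
  -- Any connection will do: it only supplies a frame, and with it finite dimension of the fibres.
  · obtain ⟨D₀, -⟩ := p.nonempty
    have hex : ∀ H : parallelTractorMetrics p, ∃ h : parallelSubmetrics p, AreInverse h.1 H.1 :=
      fun H => by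
        obtain ⟨h, hi, hh⟩ := H.2.2.2
        exact ⟨⟨h, mem_parallelSubmetrics_of_areInverse H.2 hi hh⟩, hi⟩
    choose k hk using hex
    let G : parallelTractorMetrics p →
        {g : PseudoMetric n M // g ∈ einsteinMetrics p ∧ ∀ x : M, ¬ IsRicciFlatAt g x} :=
      fun H => ⟨(F (k H)).1, (F (k H)).2, fun x => (hnd (k H) x).mp (hk H x).1⟩
    have hG : Function.Bijective G := by
      constructor
      · intro H H' hHH
        have h0 := congrArg Subtype.val hHH
        have h1 : k H = k H' := F.injective (Subtype.ext h0)
        have h2 := hk H'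
        rw [← h1] at h2
        exact Subtype.ext ((hk H).unique D₀ h2)
      · rintro ⟨g, hg, hg'⟩
        obtain ⟨h, hh⟩ := F.surjective ⟨g, hg⟩
        have hns : ∀ x, (h.1 x).Nondegenerate := fun x => (hnd h x).mpr (by rw [hh]; exact hg' x)
        obtain ⟨H, hs, hi⟩ := exists_areInverse D₀ hns fun x => (h.2.1 x).1
        let H₁ : parallelTractorMetrics p :=
          ⟨H, mem_parallelTractorMetrics_of_areInverse h.2 hi hs⟩
        refine ⟨H₁, Subtype.ext ?_⟩
        -- The sub-metric was chosen for each tractor form; since a form has only one inverse, the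
        -- choice returns the sub-metric that was inverted.
        have h1 : k H₁ = h := Subtype.ext ((hk H₁).form_unique D₀ hi)
        change (F (k H₁)).1 = g
        rw [h1, hh]
    exact ⟨Equiv.ofBijective G hG, fun H => ⟨k H, hk H, rfl⟩⟩
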